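/- Let $\mathbf{k}$ be an arbitrary field. An endomorphism of $\mathbb{A}^n=\mathbb{A}^n_{\mathbf k}$ is a tuple $f=(f_1,\dots,f_n)$ of polynomials in $\mathbf{k}[x_1,\dots,x_n]$; endomorphisms form a monoid under composition, and $\mathrm{Aut}(\mathbb{A}^n)$ is its group of invertible elements. Put $\deg f=\max_i\deg f_i$, and let $\lambda(f)=\lim_{r\to\infty}\deg(f^r)^{1/r}$ be the dynamical degree. Call $f$ triangular if $f_i\in\mathbf{k}[x_1,\dots,x_i]$ for each $i$; affine-triangular if $f=\alpha\circ\tau$ with $\tau$ a triangular endomorphism and $\alpha$ an automorphism of degree $1$; permutation-triangular if $f=\alpha\circ\tau$ with $\tau$ a triangular endomorphism and $\alpha$ a permutation of the coordinates. For $\mu\in(\mathbb{R}_{\ge0})^n\setminus\{0\}$ and a polynomial $p\ne0$, let $\deg_\mu(p)$ be the maximum of $\sum_i a_i\mu_i$ over the monomials $x_1^{a_1}\cdots x_n^{a_n}$ with nonzero coefficient in $p$, and $\deg_\mu(0)=-\infty$. Let $\deg_\mu(f)=\inf\{\theta\ge0 : \deg_\mu(f_i)\le\theta\mu_i\ \text{for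 all } i\}\in[0,\infty]$ (with $\inf\emptyset=\infty$). Say that $f$ is $\mu$-algebraically stable if $\deg_\mu(f)<\infty$ and $\deg_\mu(f^r)=\deg_\mu(f)^r$ for all $r\ge1$. A matrix $M=(m_{ij})\in\mathrm{Mat}_n(\mathbb{N})$ is contained in $f$ if for each $i$ the monomial $\prod_j x_j^{m_{ij}}$ has nonzero coefficient in $f_i$. For $f$ with all $f_i\neq 0$, the maximal eigenvalue of $f$ is the maximum $\theta$ of $|\xi|$ over all complex eigenvalues $\xi$ of matrices contained in $f$; a maximal eigenvector of $f$ is a $\mu\in(\mathbb{R}_{\ge0})^n\setminus\{0\}$ with $\deg_\mu(f_i)=\theta\mu_i$ for all $i$. A Handelman number is a positive real root of a monic integral polynomial all of whose non-leading coefficients are non-positive. **Proposition D.** Every affine-triangular automorphism $f\in\mathrm{Aut}(\mathbb{A}^3)$ is conjugate in $\mathrm{Aut}(\mathbb{A}^3)$ to a permutation-triangular automorphism $f'\in\mathrm{Aut}(\mathbb{A}^3)$ such that $\deg(f')\le\deg(f)$ and such that either the maximal eigenvalue $\theta$ of $f'$ is equal to $1$, or $f'$ is $\mu$-algebraically stable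 for each maximal eigenvector $\mu$ of $f'$. Moreover, the dynamical degrees $\lambda(f)$ and $\lambda(f')$ are both equal to the maximal eigenvalue $\theta$ of $f'$, which is a Handelman number. -/

import Mathlib

open scoped NNReal ENNReal Topology

noncomputable section

/-- Endomorphisms `f = (f₁, …, fₙ)` of the affine space `𝔸ⁿ` over `k`: `n`-tuples of polynomials
in `k[x₁, …, xₙ]` (indexed by `Fin n`). -/
def AffEnd (k : Type*) [CommSemiring k] (n : ℕ) : Type _ :=
  Fin n → MvPolynomial (Fin n) k

namespace AffEnd

variable {k : Type*} [Field k] {n : ℕ}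

/-- The composition `f ∘ g = (f₁(g₁, …, gₙ), …, fₙ(g₁, …, gₙ))`. -/
def comp (f g : AffEnd k n) : AffEnd k n :=
  fun i => MvPolynomial.bind₁ g (f i)

/-- The monoid `End(𝔸ⁿ)`: multiplication is composition, the unit is `(x₁, …, xₙ)`.
Its units are the automorphisms of `𝔸ⁿ`, and `f ^ r` is the `r`-th iterate of `f`. -/
instance : Monoid (AffEnd k n) where
  mul := comp
  one := fun i => MvPolynomial.X i
  mul_assoc f g h := by
    funext i
    exact MvPolynomial.bind₁_bind₁ g h (f i)
  one_mul f := by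
    funext i
    exact MvPolynomial.bind₁_X_right f i
  mul_one f := by
    funext i
    exact congrArg (fun φ => φ (f i)) (MvPolynomial.bind₁_X_left (σ := Fin n) (R := k))

/-- `deg(f) = max(deg(f₁), …, deg(fₙ))`. -/
def degree (f : AffEnd k n) : ℕ :=
  Finset.univ.sup fun i => (f i).totalDegree

/-- `f` is an automorphism of `𝔸ⁿ`. -/
def IsAut (f : AffEnd k n) : Prop := IsUnit f

/-- `f` is triangular: `fᵢ ∈ k[x₁, …, xᵢ]` for each `i`. -/
def IsTriangular (f : AffEnd k n) : Prop :=
  ∀ i, f i ∈ MvPolynomial.supported k (Set.Iic i)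

/-- `f` is an affine automorphism. -/
def IsAffineAut (f : AffEnd k n) : Prop :=
  f.IsAut ∧ f.degree = 1

/-- `f` is a permutation of the coordinates. -/
def IsCoordPerm (f : AffEnd k n) : Prop :=
  ∃ σ : Equiv.Perm (Fin n), ∀ i, f i = MvPolynomial.X (σ i)

/-- `f = α ∘ τ` with `α` an affine automorphism and `τ` a triangular endomorphism. -/
def IsAffineTriangular (f : AffEnd k n) : Prop :=
  ∃ α τ : AffEnd k n, α.IsAffineAut ∧ τ.IsTriangular ∧ f = α * τ

/-- `f = α ∘ τ` with `α` a permutation of the coordinates and `τ` a triangular endomorphism. -/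
def IsPermTriangular (f : AffEnd k n) : Prop :=
  ∃ α τ : AffEnd k n, α.IsCoordPerm ∧ τ.IsTriangular ∧ f = α * τ

/-- `lam` is the dynamical degree of `f`: `deg(f ^ r) ^ (1 / r)` tends to `lam` as `r → ∞`. -/
def HasDynamicalDegree (f : AffEnd k n) (lam : ℝ) : Prop :=
  Filter.Tendsto (fun r : ℕ => ((f ^ r).degree : ℝ) ^ (1 / (r : ℝ))) Filter.atTop (𝓝 lam)

/-- The `μ`-degree of an endomorphism: the infimum of all `θ ≥ 0` with `deg_μ(fᵢ) ≤ θ μᵢ` for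
each `i`, which is `∞` if there is no such `θ`. The `μ`-degree of a polynomial, with value `-∞`
at `0`, is `MvPolynomial.weightedTotalDegree'`. -/
def muDegree (μ : Fin n → ℝ≥0) (f : AffEnd k n) : ℝ≥0∞ :=
  ⨅ (θ : ℝ≥0) (_ : ∀ i, MvPolynomial.weightedTotalDegree' μ (f i)
    ≤ ((θ * μ i : ℝ≥0) : WithBot ℝ≥0)), (θ : ℝ≥0∞)

/-- `f` is `μ`-algebraically stable. -/
def IsMuAlgStable (μ : Fin n → ℝ≥0) (f : AffEnd k n) : Prop :=
  f.muDegree μ < ⊤ ∧ ∀ r : ℕ, 1 ≤ r → (f ^ r).muDegree μ = f.muDegree μ ^ r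

/-- The matrix `M` is contained in `f`: for each `i`, the coefficient of the monomial
`∏ⱼ xⱼ ^ (M i j)` in `fᵢ` is nonzero. -/
def ContainsMatrix (f : AffEnd k n) (M : Matrix (Fin n) (Fin n) ℕ) : Prop :=
  ∀ i, MvPolynomial.coeff (Finsupp.equivFunOnFinite.symm (M i)) (f i) ≠ 0

/-- `θ` is the maximal eigenvalue of `f`: the maximum of `|ξ|`, where `ξ` runs over the complex
eigenvalues of the matrices contained in `f`. -/
def IsMaximalEigenvalue (f : AffEnd k n) (θ : ℝ≥0) : Prop :=
  IsGreatest {t : ℝ≥0 | ∃ M : Matrix (Fin n) (Fin n) ℕ, f.ContainsMatrix M ∧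
    ∃ ξ : ℂ, Module.End.HasEigenvalue
      (Matrix.toLin' (M.map (fun m : ℕ => (m : ℂ)))) ξ ∧ t = ‖ξ‖₊} θ

/-- `μ` is a maximal eigenvector of `f`: `μ ≠ 0` has non-negative entries and
`deg_μ(fᵢ) = θ μᵢ` for each `i`, where `θ` is the maximal eigenvalue of `f`. -/
def IsMaximalEigenvector (f : AffEnd k n) (μ : Fin n → ℝ≥0) : Prop :=
  μ ≠ 0 ∧ ∃ θ : ℝ≥0, f.IsMaximalEigenvalue θ ∧
    ∀ i, MvPolynomial.weightedTotalDegree' μ (f i) = ((θ * μ i : ℝ≥0) : WithBot ℝ≥0)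

end AffEnd

/-- A Handelman number: a positive real number that is a root of a monic integral polynomial all
of whose coefficients, except the leading one, are non-positive. -/
def IsHandelman (x : ℝ) : Prop :=
  0 < x ∧ ∃ P : Polynomial ℤ, P.Monic ∧ (∀ i < P.natDegree, P.coeff i ≤ 0) ∧
    Polynomial.aeval x P = 0

end

/-! By Bruhat, the linear part of an affine automorphism is a product of a lower triangular matrix,
a monomial matrix and a lower triangular matrix. The right factor and the scalars go into the
triangular map; the left one is removed by conjugation. Both conjugating maps are affine, so the
degree does not grow. What remains is a coordinate permutation of `(a x + b, c y + p(x), e z + q(x,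
y))`, which leaves six cases (`IsAffineTriangular.exists_isConj`,
`IsTriangular.exists_normal_form`).

In each case one looks for `θ ≥ 1` and a weight `μ` with `deg_μ(f_i) = θ μ_i`; the weight equations
lead to `θ² = i θ + j` with `i, j` natural numbers, hence to a Handelman number. Strictly positive
weights with factor `θ + δ` bound from above both the eigenvalues of contained matrices, through a
weighted sup norm, and the growth of degrees. For the lower bound, let `g` be the `μ`-leading part
of `f`. The candidate for the leading part of `f^r` is `g^r`, and it is the genuine one as soon as
it is nonzero. If `(g^r)_i ≠ 0` for all `r` and some `i` with `μ_i > 0`, then `deg_μ(f^r) = θ^r`,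
which yields both stability and growth (`hasStableEigenvalue_of`). If `θ = 1`, the bound `deg(f^r) ≥
1` is enough.

Non-vanishing of `g^r` comes from injectivity: a substitution preserving `k[x, y]` and injective
there, or preserving `k[u]` with `u` transcendental and acting by a nonconstant polynomial, never
kills a nonzero element (`iterate_ne_zero_of_injOn`, `iterate_ne_zero_of_aeval`).

Only the two 3-cycles need a further conjugation. For `(e z + q, a x + b, c y + p)` the polynomial
`p` can be moved into `q`. For `(c y + p, e z + q, a x + b)` non-vanishing can fail only if the
leading parts `u = c y + γ x^d` and `h` of the first two components satisfy `c h + γ u^d ∈ k`.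
Conjugating by `y ↦ u` then removes the leading term of `p`; the relation forces `x^(d²)` to occur
in `q`, so the degree does not grow, and induction on `deg p` finishes
(`leadingNonvanishing_or_relation`, `exists_isConj_of_relation`). -/

noncomputable section

open MvPolynomial

namespace AffEnd

/-! ### Weights of monomials and leading parts under substitution -/

section Weights

variable {k : Type*} [Field k] {σ τ : Type*}

/-- Every monomial of `P` has `μ`-weight at most `w`. -/
def WeightLE (μ : σ → ℝ≥0) (w : ℝ≥0) (P : MvPolynomial σ k) : Prop :=
  ∀ m ∈ P.support, Finsupp.weight μ m ≤ w

/-- Every monomial of `P` has `μ`-weight less than `w`. -/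
def WeightLT (μ : σ → ℝ≥0) (w : ℝ≥0) (P : MvPolynomial σ k) : Prop :=
  ∀ m ∈ P.support, Finsupp.weight μ m < w

theorem WeightLT.weightLE {μ : σ → ℝ≥0} {w : ℝ≥0} {P : MvPolynomial σ k} (h : WeightLT μ w P) :
    WeightLE μ w P := fun m hm => (h m hm).le

theorem WeightLE.mono {μ : σ → ℝ≥0} {w v : ℝ≥0} {P : MvPolynomial σ k} (h : WeightLE μ w P)
    (hwv : w ≤ v) : WeightLE μ v P := fun m hm => (h m hm).trans hwv

theorem WeightLE.add {μ : σ → ℝ≥0} {w : ℝ≥0} {P Q : MvPolynomial σ k} (hP : WeightLE μ w P)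
    (hQ : WeightLE μ w Q) : WeightLE μ w (P + Q) := by
  classical
  intro m hm
  rcases Finset.mem_union.1 (support_add hm) with h | h
  exacts [hP m h, hQ m h]

theorem WeightLT.add {μ : σ → ℝ≥0} {w : ℝ≥0} {P Q : MvPolynomial σ k} (hP : WeightLT μ w P)
    (hQ : WeightLT μ w Q) : WeightLT μ w (P + Q) := by
  classical
  intro m hm
  rcases Finset.mem_union.1 (support_add hm) with h | h
  exacts [hP m h, hQ m h]

theorem weightLT_zero (μ : σ → ℝ≥0) (w : ℝ≥0) : WeightLT μ w (0 : MvPolynomial σ k) := by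
  intro m hm; simp at hm

theorem weightLE_zero (μ : σ → ℝ≥0) (w : ℝ≥0) : WeightLE μ w (0 : MvPolynomial σ k) :=
  (weightLT_zero μ w).weightLE

theorem WeightLE.mul {μ : σ → ℝ≥0} {w v : ℝ≥0} {P Q : MvPolynomial σ k} (hP : WeightLE μ w P)
    (hQ : WeightLE μ v Q) : WeightLE μ (w + v) (P * Q) := by
  classical
  intro m hm
  obtain ⟨a, ha, b, hb, rfl⟩ := Finset.mem_add.1 (support_mul P Q hm)
  rw [map_add]
  exact add_le_add (hP a ha) (hQ b hb)

theorem WeightLT.mul {μ : σ → ℝ≥0} {w v : ℝ≥0} {P Q : MvPolynomial σ k} (hP : WeightLT μ w P)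
    (hQ : WeightLE μ v Q) : WeightLT μ (w + v) (P * Q) := by
  classical
  intro m hm
  obtain ⟨a, ha, b, hb, rfl⟩ := Finset.mem_add.1 (support_mul P Q hm)
  rw [map_add]
  exact add_lt_add_of_lt_of_le (hP a ha) (hQ b hb)

theorem weightLE_C (μ : σ → ℝ≥0) (c : k) (w : ℝ≥0) : WeightLE μ w (C c : MvPolynomial σ k) := by
  classical
  intro m hm
  have := support_monomial_subset (R := k) (s := (0 : σ →₀ ℕ)) (a := c) hm
  rw [Finset.mem_singleton.1 this]
  simp

theorem weightLE_X (μ : σ → ℝ≥0) (i : σ) : WeightLE μ (μ i) (X i : MvPolynomial σ k) := by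
  intro m hm
  rw [support_X, Finset.mem_singleton] at hm
  simp [hm, Finsupp.weight_single]

theorem WeightLE.C_mul {μ : σ → ℝ≥0} {w : ℝ≥0} {P : MvPolynomial σ k} (hP : WeightLE μ w P)
    (c : k) : WeightLE μ w (C c * P) := by
  simpa using (weightLE_C μ c 0).mul hP

theorem WeightLT.C_mul {μ : σ → ℝ≥0} {w : ℝ≥0} {P : MvPolynomial σ k} (hP : WeightLT μ w P)
    (c : k) : WeightLT μ w (C c * P) := by
  rw [mul_comm]
  simpa using hP.mul (weightLE_C μ c 0)

theorem WeightLE.sum {ι : Type*} {s : Finset ι} {μ : σ → ℝ≥0} {w : ℝ≥0}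
    {P : ι → MvPolynomial σ k} (h : ∀ i ∈ s, WeightLE μ w (P i)) :
    WeightLE μ w (∑ i ∈ s, P i) :=
  Finset.sum_induction _ (WeightLE μ w) (fun _ _ => WeightLE.add) (weightLE_zero μ w) h

theorem WeightLT.sum {ι : Type*} {s : Finset ι} {μ : σ → ℝ≥0} {w : ℝ≥0}
    {P : ι → MvPolynomial σ k} (h : ∀ i ∈ s, WeightLT μ w (P i)) :
    WeightLT μ w (∑ i ∈ s, P i) :=
  Finset.sum_induction _ (WeightLT μ w) (fun _ _ => WeightLT.add) (weightLT_zero μ w) h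

theorem WeightLE.pow {μ : σ → ℝ≥0} {w : ℝ≥0} {P : MvPolynomial σ k} (hP : WeightLE μ w P)
    (r : ℕ) : WeightLE μ (r • w) (P ^ r) := by
  induction r with
  | zero => simpa using weightLE_C μ (1 : k) 0
  | succ r ih => rw [pow_succ, succ_nsmul]; exact ih.mul hP

theorem WeightLE.prod_pow {ι : Type*} {s : Finset ι} {μ : σ → ℝ≥0} {w : ι → ℝ≥0} {m : ι → ℕ}
    {P : ι → MvPolynomial σ k} (h : ∀ i, WeightLE μ (w i) (P i)) :
    WeightLE μ (∑ i ∈ s, m i • w i) (∏ i ∈ s, P i ^ m i) := by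
  classical
  induction s using Finset.induction_on with
  | empty => simpa using weightLE_C μ (1 : k) 0
  | insert a s ha ih => rw [Finset.sum_insert ha, Finset.prod_insert ha]; exact ((h a).pow _).mul ih

/-- `P₀` is the part of `P` of weight `w`, and `P` has no monomials of weight larger than `w`. -/
def IsLead (μ : σ → ℝ≥0) (w : ℝ≥0) (P P₀ : MvPolynomial σ k) : Prop :=
  IsWeightedHomogeneous μ P₀ w ∧ WeightLT μ w (P - P₀)

theorem weightLE_of_isWeightedHomogeneous {μ : σ → ℝ≥0} {w : ℝ≥0} {P : MvPolynomial σ k}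
    (h : IsWeightedHomogeneous μ P w) : WeightLE μ w P :=
  fun _ hm => (h (mem_support_iff.1 hm)).le

theorem IsLead.weightLE {μ : σ → ℝ≥0} {w : ℝ≥0} {P P₀ : MvPolynomial σ k}
    (h : IsLead μ w P P₀) : WeightLE μ w P := by
  simpa using h.2.weightLE.add (weightLE_of_isWeightedHomogeneous h.1)

theorem IsLead.mul {μ : σ → ℝ≥0} {w v : ℝ≥0} {P P₀ Q Q₀ : MvPolynomial σ k}
    (hP : IsLead μ w P P₀) (hQ : IsLead μ v Q Q₀) : IsLead μ (w + v) (P * Q) (P₀ * Q₀) := by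
  refine ⟨hP.1.mul hQ.1, ?_⟩
  have h : P * Q - P₀ * Q₀ = (P - P₀) * Q + (Q - Q₀) * P₀ := by ring
  rw [h]
  refine (hP.2.mul hQ.weightLE).add ?_
  rw [add_comm]
  exact hQ.2.mul (weightLE_of_isWeightedHomogeneous hP.1)

theorem isLead_C (μ : σ → ℝ≥0) (c : k) : IsLead μ 0 (C c : MvPolynomial σ k) (C c) :=
  ⟨isWeightedHomogeneous_C μ c, by simpa using weightLT_zero μ 0⟩

theorem IsLead.pow {μ : σ → ℝ≥0} {w : ℝ≥0} {P P₀ : MvPolynomial σ k} (hP : IsLead μ w P P₀)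
    (r : ℕ) : IsLead μ (r • w) (P ^ r) (P₀ ^ r) := by
  induction r with
  | zero => simpa using isLead_C μ (1 : k)
  | succ r ih => rw [pow_succ, pow_succ, succ_nsmul]; exact ih.mul hP

theorem IsLead.prod_pow {ι : Type*} {s : Finset ι} {μ : σ → ℝ≥0} {w : ι → ℝ≥0} {m : ι → ℕ}
    {P P₀ : ι → MvPolynomial σ k} (h : ∀ i, IsLead μ (w i) (P i) (P₀ i)) :
    IsLead μ (∑ i ∈ s, m i • w i) (∏ i ∈ s, P i ^ m i) (∏ i ∈ s, P₀ i ^ m i) := by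
  classical
  induction s using Finset.induction_on with
  | empty => simpa using isLead_C μ (1 : k)
  | insert a s ha ih =>
    rw [Finset.sum_insert ha, Finset.prod_insert ha, Finset.prod_insert ha]
    exact ((h a).pow _).mul ih

theorem IsLead.sum {ι : Type*} {s : Finset ι} {μ : σ → ℝ≥0} {w : ℝ≥0}
    {P P₀ : ι → MvPolynomial σ k} (h : ∀ i ∈ s, IsLead μ w (P i) (P₀ i)) :
    IsLead μ w (∑ i ∈ s, P i) (∑ i ∈ s, P₀ i) := by
  refine ⟨IsWeightedHomogeneous.sum s _ _ fun i hi => (h i hi).1, ?_⟩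
  rw [← Finset.sum_sub_distrib]
  exact WeightLT.sum fun i hi => (h i hi).2

theorem IsLead.coeff_eq {μ : σ → ℝ≥0} {w : ℝ≥0} {P P₀ : MvPolynomial σ k}
    (h : IsLead μ w P P₀) {m : σ →₀ ℕ} (hm : Finsupp.weight μ m = w) : coeff m P = coeff m P₀ := by
  have h0 : coeff m (P - P₀) = 0 := by
    by_contra hne
    exact (h.2 m (mem_support_iff.2 hne)).ne hm
  rwa [coeff_sub, sub_eq_zero] at h0

theorem IsLead.exists_mem_support {μ : σ → ℝ≥0} {w : ℝ≥0} {P P₀ : MvPolynomial σ k}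
    (h : IsLead μ w P P₀) (h0 : P₀ ≠ 0) : ∃ m ∈ P.support, Finsupp.weight μ m = w := by
  obtain ⟨m, hm⟩ := ne_zero_iff.1 h0
  have hw := h.1 hm
  exact ⟨m, by rwa [mem_support_iff, h.coeff_eq hw], hw⟩

theorem WeightLE.isLead {μ : σ → ℝ≥0} {w : ℝ≥0} {P : MvPolynomial σ k} (h : WeightLE μ w P) :
    IsLead μ w P (weightedHomogeneousComponent μ w P) := by
  classical
  refine ⟨weightedHomogeneousComponent_isWeightedHomogeneous w P, fun m hm => ?_⟩
  rw [mem_support_iff, coeff_sub, coeff_weightedHomogeneousComponent] at hm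
  split_ifs at hm with hw
  · simp at hm
  · rw [sub_zero] at hm
    exact lt_of_le_of_ne (h m (mem_support_iff.2 hm)) hw

theorem bind₁_eq_sum (f : σ → MvPolynomial τ k) (P : MvPolynomial σ k) :
    bind₁ f P = ∑ m ∈ P.support, C (coeff m P) * ∏ i ∈ m.support, f i ^ m i := by
  change aeval f P = _
  rw [aeval_def, eval₂_eq]
  rfl

theorem sum_support_smul_mul (μ : σ → ℝ≥0) (θ : ℝ≥0) (m : σ →₀ ℕ) :
    ∑ i ∈ m.support, m i • (θ * μ i) = θ * Finsupp.weight μ m := by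
  rw [Finsupp.weight_apply, Finsupp.sum, Finset.mul_sum]
  exact Finset.sum_congr rfl fun i _ => (mul_smul_comm _ _ _).symm

theorem WeightLE.bind₁ {μ : σ → ℝ≥0} {ν : τ → ℝ≥0} {θ w : ℝ≥0} {f : σ → MvPolynomial τ k}
    (hf : ∀ i, WeightLE ν (θ * μ i) (f i)) {P : MvPolynomial σ k} (hP : WeightLE μ w P) :
    WeightLE ν (θ * w) (bind₁ f P) := by
  rw [bind₁_eq_sum]
  refine WeightLE.sum fun m hm => WeightLE.C_mul ?_ _
  refine (WeightLE.prod_pow hf).mono ?_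
  rw [sum_support_smul_mul]
  exact mul_le_mul_right (hP m hm) θ

/-- Substitution multiplies weights by at most `θ`, so the lower part of `P` stays strictly lower
because `θ > 0`, and the top part changes by the rule for products. Since `IsLead` allows a zero
leading part, cancellation needs no separate treatment. -/
theorem IsLead.bind₁ {μ : σ → ℝ≥0} {ν : τ → ℝ≥0} {θ w : ℝ≥0} (hθ : 0 < θ)
    {f g : σ → MvPolynomial τ k} (hf : ∀ i, IsLead ν (θ * μ i) (f i) (g i))
    {P P₀ : MvPolynomial σ k} (hP : IsLead μ w P P₀) :
    IsLead ν (θ * w) (bind₁ f P) (bind₁ g P₀) := by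
  have key : IsLead ν (θ * w) (MvPolynomial.bind₁ f P₀) (MvPolynomial.bind₁ g P₀) := by
    rw [bind₁_eq_sum, bind₁_eq_sum]
    refine IsLead.sum fun m hm => ?_
    have h := (isLead_C ν (coeff m P₀)).mul (IsLead.prod_pow (s := m.support) (m := m) hf)
    rwa [sum_support_smul_mul, hP.1 (mem_support_iff.1 hm), zero_add] at h
  refine ⟨key.1, ?_⟩
  have h : MvPolynomial.bind₁ f P - MvPolynomial.bind₁ g P₀ = MvPolynomial.bind₁ f (P - P₀) +
      (MvPolynomial.bind₁ f P₀ - MvPolynomial.bind₁ g P₀) := by rw [map_sub]; ring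
  rw [h]
  refine WeightLT.add ?_ key.2
  rw [bind₁_eq_sum]
  refine WeightLT.sum fun m hm => WeightLT.C_mul ?_ _
  intro m' hm'
  refine lt_of_le_of_lt (WeightLE.prod_pow (fun i => (hf i).weightLE) m' hm') ?_
  rw [sum_support_smul_mul]
  exact mul_lt_mul_of_pos_left (hP.2 m hm) hθ

/-- Lets ordinary degree bounds be proved by the weight calculus. -/
theorem weightLE_one_iff {P : MvPolynomial σ k} {d : ℕ} :
    WeightLE (1 : σ → ℝ≥0) d P ↔ P.totalDegree ≤ d := by
  have hw : ∀ m : σ →₀ ℕ, Finsupp.weight (1 : σ → ℝ≥0) m = (m.sum fun _ e => e : ℕ) := by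
    intro m
    simp [Finsupp.weight_apply, Finsupp.sum]
  simp only [WeightLE, hw, Nat.cast_le]
  exact Finset.sup_le_iff.symm

end Weights

/-! ### Iterates and the eigenvector condition in terms of monomials -/

variable {k : Type*} [Field k] {n : ℕ}

/-- The substitution `P ↦ P(f₁, …, fₙ)`. -/
def subst (f : AffEnd k n) : MvPolynomial (Fin n) k →ₐ[k] MvPolynomial (Fin n) k :=
  MvPolynomial.bind₁ f

/-- The endomorphism with the given components. -/
def ofFun (v : Fin n → MvPolynomial (Fin n) k) : AffEnd k n := v

@[simp] theorem ofFun_apply (v : Fin n → MvPolynomial (Fin n) k) (i : Fin n) :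
    ofFun v i = v i := rfl

@[simp] theorem subst_X (f : AffEnd k n) (i : Fin n) : f.subst (X i) = f i :=
  bind₁_X_right (σ := Fin n) f i

@[simp] theorem subst_C (f : AffEnd k n) (c : k) : f.subst (C c) = C c :=
  bind₁_C_right (σ := Fin n) f c

theorem mul_apply (f g : AffEnd k n) (i : Fin n) : (f * g) i = g.subst (f i) := rfl

theorem one_apply (i : Fin n) : (1 : AffEnd k n) i = X i := rfl

theorem subst_mul (f g : AffEnd k n) (P : MvPolynomial (Fin n) k) :
    (f * g).subst P = g.subst (f.subst P) :=
  DFunLike.congr_fun (algHom_ext (fun i => by simp [mul_apply]) :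
    (f * g).subst = g.subst.comp f.subst) P

theorem subst_one (P : MvPolynomial (Fin n) k) : (1 : AffEnd k n).subst P = P :=
  DFunLike.congr_fun (algHom_ext (fun i => by simp [one_apply]) :
    (1 : AffEnd k n).subst = AlgHom.id k _) P

theorem pow_succ_apply (f : AffEnd k n) (r : ℕ) (i : Fin n) :
    (f ^ (r + 1)) i = f.subst ((f ^ r) i) := by
  rw [pow_succ, mul_apply]

theorem weightLE_pow {μ : Fin n → ℝ≥0} {θ : ℝ≥0} {f : AffEnd k n}
    (hf : ∀ i, WeightLE μ (θ * μ i) (f i)) (r : ℕ) (i : Fin n) :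
    WeightLE μ (θ ^ r * μ i) ((f ^ r) i) := by
  induction r with
  | zero => simpa [one_apply] using weightLE_X μ i
  | succ r ih => rw [pow_succ_apply, pow_succ', mul_assoc]; exact ih.bind₁ hf

/-- The iterate of the leading part is the only candidate for the leading part of the iterate. It
may vanish, and excluding this is the main difficulty. -/
theorem isLead_pow {μ : Fin n → ℝ≥0} {θ : ℝ≥0} (hθ : 0 < θ) {f g : AffEnd k n}
    (hf : ∀ i, IsLead μ (θ * μ i) (f i) (g i)) (r : ℕ) (i : Fin n) :
    IsLead μ (θ ^ r * μ i) ((f ^ r) i) ((g ^ r) i) := by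
  induction r with
  | zero =>
    simp only [pow_zero, one_mul, one_apply]
    exact ⟨isWeightedHomogeneous_X k μ i, by simpa using weightLT_zero μ (μ i)⟩
  | succ r ih => rw [pow_succ_apply, pow_succ_apply, pow_succ', mul_assoc]; exact ih.bind₁ hθ hf

/-- `deg_μ(fᵢ) = θ μᵢ` for each `i`, in terms of monomials. -/
def IsEigen (μ : Fin n → ℝ≥0) (θ : ℝ≥0) (f : AffEnd k n) : Prop :=
  ∀ i, WeightLE μ (θ * μ i) (f i) ∧ ∃ m ∈ (f i).support, Finsupp.weight μ m = θ * μ i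

theorem weightedTotalDegree'_le_iff {μ : Fin n → ℝ≥0} {w : ℝ≥0} {P : MvPolynomial (Fin n) k} :
    weightedTotalDegree' μ P ≤ (w : WithBot ℝ≥0) ↔ WeightLE μ w P := by
  simp [weightedTotalDegree', WeightLE, Finset.sup_le_iff]

theorem weightedTotalDegree'_eq_iff {μ : Fin n → ℝ≥0} {w : ℝ≥0} {P : MvPolynomial (Fin n) k} :
    weightedTotalDegree' μ P = (w : WithBot ℝ≥0) ↔
      WeightLE μ w P ∧ ∃ m ∈ P.support, Finsupp.weight μ m = w := by
  constructor
  · intro h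
    refine ⟨weightedTotalDegree'_le_iff.1 h.le, ?_⟩
    have hP : P.support.Nonempty := by
      rw [Finset.nonempty_iff_ne_empty]
      rintro h0
      rw [support_eq_empty.1 h0, weightedTotalDegree'_zero] at h
      exact WithBot.bot_ne_coe h
    obtain ⟨m, hm, h1⟩ := Finset.exists_mem_eq_sup P.support hP
      fun s => (Finsupp.weight μ s : WithBot ℝ≥0)
    exact ⟨m, hm, WithBot.coe_injective (h1.symm.trans h)⟩
  · rintro ⟨h, m, hm, h1⟩
    refine le_antisymm (weightedTotalDegree'_le_iff.2 h) ?_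
    rw [← h1]
    exact Finset.le_sup (f := fun s => (Finsupp.weight μ s : WithBot ℝ≥0)) hm

theorem isMaximalEigenvector_iff {μ : Fin n → ℝ≥0} {f : AffEnd k n} :
    f.IsMaximalEigenvector μ ↔ μ ≠ 0 ∧ ∃ θ, f.IsMaximalEigenvalue θ ∧ IsEigen μ θ f := by
  simp only [IsMaximalEigenvector, IsEigen, weightedTotalDegree'_eq_iff]

end AffEnd

/-! ### Eigenvalue bounds, degree growth and the stability criterion -/

namespace AffEnd

variable {k : Type*} [Field k] {n : ℕ}

/-- A single coordinate of positive weight attaining its bound suffices: dividing by `μ i` shows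
that no smaller factor is admissible. -/
theorem muDegree_eq {μ : Fin n → ℝ≥0} {θ : ℝ≥0} {f : AffEnd k n}
    (hf : ∀ i, WeightLE μ (θ * μ i) (f i)) {i : Fin n} (hi : 0 < μ i)
    (hm : ∃ m ∈ (f i).support, Finsupp.weight μ m = θ * μ i) : f.muDegree μ = θ := by
  refine le_antisymm ?_ ?_
  · exact iInf₂_le θ fun i => weightedTotalDegree'_le_iff.2 (hf i)
  · refine le_iInf₂ fun t ht => ?_
    obtain ⟨m, hm, h⟩ := hm
    have h1 := weightedTotalDegree'_le_iff.1 (ht i) m hm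
    rw [h] at h1
    exact ENNReal.coe_le_coe.2 (le_of_mul_le_mul_right h1 hi)

theorem isMuAlgStable_of_lead {μ : Fin n → ℝ≥0} {θ : ℝ≥0} (hθ : 0 < θ) {f g : AffEnd k n}
    (hf : ∀ i, IsLead μ (θ * μ i) (f i) (g i)) {i : Fin n} (hi : 0 < μ i)
    (hg : ∀ r, (g ^ r) i ≠ 0) : f.IsMuAlgStable μ := by
  have key : ∀ r, (f ^ r).muDegree μ = (θ ^ r : ℝ≥0) := fun r =>
    muDegree_eq (fun j => (isLead_pow hθ hf r j).weightLE) hi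
      ((isLead_pow hθ hf r i).exists_mem_support (hg r))
  have h1 : f.muDegree μ = θ := by simpa using key 1
  refine ⟨by rw [h1]; exact ENNReal.coe_lt_top, fun r _ => ?_⟩
  rw [key, h1, ENNReal.coe_pow]

theorem weight_symm (μ : Fin n → ℝ≥0) (v : Fin n → ℕ) :
    Finsupp.weight μ (Finsupp.equivFunOnFinite.symm v) = ∑ j, (v j : ℝ≥0) * μ j := by
  simp [Finsupp.weight_eq_sum]

/-- This is the operator norm bound for the norm `max |v_i| / μ_i`: evaluate `M v = ξ v` at a
coordinate where the maximum is reached. Positivity of all weights is what makes this a norm. -/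
theorem nnnorm_eigenvalue_le {μ : Fin n → ℝ≥0} (hμ : ∀ i, 0 < μ i) {t : ℝ≥0}
    {M : Matrix (Fin n) (Fin n) ℕ} (hM : ∀ i, ∑ j, (M i j : ℝ≥0) * μ j ≤ t * μ i) {ξ : ℂ}
    (hξ : Module.End.HasEigenvalue (Matrix.toLin' (M.map (fun m : ℕ => (m : ℂ)))) ξ) :
    ‖ξ‖₊ ≤ t := by
  obtain ⟨v, hv⟩ := hξ.exists_hasEigenvector
  have hv1 := hv.apply_eq_smul
  have hv0 := hv.2
  obtain ⟨i₀, hi₀⟩ := Function.ne_iff.1 hv0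
  obtain ⟨i, -, hi⟩ := Finset.exists_max_image Finset.univ (fun i => ‖v i‖₊ / μ i)
    ⟨i₀, Finset.mem_univ _⟩
  have hpos : 0 < ‖v i‖₊ / μ i :=
    lt_of_lt_of_le (div_pos (nnnorm_pos.2 hi₀) (hμ i₀)) (hi i₀ (Finset.mem_univ _))
  have hle : ∀ j, ‖v j‖₊ ≤ ‖v i‖₊ / μ i * μ j := fun j =>
    (div_le_iff₀ (hμ j)).1 (hi j (Finset.mem_univ _))
  have hcomp : ξ * v i = ∑ j, (M i j : ℂ) * v j := by
    have := congrFun hv1 i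
    simpa [Matrix.mulVec, dotProduct] using this.symm
  have h1 : ‖ξ‖₊ * ‖v i‖₊ ≤ t * ‖v i‖₊ := by
    calc ‖ξ‖₊ * ‖v i‖₊ = ‖∑ j, (M i j : ℂ) * v j‖₊ := by rw [← hcomp, nnnorm_mul]
      _ ≤ ∑ j, ‖(M i j : ℂ) * v j‖₊ := nnnorm_sum_le _ _
      _ ≤ ∑ j, (‖v i‖₊ / μ i) * ((M i j : ℝ≥0) * μ j) := by
          refine Finset.sum_le_sum fun j _ => ?_
          have h2 : ‖(M i j : ℂ)‖₊ = (M i j : ℝ≥0) := by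
            ext; simp
          rw [nnnorm_mul, h2]
          calc (M i j : ℝ≥0) * ‖v j‖₊ ≤ (M i j : ℝ≥0) * (‖v i‖₊ / μ i * μ j) :=
                mul_le_mul_right (hle j) _
            _ = _ := by ring
      _ ≤ (‖v i‖₊ / μ i) * (t * μ i) := by
          rw [← Finset.mul_sum]
          exact mul_le_mul_right (hM i) _
      _ = t * ‖v i‖₊ := by
          have := (hμ i).ne'
          field_simp
  refine le_of_mul_le_mul_right h1 ?_
  exact pos_of_ne_zero fun h => by simp [h] at hpos

/-- Monomials of extremal weight form a contained matrix with `M μ = θ μ`, so `θ` is attained. The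
slack `δ` in the upper bound is there because the eigenvector may have zero entries, while the norm
estimate needs positive weights. -/
theorem isMaximalEigenvalue_of_isEigen {f : AffEnd k n} {θ : ℝ≥0}
    (hub : ∀ δ : ℝ≥0, 0 < δ → ∃ μ : Fin n → ℝ≥0, (∀ i, 0 < μ i) ∧
      ∀ i, WeightLE μ ((θ + δ) * μ i) (f i))
    (hE : ∃ μ : Fin n → ℝ≥0, μ ≠ 0 ∧ IsEigen μ θ f) : f.IsMaximalEigenvalue θ := by
  constructor
  · obtain ⟨μ, hμ, h⟩ := hE
    choose m hm hw using fun i => (h i).2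
    refine ⟨Matrix.of fun i j => m i j, fun i => ?_, (θ : ℂ), ?_, ?_⟩
    · have : Finsupp.equivFunOnFinite.symm (Matrix.of (fun i j => m i j) i) = m i := by ext; simp
      rw [this]
      exact mem_support_iff.1 (hm i)
    · refine Module.End.hasEigenvalue_of_hasEigenvector (x := fun i => ((μ i : ℝ≥0) : ℂ)) ⟨?_, ?_⟩
      · rw [Module.End.mem_eigenspace_iff]
        funext i
        have h1 := hw i
        rw [Finsupp.weight_eq_sum] at h1
        have h2 := congrArg (fun t : ℝ≥0 => ((t : ℝ) : ℂ)) h1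
        simpa [Matrix.mulVec, dotProduct, Matrix.map_apply] using h2
      · intro h0
        apply hμ
        funext i
        have := congrFun h0 i
        simpa using this
    · ext; simp
  · rintro t ⟨M, hM, ξ, hξ, rfl⟩
    refine le_of_forall_pos_le_add fun δ hδ => ?_
    obtain ⟨μ, hμ, h⟩ := hub δ hδ
    refine nnnorm_eigenvalue_le hμ (fun i => ?_) hξ
    rw [← weight_symm]
    exact h i _ (mem_support_iff.2 (hM i))

theorem degree_le_iff {f : AffEnd k n} {d : ℕ} :
    f.degree ≤ d ↔ ∀ i, (f i).totalDegree ≤ d := by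
  simp [degree, Finset.sup_le_iff]

theorem totalDegree_le_degree (f : AffEnd k n) (i : Fin n) : (f i).totalDegree ≤ f.degree :=
  degree_le_iff.1 le_rfl i

theorem totalDegree_subst_le {f : AffEnd k n} {d : ℕ} (hf : f.degree ≤ d)
    (P : MvPolynomial (Fin n) k) : (f.subst P).totalDegree ≤ d * P.totalDegree := by
  rw [← weightLE_one_iff]
  push_cast
  refine WeightLE.bind₁ (μ := 1) (fun i => ?_) (weightLE_one_iff.2 le_rfl)
  simpa using weightLE_one_iff.2 (degree_le_iff.1 hf i)

theorem degree_mul_le (f g : AffEnd k n) : (f * g).degree ≤ f.degree * g.degree := by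
  rw [degree_le_iff]
  intro i
  rw [mul_comm]
  exact (totalDegree_subst_le le_rfl _).trans
    (Nat.mul_le_mul_left _ (totalDegree_le_degree f i))

/-- Substituting constants into the inverse could never return `X 0`. -/
theorem one_le_degree_of_isUnit [NeZero n] {f : AffEnd k n} (hf : IsUnit f) : 1 ≤ f.degree := by
  by_contra h
  have h0 : f.degree ≤ 0 := by omega
  obtain ⟨g, hg⟩ := hf.exists_left_inv
  have h1 := totalDegree_subst_le h0 (g 0)
  have h2 : f.subst (g 0) = X 0 := by rw [← mul_apply, hg, one_apply]
  rw [h2, totalDegree_X] at h1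
  omega

/-- The sequence `deg(f ^ r)` grows like `θ ^ r`, up to subexponential factors from above. -/
def HasGrowth (f : AffEnd k n) (θ : ℝ≥0) : Prop :=
  (∀ δ : ℝ≥0, 0 < δ → ∃ K : ℝ≥0, 0 < K ∧ ∀ r, ((f ^ r).degree : ℝ≥0) ≤ K * (θ + δ) ^ r) ∧
    ∃ c : ℝ≥0, 0 < c ∧ ∀ r, c * θ ^ r ≤ ((f ^ r).degree : ℝ≥0)

theorem tendsto_const_rpow_inv {c : ℝ} (hc : 0 < c) :
    Filter.Tendsto (fun r : ℕ => c ^ (1 / (r : ℝ))) Filter.atTop (𝓝 1) := by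
  have h := (tendsto_const_nhds (x := c)).rpow tendsto_one_div_atTop_nhds_zero_nat
    (Or.inl hc.ne')
  simpa using h

theorem HasGrowth.hasDynamicalDegree {f : AffEnd k n} {θ : ℝ≥0} (h : f.HasGrowth θ) :
    f.HasDynamicalDegree θ := by
  have root : ∀ (c t : ℝ≥0) (r : ℕ), r ≠ 0 →
      ((c * t ^ r : ℝ≥0) : ℝ) ^ (1 / (r : ℝ)) = (c : ℝ) ^ (1 / (r : ℝ)) * t := by
    intro c t r hr
    rw [NNReal.coe_mul, NNReal.coe_pow, Real.mul_rpow c.coe_nonneg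
      (pow_nonneg t.coe_nonneg r), one_div, Real.pow_rpow_inv_natCast t.coe_nonneg hr]
  obtain ⟨hub, c, hc, hlb⟩ := h
  rw [HasDynamicalDegree, tendsto_order]
  constructor
  · intro b hb
    have h1 := (tendsto_const_rpow_inv (c := c) hc).mul_const (θ : ℝ)
    rw [one_mul] at h1
    filter_upwards [h1.eventually (lt_mem_nhds hb), Filter.eventually_ne_atTop 0] with r hr hr0
    refine hr.trans_le ?_
    rw [← root c θ r hr0]
    refine Real.rpow_le_rpow (NNReal.coe_nonneg _) ?_ (by positivity)
    exact_mod_cast hlb r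
  · intro b hb
    -- Half of the gap is spent on `δ`; the other half absorbs the `r`-th root of the constant `K`.
    have hb' : 0 < (b - θ) / 2 := by linarith
    obtain ⟨δ, hδ⟩ : ∃ δ : ℝ≥0, (δ : ℝ) = (b - θ) / 2 := ⟨⟨_, hb'.le⟩, rfl⟩
    obtain ⟨K, hK, hle⟩ := hub δ (by rw [← NNReal.coe_pos, hδ]; exact hb')
    have h1 := (tendsto_const_rpow_inv (c := K) hK).mul_const ((θ : ℝ) + δ)
    rw [one_mul] at h1
    filter_upwards [h1.eventually (gt_mem_nhds (show (θ : ℝ) + δ < b by linarith)),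
      Filter.eventually_ne_atTop 0] with r hr hr0
    refine lt_of_le_of_lt ?_ hr
    have h2 := root K (θ + δ) r hr0
    rw [NNReal.coe_add] at h2
    rw [← h2]
    refine Real.rpow_le_rpow (by positivity) ?_ (by positivity)
    exact_mod_cast hle r

/-- Degree is submultiplicative, so the degrees of the iterates of conjugate maps agree up to the
factor `deg u · deg u⁻¹`, independent of `r`. -/
theorem HasGrowth.of_isConj [NeZero n] {f f' : AffEnd k n} {θ : ℝ≥0} (h : f'.HasGrowth θ)
    (hc : IsConj f f') : f.HasGrowth θ := by
  obtain ⟨u, hu⟩ := hc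
  have hpow : ∀ r, (u : AffEnd k n) * f ^ r = f' ^ r * u := fun r => hu.pow_right r
  set A := (u : AffEnd k n).degree * ((u⁻¹ : (AffEnd k n)ˣ) : AffEnd k n).degree
  have hA : 0 < A := Nat.mul_pos (one_le_degree_of_isUnit u.isUnit)
    (one_le_degree_of_isUnit (u⁻¹).isUnit)
  have h1 : ∀ r, (f ^ r).degree ≤ A * (f' ^ r).degree := by
    intro r
    have e : f ^ r = (u⁻¹ : (AffEnd k n)ˣ) * (f' ^ r * u) := by
      rw [← hpow, ← mul_assoc, Units.inv_mul, one_mul]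
    rw [e]
    refine (degree_mul_le _ _).trans ((Nat.mul_le_mul_left _ (degree_mul_le _ _)).trans ?_)
    simp only [A]
    exact le_of_eq (by ring)
  have h2 : ∀ r, (f' ^ r).degree ≤ A * (f ^ r).degree := by
    intro r
    have e : f' ^ r = u * (f ^ r) * (u⁻¹ : (AffEnd k n)ˣ) := by
      rw [hpow, mul_assoc, Units.mul_inv, mul_one]
    rw [e]
    refine (degree_mul_le _ _).trans ((Nat.mul_le_mul_right _ (degree_mul_le _ _)).trans ?_)
    simp only [A]
    exact le_of_eq (by ring)
  have hA' : (0 : ℝ≥0) < A := by exact_mod_cast hA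
  obtain ⟨hub, c, hc, hlb⟩ := h
  refine ⟨fun δ hδ => ?_, c / A, div_pos hc hA', fun r => ?_⟩
  · obtain ⟨K, hK, hle⟩ := hub δ hδ
    refine ⟨A * K, mul_pos hA' hK, fun r => ?_⟩
    calc ((f ^ r).degree : ℝ≥0) ≤ A * (f' ^ r).degree := by exact_mod_cast h1 r
      _ ≤ A * (K * (θ + δ) ^ r) := mul_le_mul_right (hle r) _
      _ = _ := by ring
  · have h3 : ((f' ^ r).degree : ℝ≥0) ≤ A * (f ^ r).degree := by exact_mod_cast h2 r
    calc c / A * θ ^ r = (c * θ ^ r) / A := by ring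
      _ ≤ (A * (f ^ r).degree) / A := div_le_div_of_nonneg_right ((hlb r).trans h3) zero_le
      _ = (f ^ r).degree := by field_simp

/-- With all weights positive, total degree and `μ`-weight are comparable; the constant is the ratio
of the largest to the smallest weight. -/
theorem growth_upper [NeZero n] {f : AffEnd k n} {μ : Fin n → ℝ≥0} (hμ : ∀ i, 0 < μ i) {t : ℝ≥0}
    (h : ∀ i, WeightLE μ (t * μ i) (f i)) :
    ∃ K : ℝ≥0, 0 < K ∧ ∀ r, ((f ^ r).degree : ℝ≥0) ≤ K * t ^ r := by
  obtain ⟨a, -, ha⟩ := Finset.exists_min_image Finset.univ μ ⟨0, Finset.mem_univ _⟩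
  obtain ⟨b, -, hb⟩ := Finset.exists_max_image Finset.univ μ ⟨0, Finset.mem_univ _⟩
  refine ⟨μ b / μ a, div_pos (hμ b) (hμ a), fun r => ?_⟩
  obtain ⟨i, -, hi⟩ := Finset.exists_mem_eq_sup Finset.univ ⟨0, Finset.mem_univ _⟩
    (fun i => ((f ^ r) i).totalDegree)
  have hdeg : (f ^ r).degree = ((f ^ r) i).totalDegree := hi
  rw [hdeg]
  by_cases h0 : (f ^ r) i = 0
  · simp [h0]
  obtain ⟨m, hm, hmd⟩ := Finset.exists_mem_eq_sup ((f ^ r) i).support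
    (Finset.nonempty_of_ne_empty (by simpa using h0)) (fun s => s.sum fun _ e => e)
  have hmd' : ((f ^ r) i).totalDegree = m.sum fun _ e => e := hmd
  have h1 := weightLE_pow h r i m hm
  have h2 : (((f ^ r) i).totalDegree : ℝ≥0) * μ a ≤ Finsupp.weight μ m := by
    rw [hmd', Finsupp.weight_apply, Finsupp.sum, Finsupp.sum, Nat.cast_sum, Finset.sum_mul]
    refine Finset.sum_le_sum fun j _ => ?_
    rw [nsmul_eq_mul]
    exact mul_le_mul_right (ha j (Finset.mem_univ _)) _
  rw [div_mul_eq_mul_div, le_div_iff₀ (hμ a)]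
  refine h2.trans (h1.trans ?_)
  rw [mul_comm]
  exact mul_le_mul_left (hb i (Finset.mem_univ _)) _

theorem growth_lower {f : AffEnd k n} {μ : Fin n → ℝ≥0} {t : ℝ≥0} {i : Fin n} (hi : 0 < μ i)
    (h : ∀ r, ∃ m ∈ ((f ^ r) i).support, Finsupp.weight μ m = t ^ r * μ i) :
    ∃ c : ℝ≥0, 0 < c ∧ ∀ r, c * t ^ r ≤ ((f ^ r).degree : ℝ≥0) := by
  obtain ⟨b, -, hb⟩ := Finset.exists_max_image Finset.univ μ ⟨i, Finset.mem_univ _⟩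
  have hb0 : 0 < μ b := hi.trans_le (hb i (Finset.mem_univ _))
  refine ⟨μ i / μ b, div_pos hi hb0, fun r => ?_⟩
  obtain ⟨m, hm, hw⟩ := h r
  have h1 : Finsupp.weight μ m ≤ (m.sum fun _ e => e : ℕ) * μ b := by
    rw [Finsupp.weight_apply, Finsupp.sum, Finsupp.sum, Nat.cast_sum, Finset.sum_mul]
    refine Finset.sum_le_sum fun j _ => ?_
    rw [nsmul_eq_mul]
    exact mul_le_mul_right (hb j (Finset.mem_univ _)) _
  have h2 : (m.sum fun _ e => e) ≤ (f ^ r).degree :=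
    (le_totalDegree hm).trans (totalDegree_le_degree _ i)
  rw [div_mul_eq_mul_div, div_le_iff₀ hb0, mul_comm, ← hw]
  refine h1.trans ?_
  gcongr

theorem isHandelman_of_sq_eq {θ : ℝ} (hθ : 0 < θ) {i j : ℕ} (h : θ ^ 2 = i * θ + j) :
    IsHandelman θ := by
  refine ⟨hθ, Polynomial.X ^ 2 + (Polynomial.C (-(i : ℤ)) * Polynomial.X
    + Polynomial.C (-(j : ℤ))), ?_, ?_, ?_⟩
  · exact Polynomial.monic_X_pow_add (Polynomial.degree_linear_lt)
  · have hd : (Polynomial.X ^ 2 + (Polynomial.C (-(i : ℤ)) * Polynomial.X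
        + Polynomial.C (-(j : ℤ)))).natDegree = 2 := by
      compute_degree!
    rw [hd]
    intro l hl
    interval_cases l <;> simp [Polynomial.coeff_X]
  · simp [h]
    ring

/-- The conclusions about the maximal eigenvalue `θ` of `f`. -/
structure HasStableEigenvalue (f : AffEnd k n) (θ : ℝ≥0) : Prop where
  isMaximalEigenvalue : f.IsMaximalEigenvalue θ
  stable : θ = 1 ∨ ∀ μ : Fin n → ℝ≥0, f.IsMaximalEigenvector μ → f.IsMuAlgStable μ
  growth : f.HasGrowth θ
  handelman : IsHandelman θ

/-- The `μ`-leading part of `f`, of `μ`-degree `θ`. -/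
def leadingPart (μ : Fin n → ℝ≥0) (θ : ℝ≥0) (f : AffEnd k n) : AffEnd k n :=
  fun i => weightedHomogeneousComponent μ (θ * μ i) (f i)

/-- Some coordinate of positive weight does not vanish along the iterates of the
`μ`-leading part of `f`. -/
def LeadingNonvanishing (μ : Fin n → ℝ≥0) (θ : ℝ≥0) (f : AffEnd k n) : Prop :=
  ∃ i, 0 < μ i ∧ ∀ r, (leadingPart μ θ f ^ r) i ≠ 0

/-- The criterion applied to each permutation. Non-vanishing is required of every eigenvector, since
stability is claimed for all of them, but only for `θ > 1`; for `θ = 1` the lower growth bound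
follows from invertibility alone. -/
theorem hasStableEigenvalue_of [NeZero n] {f : AffEnd k n} (hf : IsUnit f) {θ : ℝ≥0}
    (h1 : 1 ≤ θ) {i j : ℕ} (hH : θ ^ 2 = i * θ + j)
    (hub : ∀ δ : ℝ≥0, 0 < δ → ∃ μ : Fin n → ℝ≥0, (∀ i, 0 < μ i) ∧
      ∀ i, WeightLE μ ((θ + δ) * μ i) (f i))
    (hE : ∃ μ : Fin n → ℝ≥0, μ ≠ 0 ∧ IsEigen μ θ f)
    (hS : 1 < θ → ∀ μ : Fin n → ℝ≥0, μ ≠ 0 → IsEigen μ θ f → LeadingNonvanishing μ θ f) :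
    HasStableEigenvalue f θ := by
  have hmax := isMaximalEigenvalue_of_isEigen hub hE
  have hθ : 0 < θ := zero_lt_one.trans_le h1
  have hlead : ∀ {μ : Fin n → ℝ≥0}, IsEigen μ θ f →
      ∀ i, IsLead μ (θ * μ i) (f i) (leadingPart μ θ f i) := fun h i => (h i).1.isLead
  refine ⟨hmax, ?_, ⟨fun δ hδ => ?_, ?_⟩, ?_⟩
  · rcases h1.eq_or_lt with h | h
    · exact Or.inl h.symm
    · refine Or.inr fun μ hμ => ?_
      obtain ⟨hμ0, θ', hθ', he⟩ := isMaximalEigenvector_iff.1 hμ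
      obtain rfl : θ = θ' := hmax.unique hθ'
      obtain ⟨i, hi, hg⟩ := hS h μ hμ0 he
      exact isMuAlgStable_of_lead hθ (hlead he) hi hg
  · obtain ⟨μ, hμ, h⟩ := hub δ hδ
    exact growth_upper hμ h
  · rcases h1.eq_or_lt with h | h
    · refine ⟨1, one_pos, fun r => ?_⟩
      rw [← h, one_pow, one_mul]
      exact_mod_cast one_le_degree_of_isUnit (hf.pow r)
    · obtain ⟨μ, hμ0, he⟩ := hE
      obtain ⟨i, hi, hg⟩ := hS h μ hμ0 he
      exact growth_lower hi fun r =>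
        (isLead_pow hθ (hlead he) r i).exists_mem_support (hg r)
  · refine isHandelman_of_sq_eq (i := i) (j := j) hθ ?_
    exact_mod_cast hH

end AffEnd

/-! ### Injective substitutions and non-vanishing of iterates -/

namespace AffEnd

section Variables

variable {k : Type*} [Field k] {σ : Type*}

theorem algHom_eq_of_mem_supported {A : Type*} [CommSemiring A] [Algebra k A]
    {F G : MvPolynomial σ k →ₐ[k] A} {s : Set σ} (h : ∀ i ∈ s, F (X i) = G (X i))
    {P : MvPolynomial σ k} (hP : P ∈ supported k s) : F P = G P := by
  rw [supported_eq_adjoin_X] at hP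
  induction hP using Algebra.adjoin_induction with
  | mem x hx => obtain ⟨i, hi, rfl⟩ := hx; exact h i hi
  | algebraMap r => simp
  | add x y _ _ hx hy => simp [hx, hy]
  | mul x y _ _ hx hy => simp [hx, hy]

theorem bind₁_mem_supported {g : σ → MvPolynomial σ k} {s t : Set σ}
    (h : ∀ i ∈ s, g i ∈ supported k t) {P : MvPolynomial σ k} (hP : P ∈ supported k s) :
    bind₁ g P ∈ supported k t := by
  rw [supported_eq_adjoin_X] at hP
  induction hP using Algebra.adjoin_induction with
  | mem x hx => obtain ⟨i, hi, rfl⟩ := hx; rw [bind₁_X_right]; exact h i hi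
  | algebraMap r => rw [AlgHom.commutes]; exact Subalgebra.algebraMap_mem _ _
  | add x y _ _ hx hy => rw [map_add]; exact add_mem hx hy
  | mul x y _ _ hx hy => rw [map_mul]; exact mul_mem hx hy

theorem C_mem_supported (s : Set σ) (c : k) : (C c : MvPolynomial σ k) ∈ supported k s :=
  Subalgebra.algebraMap_mem (supported k s) c

theorem mem_supported_iff_forall_support {s : Set σ} {P : MvPolynomial σ k} :
    P ∈ supported k s ↔ ∀ m ∈ P.support, ∀ i ∉ s, m i = 0 := by
  rw [mem_supported]
  constructor
  · intro h m hm i hi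
    by_contra h0
    exact hi (h ((mem_vars_iff_mem_support i).2 ⟨m, hm, Finsupp.mem_support_iff.2 h0⟩))
  · intro h i hi
    obtain ⟨m, hm, hi⟩ := (mem_vars_iff_mem_support i).1 hi
    by_contra h0
    exact Finsupp.mem_support_iff.1 hi (h m hm i h0)

open Classical in
/-- A polynomial viewed as a polynomial in the variable `X j`. -/
def univ (j : σ) : MvPolynomial σ k →ₐ[k] Polynomial (MvPolynomial σ k) :=
  aeval (Function.update (fun i => Polynomial.C (X i)) j Polynomial.X)

theorem univ_X_self (j : σ) : univ j (X j : MvPolynomial σ k) = Polynomial.X := by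
  simp [univ]

theorem univ_X_of_ne {i j : σ} (h : i ≠ j) :
    univ j (X i : MvPolynomial σ k) = Polynomial.C (X i) := by
  simp [univ, h]

theorem univ_C (j : σ) (c : k) : univ j (C c : MvPolynomial σ k) = Polynomial.C (C c) := by
  simp only [univ, aeval_C]
  rfl

theorem eval_univ (j : σ) (P : MvPolynomial σ k) : (univ j P).eval (X j) = P := by
  induction P using MvPolynomial.induction_on with
  | C a => simp
  | add p q hp hq => simp [hp, hq]
  | mul_X p i hp =>
    by_cases h : i = j
    · subst h; simp [hp, univ_X_self]
    · simp [hp, univ_X_of_ne h]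

theorem univ_of_mem_supported {j : σ} {P : MvPolynomial σ k} (hP : P ∈ supported k {j}ᶜ) :
    univ j P = Polynomial.C P :=
  algHom_eq_of_mem_supported
    (G := (Algebra.ofId (MvPolynomial σ k) (Polynomial (MvPolynomial σ k))).restrictScalars k)
    (fun _ hi => univ_X_of_ne hi) hP

theorem coeff_univ_mem_supported (j : σ) (P : MvPolynomial σ k) (r : ℕ) :
    (univ j P).coeff r ∈ supported k {j}ᶜ := by
  induction P using MvPolynomial.induction_on generalizing r with
  | C a =>
    rw [univ_C, Polynomial.coeff_C]
    split_ifs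
    exacts [C_mem_supported _ _, zero_mem _]
  | add p q hp hq => rw [map_add, Polynomial.coeff_add]; exact add_mem (hp r) (hq r)
  | mul_X p i hp =>
    rw [map_mul]
    by_cases h : i = j
    · subst h
      rw [univ_X_self]
      cases r with
      | zero => simp
      | succ r => rw [Polynomial.coeff_mul_X]; exact hp r
    · rw [univ_X_of_ne h, Polynomial.coeff_mul_C]
      exact mul_mem (hp r) (X_mem_supported.2 h)

theorem natDegree_univ_ne_zero {j : σ} {P : MvPolynomial σ k} (h : P ∉ supported k {j}ᶜ) :
    (univ j P).natDegree ≠ 0 := by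
  intro h0
  apply h
  have h1 := Polynomial.eq_C_of_natDegree_eq_zero h0
  rw [← eval_univ j P, h1, Polynomial.eval_C]
  exact coeff_univ_mem_supported j P 0

/-- If only `g j` involves `X j`, the substitution acts on the coefficients and then composes with
`g j` as a polynomial in `X j`. The coefficients do not contain `X j`, so the value of `g' j` is
free; this freedom permits both `g' = g` and `g' j = X j`. -/
theorem univ_bind₁ {g g' : σ → MvPolynomial σ k} {j : σ}
    (hg : ∀ i ≠ j, g i ∈ supported k {j}ᶜ) (hg' : ∀ i ≠ j, g' i = g i) (P : MvPolynomial σ k) :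
    univ j (bind₁ g P) =
      ((univ j P).map (bind₁ g' : MvPolynomial σ k →+* MvPolynomial σ k)).comp (univ j (g j)) := by
  induction P using MvPolynomial.induction_on with
  | C a => simp
  | add p q hp hq => simp [hp, hq]
  | mul_X p i hp =>
    rw [map_mul, map_mul, hp, map_mul, Polynomial.map_mul, Polynomial.mul_comp, bind₁_X_right]
    congr 1
    by_cases h : i = j
    · subst h; simp [univ_X_self]
    · simp [univ_X_of_ne h, univ_of_mem_supported (hg i h), hg' i h]

/-- Over a domain, composition with a polynomial of positive degree in `X j` kills only zero, so the
question reduces to the action on coefficients. -/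
theorem injective_bind₁_of_update [DecidableEq σ] {g : σ → MvPolynomial σ k} {j : σ}
    (hg : ∀ i ≠ j, g i ∈ supported k {j}ᶜ) (hj : g j ∉ supported k {j}ᶜ)
    (h : Function.Injective (bind₁ (Function.update g j (X j)))) :
    Function.Injective (bind₁ g) := by
  rw [injective_iff_map_eq_zero]
  intro P hP
  have h1 := univ_bind₁ (g' := Function.update g j (X j)) hg
    (fun i hi => Function.update_of_ne hi _ _) P
  rw [hP, map_zero, eq_comm, Polynomial.comp_eq_zero_iff] at h1
  rcases h1 with h1 | ⟨-, h1⟩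
  · have h2 := (Polynomial.map_eq_zero_iff (f := (bind₁ (Function.update g j (X j)) :
      MvPolynomial σ k →+* MvPolynomial σ k)) h).1 h1
    rw [← eval_univ j P, h2, Polynomial.eval_zero]
  · exact absurd (by rw [h1, Polynomial.natDegree_C]) (natDegree_univ_ne_zero hj)

theorem injective_bind₁_pair [DecidableEq σ] {i j : σ} (hij : i ≠ j) {u v : MvPolynomial σ k}
    (hu : u ∈ supported k {j}ᶜ) (hu' : u ∉ supported k {i}ᶜ) (hv : v ∉ supported k {j}ᶜ) :
    Function.Injective (bind₁ (Function.update (Function.update X i u) j v)) := by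
  refine injective_bind₁_of_update (j := j) (fun l hl => ?_) (by simpa using hv) ?_
  · rw [Function.update_of_ne hl]
    by_cases h : l = i
    · subst h; simpa using hu
    · rw [Function.update_of_ne h]; exact X_mem_supported.2 hl
  · rw [Function.update_idem]
    have h1 : Function.update (Function.update X i u) j (X j : MvPolynomial σ k) =
        Function.update X i u := by
      rw [Function.update_eq_self_iff, Function.update_of_ne hij.symm]
    rw [h1]
    refine injective_bind₁_of_update (j := i) (fun l hl => ?_) (by simpa using hu') ?_
    · rw [Function.update_of_ne hl]; exact X_mem_supported.2 hl
    · rw [Function.update_idem, Function.update_eq_self, bind₁_X_left]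
      exact fun _ _ h => h

/-- Only the subalgebra on `s` matters: the third coordinate of a leading part may well be killed,
while injectivity on an invariant subalgebra persists under iteration. -/
theorem iterate_ne_zero_of_injOn {s : Set σ} {F : MvPolynomial σ k →ₐ[k] MvPolynomial σ k}
    (hs : ∀ i ∈ s, F (X i) ∈ supported k s)
    (hF : ∀ P ∈ supported k s, F P = 0 → P = 0) {P : MvPolynomial σ k}
    (hP : P ∈ supported k s) (h0 : P ≠ 0) (r : ℕ) : F^[r] P ≠ 0 := by
  induction r generalizing P with
  | zero => exact h0
  | succ r ih =>
    rw [Function.iterate_succ_apply]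
    refine ih ?_ fun h => h0 (hF P hP h)
    have hF' : F P = bind₁ (fun i => F (X i)) P :=
      DFunLike.congr_fun (algHom_ext (by simp) : F = bind₁ fun i => F (X i)) P
    rw [hF']
    exact bind₁_mem_supported hs hP

/-- Iterating a substitution `(Xᵢ, Xⱼ) ↦ (u, v)` or `(Xᵢ, Xⱼ) ↦ (v, u)`, where `u` is a nonconstant
polynomial in `Xᵢ` and `v` is a polynomial in `Xᵢ, Xⱼ` involving `Xⱼ`. -/
theorem iterate_ne_zero_of_pair {i j : σ} (hij : i ≠ j) {u v : MvPolynomial σ k}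
    (hu : u ∈ supported k {i}) (hu' : u ∉ supported k {i}ᶜ) (hv : v ∈ supported k {i, j})
    (hv' : v ∉ supported k {j}ᶜ) {F : MvPolynomial σ k →ₐ[k] MvPolynomial σ k}
    (hF : (F (X i) = u ∧ F (X j) = v) ∨ (F (X i) = v ∧ F (X j) = u)) {P : MvPolynomial σ k}
    (hP : P ∈ supported k {i, j}) (h0 : P ≠ 0) (r : ℕ) : F^[r] P ≠ 0 := by
  classical
  have huj : u ∈ supported k {j}ᶜ := supported_mono (by simpa using hij.symm) hu
  have hinj := injective_bind₁_pair hij huj hu' hv'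
  have hui : u ∈ supported k {i, j} := supported_mono (by simp) hu
  refine iterate_ne_zero_of_injOn (s := {i, j}) ?_ ?_ hP h0 r
  · rintro l (rfl | rfl) <;> rcases hF with ⟨h1, h2⟩ | ⟨h1, h2⟩ <;> simp only [h1, h2, hui, hv]
  · intro P hP hFP
    rcases hF with ⟨h1, h2⟩ | ⟨h1, h2⟩
    · refine (injective_iff_map_eq_zero _).1 hinj P ?_
      rw [← hFP]
      refine algHom_eq_of_mem_supported ?_ hP
      rintro l (rfl | rfl)
      · simp [hij, h1]
      · simp [h2]
    · have h3 : rename (Equiv.swap i j) P = 0 := by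
        refine (injective_iff_map_eq_zero _).1 hinj _ ?_
        rw [← hFP]
        refine algHom_eq_of_mem_supported (F := (bind₁ (Function.update
          (Function.update X i u) j v)).comp (rename (Equiv.swap i j))) (fun l hl => ?_) hP
        rw [AlgHom.comp_apply, rename_X, bind₁_X_right]
        rcases hl with rfl | rfl
        · rw [Equiv.swap_apply_left, Function.update_self, h1]
        · rw [Equiv.swap_apply_right, Function.update_of_ne hij, Function.update_self, h2]
      exact (injective_iff_map_eq_zero _).1 (rename_injective _ (Equiv.swap i j).injective) P h3

/-- On `k[u]`, a polynomial ring, `F` is composition with the nonconstant `Q`, hence injective. -/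
theorem iterate_ne_zero_of_aeval {A : Type*} [CommRing A] [Algebra k A] {F : A →ₐ[k] A} {u : A}
    (hu : Transcendental k u) {Q : Polynomial k} (hQ : Q.natDegree ≠ 0)
    (hF : F u = Polynomial.aeval u Q) (r : ℕ) : F^[r] u ≠ 0 := by
  have key : ∀ P : Polynomial k, P ≠ 0 → F^[r] (Polynomial.aeval u P) ≠ 0 := by
    induction r with
    | zero => exact fun P hP h => hP (transcendental_iff.1 hu P h)
    | succ r ih =>
      intro P hP
      rw [Function.iterate_succ_apply, ← Polynomial.aeval_algHom_apply, hF,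
        ← Polynomial.aeval_comp]
      refine ih _ fun h => ?_
      rcases Polynomial.comp_eq_zero_iff.1 h with h | ⟨-, h⟩
      · exact hP h
      · exact hQ (by rw [h, Polynomial.natDegree_C])
  simpa using key Polynomial.X Polynomial.X_ne_zero

theorem exists_aeval_of_mem_supported_singleton {i : σ} {P : MvPolynomial σ k}
    (hP : P ∈ supported k {i}) : ∃ Q : Polynomial k, P = Polynomial.aeval (X i) Q := by
  rw [supported_eq_adjoin_X, Set.image_singleton, Algebra.adjoin_singleton_eq_range_aeval] at hP
  obtain ⟨Q, hQ⟩ := hP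
  exact ⟨Q, hQ.symm⟩

end Variables

/-! ### Elementary automorphisms -/

variable {k : Type*} [Field k] {n : ℕ}

theorem subst_mem_supported {f : AffEnd k n} {s t : Set (Fin n)}
    (h : ∀ i ∈ s, f i ∈ supported k t) {P : MvPolynomial (Fin n) k} (hP : P ∈ supported k s) :
    f.subst P ∈ supported k t :=
  bind₁_mem_supported h hP

theorem pow_apply_eq_iterate (g : AffEnd k n) (r : ℕ) (i : Fin n) :
    (g ^ r) i = g.subst^[r] (X i) := by
  induction r with
  | zero => rfl
  | succ r ih => rw [pow_succ_apply, ih, Function.iterate_succ_apply']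

/-- Write `X j` as the `j`-th component of the inverse with `f` substituted. Degrees in `X j`
multiply under composition, so `f j` has degree one in `X j`; comparing leading coefficients, its
coefficient is a unit of the polynomial ring, that is, a nonzero constant. -/
theorem exists_eq_C_mul_X_add {f : AffEnd k n} (hf : IsUnit f) {j : Fin n}
    (h : ∀ i ≠ j, f i ∈ supported k {j}ᶜ) :
    ∃ e : k, e ≠ 0 ∧ ∃ q ∈ supported k {j}ᶜ, f j = C e * X j + q := by
  obtain ⟨g, hg⟩ := hf.exists_left_inv
  have h1 : f.subst (g j) = X j := by rw [← mul_apply, hg, one_apply]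
  have h2 : univ j (f.subst (g j)) = ((univ j (g j)).map
      (f.subst : MvPolynomial (Fin n) k →+* MvPolynomial (Fin n) k)).comp (univ j (f j)) :=
    univ_bind₁ h (fun _ _ => rfl) (g j)
  rw [h1, univ_X_self] at h2
  have h3 := congrArg Polynomial.natDegree h2
  rw [Polynomial.natDegree_X, Polynomial.natDegree_comp, eq_comm] at h3
  replace h3 := And.intro (Nat.eq_one_of_mul_eq_one_right h3) (Nat.eq_one_of_mul_eq_one_left h3)
  have h4 := congrArg Polynomial.leadingCoeff h2
  rw [Polynomial.leadingCoeff_X, Polynomial.leadingCoeff_comp (by omega), h3.1, pow_one] at h4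
  have h5 : IsUnit (univ j (f j)).leadingCoeff := IsUnit.of_mul_eq_one_right _ h4.symm
  obtain ⟨e, he, h6⟩ := isUnit_iff_eq_C_of_isReduced.1 h5
  have h7 := Polynomial.eq_X_add_C_of_natDegree_le_one h3.2.le
  rw [Polynomial.leadingCoeff, h3.2] at h6
  refine ⟨e, he.ne_zero, _, coeff_univ_mem_supported j (f j) 0, ?_⟩
  have h8 := eval_univ j (f j)
  rw [h7, h6] at h8
  simpa using h8.symm

/-- The elementary endomorphism replacing the `j`-th coordinate by `c Xⱼ + q`. -/
def elementary (j : Fin n) (c : k) (q : MvPolynomial (Fin n) k) : AffEnd k n :=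
  ofFun (Function.update X j (C c * X j + q))

theorem elementary_self (j : Fin n) (c : k) (q : MvPolynomial (Fin n) k) :
    elementary j c q j = C c * X j + q := by
  simp [elementary]

theorem elementary_of_ne {i j : Fin n} (h : i ≠ j) (c : k) (q : MvPolynomial (Fin n) k) :
    elementary j c q i = X i := by
  simp [elementary, h]

theorem subst_elementary_of_mem_supported {j : Fin n} (c : k) (q : MvPolynomial (Fin n) k)
    {P : MvPolynomial (Fin n) k} (hP : P ∈ supported k {j}ᶜ) : (elementary j c q).subst P = P :=
  algHom_eq_of_mem_supported (G := AlgHom.id k _)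
    (fun i hi => by rw [subst_X, elementary_of_ne hi]; rfl) hP

theorem elementary_mul_elementary {j : Fin n} {c c' : k} (hc : c * c' = 1)
    {q : MvPolynomial (Fin n) k} (hq : q ∈ supported k {j}ᶜ) :
    elementary j c q * elementary j c' (-(C c' * q)) = 1 := by
  have hcc : (C c * C c' : MvPolynomial (Fin n) k) = 1 := by rw [← C_mul, hc, C_1]
  funext i
  rw [mul_apply, one_apply]
  by_cases h : i = j
  · subst h
    rw [elementary_self, map_add, map_mul, subst_C, subst_X, elementary_self,
      subst_elementary_of_mem_supported _ _ hq]
    linear_combination (X i - q) * hcc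
  · rw [elementary_of_ne h, subst_X, elementary_of_ne h]

theorem elementary_mul_elementary' {j : Fin n} {c c' : k} (hc : c * c' = 1)
    {q : MvPolynomial (Fin n) k} (hq : q ∈ supported k {j}ᶜ) :
    elementary j c' (-(C c' * q)) * elementary j c q = 1 := by
  have hcc : (C c * C c' : MvPolynomial (Fin n) k) = 1 := by rw [← C_mul, hc, C_1]
  have h := elementary_mul_elementary (j := j) (c := c') (c' := c) (by rwa [mul_comm])
    (q := -(C c' * q)) (neg_mem (mul_mem (C_mem_supported _ _) hq))
  have h2 : -(C c * -(C c' * q)) = q := by linear_combination q * hcc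
  rwa [h2] at h

theorem isUnit_elementary (j : Fin n) {c : k} (hc : c ≠ 0) {q : MvPolynomial (Fin n) k}
    (hq : q ∈ supported k {j}ᶜ) : IsUnit (elementary j c q) :=
  isUnit_iff_exists.2 ⟨_, elementary_mul_elementary (mul_inv_cancel₀ hc) hq,
    elementary_mul_elementary' (mul_inv_cancel₀ hc) hq⟩

end AffEnd

/-! ### Bruhat decomposition and reduction to permutation-triangular maps -/

namespace AffEnd

variable {k : Type*} [Field k] {n : ℕ}

/-- Invertible lower triangular matrices. -/
def IsLowerUnit (L : Matrix (Fin n) (Fin n) k) : Prop :=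
  (∀ i j, i < j → L i j = 0) ∧ L.det ≠ 0

theorem IsLowerUnit.one : IsLowerUnit (1 : Matrix (Fin n) (Fin n) k) :=
  ⟨fun _ _ h => Matrix.one_apply_ne h.ne, by simp⟩

theorem IsLowerUnit.mul {L M : Matrix (Fin n) (Fin n) k} (hL : IsLowerUnit L)
    (hM : IsLowerUnit M) : IsLowerUnit (L * M) := by
  refine ⟨fun i j hij => ?_, by rw [Matrix.det_mul]; exact mul_ne_zero hL.2 hM.2⟩
  rw [Matrix.mul_apply]
  refine Finset.sum_eq_zero fun l _ => ?_
  rcases lt_or_ge i l with h | h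
  · rw [hL.1 i l h, zero_mul]
  · rw [hM.1 l j (h.trans_lt hij), mul_zero]

theorem IsLowerUnit.of_diag_one {L : Matrix (Fin n) (Fin n) k} (h : ∀ i j, i < j → L i j = 0)
    (h1 : ∀ i, L i i = 1) : IsLowerUnit L := by
  refine ⟨h, ?_⟩
  rw [Matrix.det_of_isLowerTriangular L fun i j hij => h i j hij]
  simp [h1]

/-- One step of the elimination: pivot at row `m` and column `j`. -/
theorem exists_elimination_step {B : Matrix (Fin n) (Fin n) k} {m j : Fin n} (hp : B m j ≠ 0)
    (hrow : ∀ b, j < b → B m b = 0) (hcol : ∀ a, a < m → B a j = 0) :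
    ∃ L R B' : Matrix (Fin n) (Fin n) k, IsLowerUnit L ∧ IsLowerUnit R ∧ B = L * B' * R ∧
      B' m j ≠ 0 ∧ (∀ b, b ≠ j → B' m b = 0) ∧ (∀ a, a ≠ m → B' a j = 0) ∧
      ∀ a b, a ≠ m → b ≠ j → B' a b = B a b - B a j * B m b / B m j := by
  -- Entries above and to the right of the pivot already vanish. Clearing therefore only adds the
  -- pivot row to lower rows and the pivot column to columns on its left, both lower triangular
  -- operations.
  let L : Matrix (Fin n) (Fin n) k :=
    Matrix.of fun a b => (if a = b then 1 else 0) +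
      if b = m then (if m < a then B a j / B m j else 0) else 0
  let R : Matrix (Fin n) (Fin n) k :=
    Matrix.of fun a b => (if a = b then 1 else 0) +
      if a = j then (if b < j then B m b / B m j else 0) else 0
  let B' : Matrix (Fin n) (Fin n) k := Matrix.of fun a b =>
    if a = m then (if b = j then B m j else 0) else if b = j then 0 else
      B a b - B a j * B m b / B m j
  have hLB : ∀ a b, (L * B') a b = B' a b + (if m < a then B a j / B m j else 0) * B' m b := by
    intro a b
    simp [Matrix.mul_apply, L, add_mul, Finset.sum_add_distrib]
  have hCR : ∀ (D : Matrix (Fin n) (Fin n) k) (a b), (D * R) a b =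
      D a b + D a j * (if b < j then B m b / B m j else 0) := by
    intro D a b
    simp [Matrix.mul_apply, R, mul_add, Finset.sum_add_distrib]
  refine ⟨L, R, B', IsLowerUnit.of_diag_one ?_ ?_,
    IsLowerUnit.of_diag_one ?_ ?_, ?_, ?_, ?_, ?_, ?_⟩
  · intro a b h
    simp only [L, Matrix.of_apply, if_neg h.ne, zero_add]
    split_ifs with h1 h2
    · subst h1; exact absurd h h2.not_gt
    · rfl
    · rfl
  · intro a
    simp only [L, Matrix.of_apply, if_true]
    split_ifs with h1 h2
    · subst h1; exact absurd h2 (lt_irrefl _)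
    all_goals simp
  · intro a b h
    simp only [R, Matrix.of_apply, if_neg h.ne, zero_add]
    split_ifs with h1 h2
    · subst h1; exact absurd h h2.not_gt
    · rfl
    · rfl
  · intro a
    simp only [R, Matrix.of_apply, if_true]
    split_ifs with h1 h2
    · subst h1; exact absurd h2 (lt_irrefl _)
    all_goals simp
  · ext a b
    rw [hCR, hLB, hLB]
    simp only [B', Matrix.of_apply]
    rcases lt_trichotomy a m with ha | rfl | ha <;> rcases lt_trichotomy b j with hb | rfl | hb
    · simp [ha.ne, hb.ne, hb, ha.not_gt, hcol a ha]
    · simp [ha.ne, ha.not_gt, hcol a ha]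
    · simp [ha.ne, hb.ne', hb.not_gt, ha.not_gt, hcol a ha]
    · simp [hb.ne, hb, mul_div_cancel₀ _ hp]
    · simp
    · simp [hb.ne', hb.not_gt, hrow b hb]
    · simp [ha.ne', hb.ne, hb, ha, hp]; field_simp; ring
    · simp [ha.ne', ha, hp]
    · simp [ha.ne', hb.ne', hb.not_gt, ha, hrow b hb]
  · simpa [B'] using hp
  · intro b hb; simp [B', hb]
  · intro a ha; simp [B', ha]
  · intro a b ha hb; simp [B', ha, hb]

/-- The Bruhat decomposition of an invertible matrix. -/
theorem exists_bruhat (A : Matrix (Fin n) (Fin n) k) (hA : A.det ≠ 0) :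
    ∃ (L R : Matrix (Fin n) (Fin n) k) (s : Equiv.Perm (Fin n)) (b : Fin n → k),
      IsLowerUnit L ∧ IsLowerUnit R ∧
      A = L * Matrix.of (fun i j => if j = s i then b i else 0) * R := by
  classical
  -- Invariant after `m` rounds: each of the first `m` rows has a single nonzero entry, and this
  -- entry is also alone in its column.
  have key : ∀ m : ℕ, m ≤ n → ∃ (L R B : Matrix (Fin n) (Fin n) k) (s : Fin n → Fin n),
      IsLowerUnit L ∧ IsLowerUnit R ∧ A = L * B * R ∧ ∀ i : Fin n, i.val < m →
        B i (s i) ≠ 0 ∧ (∀ j, j ≠ s i → B i j = 0) ∧ ∀ i', i' ≠ i → B i' (s i) = 0 := by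
    intro m
    induction m with
    | zero => exact fun _ => ⟨1, 1, A, id, .one, .one, by simp, fun i hi => absurd hi (by omega)⟩
    | succ m ih =>
      intro hm
      obtain ⟨L, R, B, s, hL, hR, hAB, hs⟩ := ih (by omega)
      have hB : B.det ≠ 0 := by
        rw [hAB, Matrix.det_mul, Matrix.det_mul] at hA
        exact right_ne_zero_of_mul (left_ne_zero_of_mul hA)
      let m' : Fin n := ⟨m, by omega⟩
      have hne : (Finset.univ.filter fun j => B m' j ≠ 0).Nonempty := by
        by_contra h
        rw [Finset.not_nonempty_iff_eq_empty, Finset.filter_eq_empty_iff] at h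
        exact hB (Matrix.det_eq_zero_of_row_eq_zero m' fun j => not_not.1 (h (Finset.mem_univ j)))
      -- The pivot is the last nonzero entry of the row, so nothing to its right has to be cleared.
      obtain ⟨j, hj, hmax⟩ := Finset.exists_max_image _ id hne
      have hp : B m' j ≠ 0 := (Finset.mem_filter.1 hj).2
      have hrow : ∀ b, j < b → B m' b = 0 := by
        intro b hb
        by_contra h
        exact hb.not_ge (hmax b (Finset.mem_filter.2 ⟨Finset.mem_univ _, h⟩))
      have hsj : ∀ i : Fin n, i.val < m → s i ≠ j := by
        rintro i hi rfl
        exact hp ((hs i hi).2.2 m' (Fin.ne_of_val_ne (by simp only [m']; omega)))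
      obtain ⟨L', R', B', hL', hR', hBB, h1, h2, h3, h4⟩ := exists_elimination_step hp hrow
        fun a ha => (hs a ha).2.1 j (hsj a ha).symm
      refine ⟨L * L', R' * R, B', Function.update s m' j, hL.mul hL', hR'.mul hR,
        by rw [hAB, hBB]; simp only [mul_assoc], fun i hi => ?_⟩
      by_cases him : i = m'
      · subst him
        rw [Function.update_self]
        exact ⟨h1, h2, h3⟩
      · have hi' : i.val < m := by
          have : i.val ≠ m := fun h => him (Fin.ext h)
          omega
        rw [Function.update_of_ne him]
        obtain ⟨g1, g2, g3⟩ := hs i hi'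
        have hBij : B i j = 0 := g2 j (hsj i hi').symm
        have hms : B m' (s i) = 0 := g3 m' (Ne.symm him)
        refine ⟨by rw [h4 _ _ him (hsj i hi'), hBij]; simpa using g1, fun l hl => ?_,
          fun i' hi' => ?_⟩
        · by_cases hlj : l = j
          · rw [hlj, h3 i him]
          · rw [h4 _ _ him hlj, hBij, g2 l hl]; simp
        · by_cases him' : i' = m'
          · rw [him', h2 _ (hsj i ‹_›)]
          · rw [h4 _ _ him' (hsj i ‹_›), hms, g3 i' hi']; simp
  obtain ⟨L, R, B, s, hL, hR, hAB, hs⟩ := key n le_rfl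
  have hinj : Function.Injective s := by
    intro i i' h
    by_contra hne
    exact (hs i' i'.2).1 (h ▸ (hs i i.2).2.2 i' (Ne.symm hne))
  refine ⟨L, R, Equiv.ofBijective s (Finite.injective_iff_bijective.1 hinj),
    fun i => B i (s i), hL, hR, ?_⟩
  rw [hAB]
  congr 2
  ext i j
  simp only [Equiv.ofBijective_apply, Matrix.of_apply]
  split_ifs with h
  · rw [h]
  · exact (hs i i.2).2.1 j h

/-- The affine endomorphism `x ↦ A x + v`. -/
def aff (A : Matrix (Fin n) (Fin n) k) (v : Fin n → k) : AffEnd k n :=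
  ofFun fun i => ∑ j, C (A i j) * X j + C (v i)

theorem aff_mul (A B : Matrix (Fin n) (Fin n) k) (v w : Fin n → k) :
    aff A v * aff B w = aff (A * B) (A.mulVec w + v) := by
  funext i
  rw [mul_apply]
  simp only [aff, ofFun_apply, map_add, map_sum, map_mul, subst_C, subst_X, Matrix.mul_apply,
    Matrix.mulVec, dotProduct, Pi.add_apply, mul_add, Finset.sum_add_distrib, Finset.sum_mul,
    Finset.mul_sum]
  rw [Finset.sum_comm]
  simp only [mul_assoc, add_assoc]

theorem aff_one : aff (1 : Matrix (Fin n) (Fin n) k) 0 = 1 := by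
  funext i
  simp [aff, one_apply, Matrix.one_apply, Finset.sum_ite_eq]

theorem degree_aff_le (A : Matrix (Fin n) (Fin n) k) (v : Fin n → k) : (aff A v).degree ≤ 1 := by
  rw [degree_le_iff]
  intro i
  refine (totalDegree_add _ _).trans (max_le ?_ (by simp))
  refine (totalDegree_finsetSum _ _).trans (Finset.sup_le fun j _ => ?_)
  exact (totalDegree_mul _ _).trans (by simp)

theorem aff_mul_aff_inv {A : Matrix (Fin n) (Fin n) k} (hA : A.det ≠ 0) (v : Fin n → k) :
    aff A v * aff A⁻¹ (-(A⁻¹.mulVec v)) = 1 := by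
  have h := Matrix.mul_nonsing_inv A hA.isUnit
  rw [aff_mul, h, Matrix.mulVec_neg, Matrix.mulVec_mulVec, h, Matrix.one_mulVec, neg_add_cancel,
    aff_one]

theorem aff_inv_mul_aff {A : Matrix (Fin n) (Fin n) k} (hA : A.det ≠ 0) (v : Fin n → k) :
    aff A⁻¹ (-(A⁻¹.mulVec v)) * aff A v = 1 := by
  rw [aff_mul, Matrix.nonsing_inv_mul A hA.isUnit, add_neg_cancel, aff_one]

theorem eq_aff_of_degree_le_one {f : AffEnd k n} (hf : f.degree ≤ 1) : ∃ A v, f = aff A v := by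
  refine ⟨Matrix.of fun i j => coeff (Finsupp.single j 1) (f i), fun i => coeff 0 (f i), ?_⟩
  funext i
  have hd := degree_le_iff.1 hf i
  refine MvPolynomial.ext _ _ fun m => ?_
  simp only [aff, ofFun_apply, Matrix.of_apply, coeff_add, coeff_sum, coeff_C_mul, coeff_X,
    coeff_C]
  rcases Nat.lt_or_ge 1 m.degree with h | h
  · have h0 : coeff m (f i) = 0 := by
      by_contra hne
      have := le_totalDegree (mem_support_iff.2 hne)
      have h2 : m.degree = m.sum fun _ e => e := rfl
      omega
    have h1 : ∀ j, Finsupp.single j 1 ≠ m := by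
      rintro j rfl
      simp at h
    have h2 : (0 : Fin n →₀ ℕ) ≠ m := by
      rintro rfl
      simp at h
    simp [h0, h1, h2]
  · rcases Nat.eq_zero_or_pos m.degree with h0 | h0
    · rw [Finsupp.degree_eq_zero_iff] at h0
      subst h0
      simp
    · have hm : m ∈ {d : Fin n →₀ ℕ | d.degree = 1} := le_antisymm h h0
      rw [← Finsupp.range_single_one] at hm
      obtain ⟨j, rfl⟩ := hm
      have h4 : (0 : Fin n →₀ ℕ) ≠ Finsupp.single j 1 := fun h => by
        simpa using congrArg Finsupp.degree h
      simp [Finsupp.single_left_inj, h4]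

/-- A left kernel vector `w` makes a combination of the components constant; substituting the
inverse gives `∑ w_i X_i` constant, so `w = 0`. -/
theorem det_ne_zero_of_isUnit_aff {A : Matrix (Fin n) (Fin n) k} {v : Fin n → k}
    (h : IsUnit (aff A v)) : A.det ≠ 0 := by
  intro h0
  obtain ⟨w, hw, hwA⟩ := Matrix.exists_vecMul_eq_zero_iff.2 h0
  obtain ⟨g, hg⟩ := h.exists_right_inv
  have h1 : ∑ i, C (w i) * aff A v i = C (∑ i, w i * v i) := by
    simp only [aff, ofFun_apply, mul_add, Finset.sum_add_distrib, Finset.mul_sum]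
    rw [Finset.sum_comm]
    have h2 : ∀ j, ∑ i, C (w i) * (C (A i j) * X j) = (0 : MvPolynomial (Fin n) k) := by
      intro j
      have := congrFun hwA j
      simp only [Matrix.vecMul, dotProduct, Pi.zero_apply] at this
      simp only [← mul_assoc, ← Finset.sum_mul, ← C_mul, ← map_sum, this, C_0, zero_mul]
    simp [h2]
  have h2 := congrArg g.subst h1
  simp only [map_sum, map_mul, subst_C, ← mul_apply, hg, one_apply] at h2
  apply hw
  funext i
  have h3 := congrArg (coeff (Finsupp.single i 1)) h2
  have h4 : (0 : Fin n →₀ ℕ) ≠ Finsupp.single i 1 := fun h => by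
    simpa using congrArg Finsupp.degree h
  simpa [coeff_sum, coeff_C_mul, coeff_X, Finsupp.single_left_inj, coeff_C, h4] using h3

theorem IsTriangular.mul {f g : AffEnd k n} (hf : f.IsTriangular) (hg : g.IsTriangular) :
    (f * g).IsTriangular := by
  intro i
  rw [mul_apply]
  exact subst_mem_supported
    (fun j hj => supported_mono (Set.Iic_subset_Iic.2 hj) (hg j)) (hf i)

theorem isTriangular_aff {L : Matrix (Fin n) (Fin n) k} (hL : IsLowerUnit L) (v : Fin n → k) :
    (aff L v).IsTriangular := by
  intro i
  refine add_mem (sum_mem fun j _ => ?_) (C_mem_supported _ _)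
  rcases lt_or_ge i j with h | h
  · rw [hL.1 i j h, C_0, zero_mul]; exact zero_mem _
  · exact mul_mem (C_mem_supported _ _) (X_mem_supported.2 h)

theorem isUnit_of_isConj {f g : AffEnd k n} (h : IsConj f g) (hf : IsUnit f) : IsUnit g := by
  obtain ⟨u, hu⟩ := h
  have : g = u * f * (u⁻¹ : (AffEnd k n)ˣ) := by
    rw [hu.eq, mul_assoc, Units.mul_inv, mul_one]
  rw [this]
  exact (u.isUnit.mul hf).mul (u⁻¹).isUnit

/-- An affine-triangular endomorphism is conjugate to a permutation-triangular one. -/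
theorem IsAffineTriangular.exists_isConj {f : AffEnd k n} (hf : f.IsAffineTriangular) :
    ∃ (s : Equiv.Perm (Fin n)) (t : AffEnd k n), t.IsTriangular ∧
      IsConj f (ofFun fun i => t (s i)) ∧ (ofFun fun i => t (s i)).degree ≤ f.degree := by
  obtain ⟨α, τ, ⟨hα, hα1⟩, hτ, rfl⟩ := hf
  obtain ⟨A, v, rfl⟩ := eq_aff_of_degree_le_one hα1.le
  obtain ⟨L, R, s, b, hL, hR, hA⟩ := exists_bruhat A (det_ne_zero_of_isUnit_aff hα)
  set B : Matrix (Fin n) (Fin n) k := Matrix.of fun i j => if j = s i then b i else 0 with hB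
  -- Conjugation moves `L` from the left of `B R τ` to its right, where it is absorbed in a
  -- triangular map. The translation `v` travels with `L`.
  let T : AffEnd k n := aff R 0 * τ * aff L v
  have hT : T.IsTriangular := ((isTriangular_aff hR 0).mul hτ).mul (isTriangular_aff hL v)
  have hα' : aff A v = aff L v * aff B 0 * aff R 0 := by
    rw [aff_mul, aff_mul, ← hA]; simp
  -- The scalars of the monomial matrix also go into the triangular map, leaving a pure permutation.
  let t : AffEnd k n := ofFun fun j => C (b (s.symm j)) * T j
  have ht : (ofFun fun i => t (s i)) = aff B 0 * T := by
    funext i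
    rw [mul_apply]
    simp only [t, aff, hB, ofFun_apply, Equiv.symm_apply_apply, map_add, map_sum, map_mul, subst_C,
      subst_X, Matrix.of_apply]
    simp [Finset.sum_ite_eq', apply_ite (C : k → MvPolynomial (Fin n) k)]
  have hLi := aff_mul_aff_inv hL.2 v
  have hLi' := aff_inv_mul_aff hL.2 v
  have hfac : aff B 0 * T = aff L⁻¹ (-(L⁻¹.mulVec v)) * (aff A v * τ) * aff L v := by
    rw [hα']
    simp only [T, mul_assoc]
    rw [← mul_assoc _ (aff L v), hLi', one_mul]
  refine ⟨s, t, fun i => mul_mem (C_mem_supported _ _) (hT i), ?_, ?_⟩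
  · rw [ht]
    refine ⟨⟨_, _, hLi', hLi⟩, ?_⟩
    change _ * _ = _ * _
    rw [hfac]
    simp only [mul_assoc]
    rw [hLi, mul_one]
  · rw [ht, hfac]
    refine (degree_mul_le _ _).trans ?_
    have h1 := degree_aff_le L v
    have h2 := degree_aff_le L⁻¹ (-(L⁻¹.mulVec v))
    calc _ ≤ (1 * (aff A v * τ).degree) * 1 :=
          Nat.mul_le_mul ((degree_mul_le _ _).trans (Nat.mul_le_mul_right _ h2)) h1
      _ = _ := by ring

end AffEnd

namespace AffEnd

/-! ### Weights and leading components of the triangular building blocks -/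

section Components

variable {k : Type*} [Field k] {σ : Type*}

/-- The largest weight of a monomial of `P` is `w`. -/
def IsWeight (μ : σ → ℝ≥0) (w : ℝ≥0) (P : MvPolynomial σ k) : Prop :=
  WeightLE μ w P ∧ ∃ m ∈ P.support, Finsupp.weight μ m = w

theorem IsLead.component_eq {μ : σ → ℝ≥0} {w : ℝ≥0} {P P₀ : MvPolynomial σ k}
    (h : IsLead μ w P P₀) : weightedHomogeneousComponent μ w P = P₀ := by
  classical
  refine MvPolynomial.ext _ _ fun m => ?_
  rw [coeff_weightedHomogeneousComponent]
  split_ifs with hm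
  · exact h.coeff_eq hm
  · by_contra h0
    exact hm (h.1 (Ne.symm h0))

theorem component_ne_zero {μ : σ → ℝ≥0} {w : ℝ≥0} {P : MvPolynomial σ k}
    (h : ∃ m ∈ P.support, Finsupp.weight μ m = w) : weightedHomogeneousComponent μ w P ≠ 0 := by
  classical
  obtain ⟨m, hm, hw⟩ := h
  rw [ne_zero_iff]
  refine ⟨m, ?_⟩
  rw [coeff_weightedHomogeneousComponent, if_pos hw]
  exact mem_support_iff.1 hm

theorem mem_support_component {μ : σ → ℝ≥0} {w : ℝ≥0} {P : MvPolynomial σ k} {m : σ →₀ ℕ}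
    (hm : m ∈ (weightedHomogeneousComponent μ w P).support) :
    m ∈ P.support ∧ Finsupp.weight μ m = w := by
  classical
  rw [support_weightedHomogeneousComponent] at hm
  exact Finset.mem_filter.1 hm

theorem component_mem_supported {μ : σ → ℝ≥0} {w : ℝ≥0} {P : MvPolynomial σ k} {s : Set σ}
    (hP : P ∈ supported k s) : weightedHomogeneousComponent μ w P ∈ supported k s :=
  mem_supported_iff_forall_support.2 fun m hm =>
    mem_supported_iff_forall_support.1 hP m (mem_support_component hm).1

theorem component_eq_zero_of_weightLT {μ : σ → ℝ≥0} {w : ℝ≥0} {P : MvPolynomial σ k}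
    (h : WeightLT μ w P) : weightedHomogeneousComponent μ w P = 0 :=
  IsLead.component_eq ⟨isWeightedHomogeneous_zero k μ w, by simpa using h⟩

theorem component_C_mul_X {μ : σ → ℝ≥0} {w : ℝ≥0} (e : k) (j : σ) :
    weightedHomogeneousComponent μ w (C e * X j : MvPolynomial σ k) =
      if μ j = w then C e * X j else 0 := by
  split_ifs with h
  · subst h
    exact ((isWeightedHomogeneous_X k μ j).C_mul e).weightedHomogeneousComponent_same
  · exact ((isWeightedHomogeneous_X k μ j).C_mul e).weightedHomogeneousComponent_ne w
      (Ne.symm h)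

theorem component_C {μ : σ → ℝ≥0} {w : ℝ≥0} (hw : w ≠ 0) (b : k) :
    weightedHomogeneousComponent μ w (C b : MvPolynomial σ k) = 0 :=
  (isWeightedHomogeneous_C μ b).weightedHomogeneousComponent_ne w hw

theorem component_zero_C {μ : σ → ℝ≥0} (b : k) :
    weightedHomogeneousComponent μ 0 (C b : MvPolynomial σ k) = C b :=
  (isWeightedHomogeneous_C μ b).weightedHomogeneousComponent_same

/-- As `q` does not involve `X j`, there is no cancellation; weight conditions on the sum split
accordingly. -/
theorem mem_support_C_mul_X_add {e : k} (he : e ≠ 0) {j : σ} {q : MvPolynomial σ k}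
    (hq : q ∈ supported k {j}ᶜ) {m : σ →₀ ℕ} :
    m ∈ (C e * X j + q).support ↔ m = Finsupp.single j 1 ∨ m ∈ q.support := by
  classical
  rw [mem_support_iff, mem_support_iff, coeff_add, coeff_C_mul, coeff_X]
  by_cases h : Finsupp.single j 1 = m
  · subst h
    have h0 : coeff (Finsupp.single j 1) q = 0 := by
      by_contra h0
      have := mem_supported_iff_forall_support.1 hq _ (mem_support_iff.2 h0) j (by simp)
      simp at this
    simp [h0, he]
  · simp [h, Ne.symm h]

theorem weightLE_C_mul_X_add_iff {e : k} (he : e ≠ 0) {j : σ} {q : MvPolynomial σ k}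
    (hq : q ∈ supported k {j}ᶜ) {μ : σ → ℝ≥0} {w : ℝ≥0} :
    WeightLE μ w (C e * X j + q) ↔ μ j ≤ w ∧ WeightLE μ w q := by
  simp [WeightLE, mem_support_C_mul_X_add he hq, or_imp, forall_and, Finsupp.weight_single]

theorem isWeight_C_mul_X_add_iff {e : k} (he : e ≠ 0) {j : σ} {q : MvPolynomial σ k}
    (hq : q ∈ supported k {j}ᶜ) {μ : σ → ℝ≥0} {w : ℝ≥0} :
    IsWeight μ w (C e * X j + q) ↔ μ j ≤ w ∧ WeightLE μ w q ∧
      (μ j = w ∨ ∃ m ∈ q.support, Finsupp.weight μ m = w) := by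
  rw [IsWeight, weightLE_C_mul_X_add_iff he hq, and_assoc]
  simp [mem_support_C_mul_X_add he hq, or_and_right, exists_or, Finsupp.weight_single]

theorem isWeight_C_mul_X_add_C_iff {e b : k} (he : e ≠ 0) {j : σ} {μ : σ → ℝ≥0} {w : ℝ≥0} :
    IsWeight μ w (C e * X j + C b) ↔ μ j = w := by
  rw [isWeight_C_mul_X_add_iff he (C_mem_supported _ _)]
  constructor
  · rintro ⟨h1, -, h | ⟨m, hm, h⟩⟩
    · exact h
    · have := weightLE_C μ b 0 m hm
      rw [h] at this
      exact le_antisymm h1 (this.trans zero_le)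
  · exact fun h => ⟨h.le, weightLE_C _ _ _, Or.inl h⟩

theorem aeval_X_eq_sum (i : σ) (p : Polynomial k) :
    Polynomial.aeval (X i : MvPolynomial σ k) p =
      ∑ l ∈ p.support, C (p.coeff l) * X i ^ l := by
  rw [Polynomial.aeval_def, Polynomial.eval₂_eq_sum, Polynomial.sum]
  rfl

theorem mem_support_aeval_X {i : σ} {p : Polynomial k} {m : σ →₀ ℕ} :
    m ∈ (Polynomial.aeval (X i : MvPolynomial σ k) p).support ↔
      ∃ l ∈ p.support, m = Finsupp.single i l := by
  classical
  have hc : coeff m (Polynomial.aeval (X i : MvPolynomial σ k) p) =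
      ∑ l ∈ p.support, if Finsupp.single i l = m then p.coeff l else 0 := by
    rw [aeval_X_eq_sum, coeff_sum]
    refine Finset.sum_congr rfl fun l _ => ?_
    rw [coeff_C_mul, coeff_X_pow]
    simp
  rw [mem_support_iff, hc]
  constructor
  · intro h
    obtain ⟨l, hl, h⟩ := Finset.exists_ne_zero_of_sum_ne_zero h
    exact ⟨l, hl, by by_contra h1; exact h (if_neg (Ne.symm h1))⟩
  · rintro ⟨l, hl, rfl⟩
    rw [Finset.sum_eq_single l]
    · simpa using hl
    · intro b _ hb
      rw [if_neg]
      exact fun h => hb (Finsupp.single_injective i h)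
    · exact fun h => absurd hl h

theorem aeval_X_mem_supported (i : σ) (p : Polynomial k) :
    Polynomial.aeval (X i : MvPolynomial σ k) p ∈ supported k {i} := by
  rw [supported_eq_adjoin_X, Set.image_singleton, Algebra.adjoin_singleton_eq_range_aeval]
  exact ⟨p, rfl⟩

theorem weightLE_aeval_X_iff {i : σ} {p : Polynomial k} {μ : σ → ℝ≥0} {w : ℝ≥0} :
    WeightLE μ w (Polynomial.aeval (X i : MvPolynomial σ k) p) ↔ p.natDegree * μ i ≤ w := by
  constructor
  · intro h
    by_cases hp : p = 0
    · simp [hp]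
    · have := h _ (mem_support_aeval_X.2 ⟨_, Polynomial.natDegree_mem_support_of_nonzero hp, rfl⟩)
      simpa [Finsupp.weight_single] using this
  · intro h m hm
    obtain ⟨l, hl, rfl⟩ := mem_support_aeval_X.1 hm
    refine le_trans ?_ h
    rw [Finsupp.weight_single, nsmul_eq_mul]
    gcongr
    exact Polynomial.le_natDegree_of_mem_supp l hl

theorem isWeight_C_mul_X_add_aeval_iff {e : k} (he : e ≠ 0) {i j : σ} (hij : i ≠ j)
    {p : Polynomial k} {μ : σ → ℝ≥0} {w : ℝ≥0} :
    IsWeight μ w (C e * X j + Polynomial.aeval (X i) p) ↔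
      μ j ≤ w ∧ p.natDegree * μ i ≤ w ∧ (μ j = w ∨ p.natDegree * μ i = w) := by
  have hs : Polynomial.aeval (X i : MvPolynomial σ k) p ∈ supported k {j}ᶜ :=
    supported_mono (by simpa using hij.symm) (aeval_X_mem_supported i p)
  rw [isWeight_C_mul_X_add_iff he hs, weightLE_aeval_X_iff]
  refine and_congr_right fun h1 => and_congr_right fun h2 => ?_
  constructor
  · rintro (h | ⟨m, hm, h⟩)
    · exact Or.inl h
    · obtain ⟨l, hl, rfl⟩ := mem_support_aeval_X.1 hm
      refine Or.inr (le_antisymm h2 ?_)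
      rw [← h, Finsupp.weight_single, nsmul_eq_mul]
      gcongr
      exact Polynomial.le_natDegree_of_mem_supp l hl
  · rintro (h | h)
    · exact Or.inl h
    -- For `p = 0` the default `natDegree = 0` makes the second alternative read `w = 0`; together
    -- with `μ j ≤ w` this is the first alternative.
    · by_cases hp : p = 0
      · rw [hp, Polynomial.natDegree_zero, Nat.cast_zero, zero_mul] at h
        exact Or.inl (le_antisymm h1 (h ▸ zero_le))
      · refine Or.inr ⟨_, mem_support_aeval_X.2
          ⟨_, Polynomial.natDegree_mem_support_of_nonzero hp, rfl⟩, ?_⟩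
        rw [Finsupp.weight_single, nsmul_eq_mul, h]

theorem aeval_eraseLead_add (i : σ) (p : Polynomial k) :
    Polynomial.aeval (X i : MvPolynomial σ k) p =
      Polynomial.aeval (X i) p.eraseLead + C p.leadingCoeff * X i ^ p.natDegree := by
  conv_lhs => rw [← Polynomial.eraseLead_add_C_mul_X_pow p]
  rw [map_add, map_mul, Polynomial.aeval_C, map_pow, Polynomial.aeval_X]
  rfl

theorem weightLT_aeval_eraseLead {i : σ} (p : Polynomial k) {μ : σ → ℝ≥0} (hi : 0 < μ i) :
    WeightLT μ (p.natDegree * μ i) (Polynomial.aeval (X i : MvPolynomial σ k) p.eraseLead) := by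
  intro m hm
  obtain ⟨l, hl, rfl⟩ := mem_support_aeval_X.1 hm
  rw [Finsupp.weight_single, nsmul_eq_mul]
  have : l < p.natDegree := Polynomial.lt_natDegree_of_mem_eraseLead_support hl
  gcongr

theorem component_aeval_of_eq {i : σ} {p : Polynomial k} {μ : σ → ℝ≥0} (hi : 0 < μ i) {w : ℝ≥0}
    (h : p.natDegree * μ i = w) :
    weightedHomogeneousComponent μ w (Polynomial.aeval (X i : MvPolynomial σ k) p) =
      C p.leadingCoeff * X i ^ p.natDegree := by
  refine IsLead.component_eq ⟨?_, ?_⟩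
  · rw [← h, ← nsmul_eq_mul]
    exact ((isWeightedHomogeneous_X k μ i).pow p.natDegree).C_mul p.leadingCoeff
  · rw [aeval_eraseLead_add, add_sub_cancel_right, ← h]
    exact weightLT_aeval_eraseLead p hi

theorem component_aeval_of_lt {i : σ} {p : Polynomial k} {μ : σ → ℝ≥0} {w : ℝ≥0}
    (h : p.natDegree * μ i < w) :
    weightedHomogeneousComponent μ w (Polynomial.aeval (X i : MvPolynomial σ k) p) = 0 :=
  component_eq_zero_of_weightLT fun m hm => (weightLE_aeval_X_iff.2 le_rfl m hm).trans_lt h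

theorem not_mem_supported_compl_of_weight {P : MvPolynomial σ k} (h0 : P ≠ 0) {j : σ}
    (h : ∀ m ∈ P.support, m j ≠ 0) : P ∉ supported k {j}ᶜ := by
  intro hP
  obtain ⟨m, hm⟩ := ne_zero_iff.1 h0
  exact h m (mem_support_iff.2 hm)
    (mem_supported_iff_forall_support.1 hP m (mem_support_iff.2 hm) j (by simp))

theorem not_mem_supported_C_mul_X_pow {a : k} (ha : a ≠ 0) (j : σ) {d : ℕ} (hd : d ≠ 0) :
    (C a * X j ^ d : MvPolynomial σ k) ∉ supported k {j}ᶜ := by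
  classical
  intro h
  have := mem_supported_iff_forall_support.1 h (Finsupp.single j d)
    (by rw [mem_support_iff, coeff_C_mul, coeff_X_pow]; simpa using ha) j (by simp)
  simp [hd] at this

theorem not_mem_supported_C_mul_X_add_C {a : k} (ha : a ≠ 0) (b : k) (j : σ) :
    (C a * X j + C b : MvPolynomial σ k) ∉ supported k {j}ᶜ := by
  intro h
  refine not_mem_supported_C_mul_X_pow ha j one_ne_zero ?_
  have := sub_mem h (C_mem_supported {j}ᶜ b)
  simpa using this

end Components

theorem weight_fin_three (μ : Fin 3 → ℝ≥0) (m : Fin 3 →₀ ℕ) :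
    Finsupp.weight μ m = m 0 * μ 0 + m 1 * μ 1 + m 2 * μ 2 := by
  simp [Finsupp.weight_eq_sum, Fin.sum_univ_three]

/-- The largest positive root of the equations `t ^ 2 = u t + v` from a finite family. -/
theorem exists_maximal_root {ι : Type*} (s : Finset ι) (u v : ι → ℕ) :
    ∃ θ : ℝ≥0, 1 ≤ θ ∧ (∀ x ∈ s, u x * θ + v x ≤ θ ^ 2) ∧
      (θ = 1 ∨ ∃ x ∈ s, u x * θ + v x = θ ^ 2) := by
  classical
  induction s using Finset.induction_on with
  | empty => exact ⟨1, le_rfl, by simp, Or.inl rfl⟩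
  | insert x s _ ih =>
    obtain ⟨θ, h1, hle, hex⟩ := ih
    by_cases hx : u x * θ + v x ≤ θ ^ 2
    · refine ⟨θ, h1, fun y hy => ?_, hex.imp_right fun ⟨y, hy, h⟩ =>
        ⟨y, Finset.mem_insert_of_mem hy, h⟩⟩
      rcases Finset.mem_insert.1 hy with rfl | hy
      exacts [hx, hle y hy]
    · rw [not_le] at hx
      have hx' : (θ : ℝ) ^ 2 < u x * θ + v x := by exact_mod_cast hx
      have hu0 : (0 : ℝ) ≤ u x := Nat.cast_nonneg _
      have hv0 : (0 : ℝ) ≤ v x := Nat.cast_nonneg _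
      have hθ1 : (1 : ℝ) ≤ θ := by exact_mod_cast h1
      have hsq := Real.sq_sqrt (show (0 : ℝ) ≤ (u x : ℝ) ^ 2 + 4 * v x by positivity)
      have hs0 := Real.sqrt_nonneg ((u x : ℝ) ^ 2 + 4 * v x)
      have hsu : (u x : ℝ) ≤ √((u x : ℝ) ^ 2 + 4 * v x) := Real.le_sqrt_of_sq_le (by linarith)
      set r := √((u x : ℝ) ^ 2 + 4 * v x)
      -- The new equation is violated at `θ`, so `θ` lies below its larger root `t`, which becomes
      -- the new maximum.
      obtain ⟨t, ht⟩ : ∃ t : ℝ≥0, (t : ℝ) = (u x + r) / 2 := ⟨⟨_, by positivity⟩, rfl⟩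
      have htu : (u x : ℝ) ≤ t := by rw [ht]; linarith
      have hroot' : (u x : ℝ) * t + v x = t ^ 2 := by rw [ht]; nlinarith
      have hroot : u x * t + v x = t ^ 2 := by exact_mod_cast hroot'
      have htθ' : (θ : ℝ) ≤ t := by
        by_contra h
        rw [not_le] at h
        nlinarith [mul_pos (sub_pos.2 h) (show (0 : ℝ) < θ + t - u x by linarith)]
      have htθ : θ ≤ t := by exact_mod_cast htθ'
      refine ⟨t, h1.trans htθ, fun y hy => ?_, Or.inr ⟨x, Finset.mem_insert_self _ _, hroot⟩⟩
      rcases Finset.mem_insert.1 hy with rfl | hy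
      · exact hroot.le
      · have hy' : (u y : ℝ) * θ + v y ≤ θ ^ 2 := by exact_mod_cast hle y hy
        have huy : (0 : ℝ) ≤ u y := Nat.cast_nonneg _
        have hvy : (0 : ℝ) ≤ v y := Nat.cast_nonneg _
        -- From `u_y ≤ θ` it follows that `t² - u_y t - v_y` increases beyond `θ`, so the old
        -- inequalities survive.
        have huθ : (u y : ℝ) ≤ θ := by nlinarith
        have : (u y : ℝ) * t + v y ≤ t ^ 2 := by nlinarith
        exact_mod_cast this

end AffEnd

/-! ### Normal form of triangular automorphisms in dimension three -/

namespace AffEnd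

variable {k : Type*} [Field k]

/-- The first component of a triangular automorphism of `𝔸³`. -/
abbrev triFst (a b : k) : MvPolynomial (Fin 3) k := C a * X 0 + C b

/-- The second component of a triangular automorphism of `𝔸³`. -/
abbrev triSnd (c : k) (p : Polynomial k) : MvPolynomial (Fin 3) k :=
  C c * X 1 + Polynomial.aeval (X 0) p

/-- The third component of a triangular automorphism of `𝔸³`. -/
abbrev triThd (e : k) (q : MvPolynomial (Fin 3) k) : MvPolynomial (Fin 3) k := C e * X 2 + q

theorem supported_inter {s t u : Set (Fin 3)} (h : s ∩ t ⊆ u) {P : MvPolynomial (Fin 3) k}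
    (hs : P ∈ supported k s) (ht : P ∈ supported k t) : P ∈ supported k u := by
  rw [mem_supported] at *
  exact (Set.subset_inter hs ht).trans h

theorem compl_two : ({2}ᶜ : Set (Fin 3)) = {0, 1} := by
  ext i; fin_cases i <;> simp

/-- Dividing an automorphism by an elementary one in the `j`-th variable. -/
theorem exists_isUnit_update {n : ℕ} {t : AffEnd k n} (ht : IsUnit t) {j : Fin n} {e : k}
    (he : e ≠ 0) {q : MvPolynomial (Fin n) k} (hq : q ∈ supported k {j}ᶜ)
    (htj : t j = C e * X j + q) (h : ∀ i ≠ j, t i ∈ supported k {j}ᶜ) :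
    ∃ t' : AffEnd k n, IsUnit t' ∧ t' j = X j ∧ ∀ i ≠ j, t' i = t i := by
  obtain ⟨u, hu⟩ := isUnit_elementary j he hq
  let t' : AffEnd k n := ofFun fun i => if i = j then X j else t i
  have hj : t' j = X j := if_pos rfl
  have hi : ∀ i ≠ j, t' i = t i := fun i hi => if_neg hi
  have h1 : t = t' * u := by
    rw [hu]
    funext i
    rw [mul_apply]
    by_cases hij : i = j
    · subst hij
      rw [hj, subst_X, elementary_self, htj]
    · rw [hi i hij, subst_elementary_of_mem_supported _ _ (h i hij)]
  rw [h1] at ht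
  exact ⟨t', (Units.isUnit_mul_units _ u).1 ht, hj, hi⟩

/-- Only the last component involves `X 2`, so it has the form `e X 2 + q`. Dividing by this
elementary map leaves an automorphism with last component `X 2`, to which the same argument applies
in `X 1` and then in `X 0`. -/
theorem IsTriangular.exists_normal_form {t : AffEnd k 3} (ht : t.IsTriangular) (hu : IsUnit t) :
    ∃ (a b c e : k) (p : Polynomial k) (q : MvPolynomial (Fin 3) k), a ≠ 0 ∧ c ≠ 0 ∧ e ≠ 0 ∧
      q ∈ supported k {0, 1} ∧ t 0 = triFst a b ∧ t 1 = triSnd c p ∧ t 2 = triThd e q := by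
  have ht0 : t 0 ∈ supported k {0} := supported_mono (by intro i; simp) (ht 0)
  have ht1 : t 1 ∈ supported k {0, 1} :=
    supported_mono (by intro i; fin_cases i <;> simp) (ht 1)
  have h02 : t 0 ∈ supported k {2}ᶜ := supported_mono (by simp) ht0
  have h12 : t 1 ∈ supported k {2}ᶜ := supported_mono (by simp [compl_two]) ht1
  have h01 : t 0 ∈ supported k {1}ᶜ := supported_mono (by simp) ht0
  have hz : ∀ i ≠ 2, t i ∈ supported k {2}ᶜ := by
    intro i hi
    fin_cases i
    exacts [h02, h12, absurd rfl hi]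
  obtain ⟨e, he, q, hq, h2⟩ := exists_eq_C_mul_X_add hu hz
  obtain ⟨t', hu', e2, ht'⟩ := exists_isUnit_update hu he hq h2 hz
  have e0 : t' 0 = t 0 := ht' 0 (by simp)
  have e1 : t' 1 = t 1 := ht' 1 (by simp)
  have hy : ∀ i ≠ 1, t' i ∈ supported k {1}ᶜ := by
    intro i hi
    fin_cases i
    · exact e0 ▸ h01
    · exact absurd rfl hi
    · change t' 2 ∈ _; rw [e2]; exact X_mem_supported.2 (by simp)
  obtain ⟨c, hc, p, hp, h1⟩ := exists_eq_C_mul_X_add hu' hy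
  obtain ⟨t'', hu'', e1', ht''⟩ := exists_isUnit_update hu' hc hp h1 hy
  rw [e1] at h1
  have hp0 : p ∈ supported k {0} := by
    have hp1 : p ∈ supported k {0, 1} := by
      have : p = t 1 - C c * X 1 := by rw [h1]; ring
      rw [this]
      exact sub_mem ht1 (mul_mem (C_mem_supported _ _) (X_mem_supported.2 (by simp)))
    exact supported_inter (by intro i; fin_cases i <;> simp) hp1 hp
  have e0' : t'' 0 = t 0 := (ht'' 0 (by simp)).trans e0
  have hx : ∀ i ≠ 0, t'' i ∈ supported k {0}ᶜ := by
    intro i hi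
    fin_cases i
    · exact absurd rfl hi
    · change t'' 1 ∈ _; rw [e1']; exact X_mem_supported.2 (by simp)
    · change t'' 2 ∈ _; rw [ht'' 2 (by simp), e2]; exact X_mem_supported.2 (by simp)
  obtain ⟨a, ha, b', hb', h0⟩ := exists_eq_C_mul_X_add hu'' hx
  rw [e0'] at h0
  have hb0 : b' ∈ supported k ∅ := by
    have hb1 : b' ∈ supported k {0} := by
      have : b' = t 0 - C a * X 0 := by rw [h0]; ring
      rw [this]
      exact sub_mem ht0 (mul_mem (C_mem_supported _ _) (X_mem_supported.2 (by simp)))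
    exact supported_inter (by simp) hb1 hb'
  rw [supported_empty, Algebra.mem_bot] at hb0
  obtain ⟨b, rfl⟩ := hb0
  obtain ⟨p, rfl⟩ := exists_aeval_of_mem_supported_singleton hp0
  exact ⟨a, b, c, e, p, q, ha, hc, he, compl_two ▸ hq, h0, h1, h2⟩

theorem isEigen_vec_iff {A B D : MvPolynomial (Fin 3) k} {μ : Fin 3 → ℝ≥0} {θ : ℝ≥0} :
    IsEigen μ θ (ofFun ![A, B, D]) ↔
      IsWeight μ (θ * μ 0) A ∧ IsWeight μ (θ * μ 1) B ∧ IsWeight μ (θ * μ 2) D := by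
  simp [IsEigen, IsWeight, Fin.forall_fin_succ]

theorem forall_weightLE_vec_iff {A B D : MvPolynomial (Fin 3) k} {μ : Fin 3 → ℝ≥0} {θ : ℝ≥0} :
    (∀ i, WeightLE μ (θ * μ i) (ofFun ![A, B, D] i)) ↔
      WeightLE μ (θ * μ 0) A ∧ WeightLE μ (θ * μ 1) B ∧ WeightLE μ (θ * μ 2) D := by
  simp [Fin.forall_fin_succ]

theorem weightLE_triFst_iff {a b : k} (ha : a ≠ 0) {μ : Fin 3 → ℝ≥0} {w : ℝ≥0} :
    WeightLE μ w (triFst a b) ↔ μ 0 ≤ w := by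
  rw [weightLE_C_mul_X_add_iff ha (C_mem_supported _ _)]
  simp [weightLE_C]

theorem weightLE_triSnd_iff {c : k} (hc : c ≠ 0) {p : Polynomial k} {μ : Fin 3 → ℝ≥0} {w : ℝ≥0} :
    WeightLE μ w (triSnd c p) ↔ μ 1 ≤ w ∧ p.natDegree * μ 0 ≤ w := by
  rw [weightLE_C_mul_X_add_iff hc
    (supported_mono (by simp) (aeval_X_mem_supported (0 : Fin 3) p)), weightLE_aeval_X_iff]

theorem weightLE_triThd_iff {e : k} (he : e ≠ 0) {q : MvPolynomial (Fin 3) k}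
    (hq : q ∈ supported k {0, 1}) {μ : Fin 3 → ℝ≥0} {w : ℝ≥0} :
    WeightLE μ w (triThd e q) ↔ μ 2 ≤ w ∧ WeightLE μ w q :=
  weightLE_C_mul_X_add_iff he (compl_two ▸ hq)

theorem isWeight_triFst_iff {a b : k} (ha : a ≠ 0) {μ : Fin 3 → ℝ≥0} {w : ℝ≥0} :
    IsWeight μ w (triFst a b) ↔ μ 0 = w :=
  isWeight_C_mul_X_add_C_iff ha

theorem isWeight_triSnd_iff {c : k} (hc : c ≠ 0) {p : Polynomial k} {μ : Fin 3 → ℝ≥0} {w : ℝ≥0} :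
    IsWeight μ w (triSnd c p) ↔
      μ 1 ≤ w ∧ p.natDegree * μ 0 ≤ w ∧ (μ 1 = w ∨ p.natDegree * μ 0 = w) :=
  isWeight_C_mul_X_add_aeval_iff hc (by simp)

theorem isWeight_triThd_iff {e : k} (he : e ≠ 0) {q : MvPolynomial (Fin 3) k}
    (hq : q ∈ supported k {0, 1}) {μ : Fin 3 → ℝ≥0} {w : ℝ≥0} :
    IsWeight μ w (triThd e q) ↔ μ 2 ≤ w ∧ WeightLE μ w q ∧
      (μ 2 = w ∨ ∃ m ∈ q.support, Finsupp.weight μ m = w) :=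
  isWeight_C_mul_X_add_iff he (compl_two ▸ hq)

theorem weight_of_mem_support {q : MvPolynomial (Fin 3) k} (hq : q ∈ supported k {0, 1})
    (μ : Fin 3 → ℝ≥0) {m : Fin 3 →₀ ℕ} (hm : m ∈ q.support) :
    Finsupp.weight μ m = m 0 * μ 0 + m 1 * μ 1 := by
  have h : m 2 = 0 := mem_supported_iff_forall_support.1 hq m hm 2 (by simp)
  rw [weight_fin_three, h]
  simp

theorem add_le_totalDegree {q : MvPolynomial (Fin 3) k} {m : Fin 3 →₀ ℕ} (hm : m ∈ q.support) :
    m 0 + m 1 ≤ q.totalDegree := by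
  refine le_trans ?_ (le_totalDegree hm)
  rw [Finsupp.sum_fintype _ _ (fun _ => rfl), Fin.sum_univ_three]
  omega

theorem weightLE_iff_of_mem_supported {q : MvPolynomial (Fin 3) k} (hq : q ∈ supported k {0, 1})
    {μ : Fin 3 → ℝ≥0} {w : ℝ≥0} :
    WeightLE μ w q ↔ ∀ m ∈ q.support, m 0 * μ 0 + m 1 * μ 1 ≤ w :=
  forall₂_congr fun m hm => by rw [weight_of_mem_support hq μ hm]

/-- Positive weights with factor `θ` itself serve for every `δ`. -/
theorem upper_of_pos {n : ℕ} {f : AffEnd k n} {θ : ℝ≥0} {μ : Fin n → ℝ≥0} (hμ : ∀ i, 0 < μ i)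
    (h : ∀ i, WeightLE μ (θ * μ i) (f i)) (δ : ℝ≥0) (_ : 0 < δ) :
    ∃ μ : Fin n → ℝ≥0, (∀ i, 0 < μ i) ∧ ∀ i, WeightLE μ ((θ + δ) * μ i) (f i) :=
  ⟨μ, hμ, fun i => (h i).mono (by gcongr; exact le_self_add)⟩

theorem eq_zero_of_eq_mul {θ x : ℝ≥0} (h1 : 1 < θ) (h : x = θ * x) : x = 0 := by
  by_contra h0
  have := mul_lt_mul_of_pos_right h1 (pos_of_ne_zero h0)
  rw [one_mul, ← h] at this
  exact lt_irrefl _ this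

theorem lt_mul_of_one_lt {θ x : ℝ≥0} (h1 : 1 < θ) (h : 0 < x) : x < θ * x := by
  simpa using mul_lt_mul_of_pos_right h1 h

section Nonvanishing

variable {σ : Type*}

theorem natDegree_ne_zero_of_aeval_X {j : σ} {Q : Polynomial k}
    (h0 : Polynomial.aeval (X j : MvPolynomial σ k) Q ≠ 0)
    (h : ∀ m ∈ (Polynomial.aeval (X j : MvPolynomial σ k) Q).support, m ≠ 0) :
    Q.natDegree ≠ 0 := by
  intro hd
  rw [Polynomial.eq_C_of_natDegree_eq_zero hd] at h0 h
  have hQ : Q.coeff 0 ≠ 0 := by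
    rintro hQ
    simp [hQ] at h0
  refine h 0 (mem_support_aeval_X.2 ⟨0, ?_, by simp⟩) rfl
  simpa using hQ

/-- Iterates of `(X₀, X₁) ↦ (h, γ X₀ᵈ)` with `h` nonconstant. -/
theorem iterate_ne_zero_of_X_pow {F : MvPolynomial (Fin 3) k →ₐ[k] MvPolynomial (Fin 3) k}
    {h : MvPolynomial (Fin 3) k} (hh : h ∈ supported k {0, 1}) (h0 : h ≠ 0)
    (hpos : ∀ m ∈ h.support, m ≠ 0) {γ : k} (hγ : γ ≠ 0) {d : ℕ} (hd : d ≠ 0)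
    (hF0 : F (X 0) = h) (hF1 : F (X 1) = C γ * X 0 ^ d) (r : ℕ) : F^[r] (X 0) ≠ 0 := by
  by_cases h1 : h ∈ supported k {1}ᶜ
  · have h2 : h ∈ supported k {0} :=
      supported_inter (by intro i; fin_cases i <;> simp) hh h1
    obtain ⟨Q, rfl⟩ := exists_aeval_of_mem_supported_singleton h2
    exact iterate_ne_zero_of_aeval (transcendental_X k 0)
      (natDegree_ne_zero_of_aeval_X h0 hpos) hF0 r
  · exact iterate_ne_zero_of_pair (i := 0) (j := 1) (by simp)
      (mul_mem (C_mem_supported _ _) (pow_mem (X_mem_supported.2 (by simp)) d))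
      (not_mem_supported_C_mul_X_pow hγ 0 hd) hh h1 (Or.inr ⟨hF0, hF1⟩)
      (X_mem_supported.2 (by simp)) (X_ne_zero _) r

theorem ne_zero_of_weight_ne_zero {μ : σ → ℝ≥0} {m : σ →₀ ℕ} (h : Finsupp.weight μ m ≠ 0) :
    m ≠ 0 := by
  rintro rfl
  simp at h

end Nonvanishing

end AffEnd

/-! ### Eigenvalues and eigenvectors for the permutations treated without a relation -/

namespace AffEnd

variable {k : Type*} [Field k] {a b c e : k} {p : Polynomial k} {q : MvPolynomial (Fin 3) k}

theorem pos_vec {x y z : ℝ≥0} (hx : 0 < x) (hy : 0 < y) (hz : 0 < z) :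
    ∀ i, 0 < (![x, y, z] : Fin 3 → ℝ≥0) i := by
  intro i
  fin_cases i
  exacts [hx, hy, hz]

/-- The permutation is the identity. -/
theorem hasStableEigenvalue_id (ha : a ≠ 0) (hc : c ≠ 0) (he : e ≠ 0) (hq : q ∈ supported k {0, 1})
    (hu : IsUnit (ofFun ![triFst a b, triSnd c p, triThd e q])) :
    HasStableEigenvalue (ofFun ![triFst a b, triSnd c p, triThd e q]) 1 := by
  refine hasStableEigenvalue_of hu le_rfl (i := 0) (j := 1) (by simp) ?_ ?_
    fun h => absurd h (lt_irrefl _)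
  -- With `N` above both degrees, the weights `1, N, N²` make each variable dominate all polynomials
  -- of degree less than `N` in the preceding ones.
  · set N : ℕ := p.natDegree + q.totalDegree + 1 with hN
    have hN0 : (0 : ℝ≥0) < N := by simp [hN]
    refine upper_of_pos (μ := ![1, (N : ℝ≥0), (N : ℝ≥0) ^ 2])
      (pos_vec one_pos hN0 (by positivity)) ?_
    rw [forall_weightLE_vec_iff, weightLE_triFst_iff ha, weightLE_triSnd_iff hc,
      weightLE_triThd_iff he hq, weightLE_iff_of_mem_supported hq]
    simp only [Matrix.cons_val_zero, Matrix.cons_val_one, Matrix.cons_val, one_mul, mul_one,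
      le_refl, true_and]
    refine ⟨by norm_cast; omega, fun m hm => ?_⟩
    have hm := add_le_totalDegree hm
    norm_cast
    nlinarith
  · refine ⟨![0, 0, 1], fun h => by simpa using congrFun h 2, ?_⟩
    rw [isEigen_vec_iff, isWeight_triFst_iff ha, isWeight_triSnd_iff hc,
      isWeight_triThd_iff he hq, weightLE_iff_of_mem_supported hq]
    simp

/-- The permutation exchanges the first two components, and `p` has degree at most one. -/
theorem hasStableEigenvalue_swap01_of_le (ha : a ≠ 0) (hc : c ≠ 0) (he : e ≠ 0)
    (hq : q ∈ supported k {0, 1}) (hp : p.natDegree ≤ 1)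
    (hu : IsUnit (ofFun ![triSnd c p, triFst a b, triThd e q])) :
    HasStableEigenvalue (ofFun ![triSnd c p, triFst a b, triThd e q]) 1 := by
  refine hasStableEigenvalue_of hu le_rfl (i := 0) (j := 1) (by simp) ?_ ?_
    fun h => absurd h (lt_irrefl _)
  · set N : ℕ := q.totalDegree + 1 with hN
    have hN0 : (0 : ℝ≥0) < N := by simp [hN]
    refine upper_of_pos (μ := ![1, 1, (N : ℝ≥0)]) (pos_vec one_pos one_pos hN0) ?_
    rw [forall_weightLE_vec_iff, weightLE_triFst_iff ha, weightLE_triSnd_iff hc,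
      weightLE_triThd_iff he hq, weightLE_iff_of_mem_supported hq]
    simp only [Matrix.cons_val_zero, Matrix.cons_val_one, Matrix.cons_val, one_mul, mul_one,
      le_refl, true_and]
    refine ⟨by exact_mod_cast hp, fun m hm => ?_⟩
    have hm := add_le_totalDegree hm
    norm_cast
    omega
  · refine ⟨![0, 0, 1], fun h => by simpa using congrFun h 2, ?_⟩
    rw [isEigen_vec_iff, isWeight_triFst_iff ha, isWeight_triSnd_iff hc,
      isWeight_triThd_iff he hq, weightLE_iff_of_mem_supported hq]
    simp

/-- The permutation exchanges the first two components, and `p` has degree at least two. -/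
theorem hasStableEigenvalue_swap01_of_two_le (ha : a ≠ 0) (hc : c ≠ 0) (he : e ≠ 0)
    (hq : q ∈ supported k {0, 1}) (hp : 2 ≤ p.natDegree)
    (hu : IsUnit (ofFun ![triSnd c p, triFst a b, triThd e q])) :
    HasStableEigenvalue (ofFun ![triSnd c p, triFst a b, triThd e q]) p.natDegree := by
  set d := p.natDegree with hd
  have hp0 : p ≠ 0 := by rintro rfl; simp at hd; omega
  have hd2 : (2 : ℝ≥0) ≤ d := by exact_mod_cast hp
  have hd1 : (1 : ℝ≥0) < d := lt_of_lt_of_le one_lt_two hd2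
  have hd0 : (0 : ℝ≥0) < d := zero_lt_one.trans hd1
  refine hasStableEigenvalue_of hu hd1.le (i := d) (j := 0) (by simp [sq]) ?_ ?_ ?_
  · set N : ℕ := q.totalDegree * d + 1 with hN
    have hN0 : (0 : ℝ≥0) < N := by simp [hN]
    refine upper_of_pos (μ := ![(d : ℝ≥0), 1, (N : ℝ≥0)]) (pos_vec hd0 one_pos hN0) ?_
    rw [forall_weightLE_vec_iff, weightLE_triFst_iff ha, weightLE_triSnd_iff hc,
      weightLE_triThd_iff he hq, weightLE_iff_of_mem_supported hq]
    simp only [Matrix.cons_val_zero, Matrix.cons_val_one, Matrix.cons_val, mul_one, le_refl,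
      true_and, ← hd, and_true]
    refine ⟨by norm_cast; nlinarith, by norm_cast; nlinarith, fun m hm => ?_⟩
    have hm := add_le_totalDegree hm
    norm_cast
    nlinarith [Nat.zero_le (m 1), Nat.mul_le_mul_right d hm]
  -- The third weight is chosen so that `d μ₂` is exactly the weight of `q`. It is zero when `q =
  -- 0`, and then `e z` attains the value.
  · set w : ℕ := q.support.sup fun m => m 0 * d + m 1 with hw
    refine ⟨![(d : ℝ≥0), 1, (w : ℝ≥0) / d], fun h => by simpa using congrFun h 1, ?_⟩
    rw [isEigen_vec_iff, isWeight_triFst_iff ha, isWeight_triSnd_iff hc,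
      isWeight_triThd_iff he hq, weightLE_iff_of_mem_supported hq]
    simp only [Matrix.cons_val_zero, Matrix.cons_val_one, Matrix.cons_val, mul_one, le_refl,
      true_and, ← hd, or_true, and_true, mul_div_cancel₀ _ hd0.ne']
    refine ⟨by norm_cast; nlinarith, div_le_self zero_le hd1.le, fun m hm => ?_, ?_⟩
    · exact_mod_cast Finset.le_sup (f := fun m : Fin 3 →₀ ℕ => m 0 * d + m 1) hm
    · by_cases h0 : q.support = ∅
      · left; simp [hw, h0]
      · right
        obtain ⟨m, hm, h⟩ := Finset.exists_mem_eq_sup q.support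
          (Finset.nonempty_of_ne_empty h0) fun m => m 0 * d + m 1
        refine ⟨m, hm, ?_⟩
        rw [weight_of_mem_support hq _ hm]
        simp only [Matrix.cons_val_zero, Matrix.cons_val_one, mul_one]
        exact_mod_cast h.symm
  · intro h1 μ hμ hE
    rw [isEigen_vec_iff, isWeight_triFst_iff ha, isWeight_triSnd_iff hc,
      isWeight_triThd_iff he hq] at hE
    obtain ⟨⟨-, -, -⟩, hx, -, hqw, hz⟩ := hE
    have hμ0 : 0 < μ 0 := by
      refine pos_of_ne_zero fun h0 => hμ ?_
      have h10 : μ 1 = 0 := by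
        rw [h0] at hx
        exact (mul_eq_zero.1 hx.symm).resolve_left hd0.ne'
      have h20 : μ 2 = 0 := by
        rcases hz with h | ⟨m, hm, h⟩
        · exact eq_zero_of_eq_mul h1 h
        · rw [weight_of_mem_support hq _ hm, h0, h10, mul_zero, mul_zero, zero_add] at h
          exact (mul_eq_zero.1 h.symm).resolve_left hd0.ne'
      funext i
      fin_cases i
      exacts [h0, h10, h20]
    -- The variable `y` is too light to contribute to the first component, whose leading part is `γ
    -- x^d` and stays in `k[x]`.
    have hlt : μ 1 ≠ d * μ 0 := by
      have h10 : 0 < μ 1 := by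
        refine pos_of_ne_zero fun h => ?_
        rw [h, mul_zero] at hx
        exact hμ0.ne' hx
      rw [hx]
      exact ((lt_mul_of_one_lt h1 h10).trans (lt_mul_of_one_lt h1 (mul_pos hd0 h10))).ne
    refine ⟨0, hμ0, fun r => ?_⟩
    rw [pow_apply_eq_iterate]
    refine iterate_ne_zero_of_aeval (transcendental_X k 0)
      (Q := Polynomial.C p.leadingCoeff * Polynomial.X ^ d) ?_ ?_ r
    · rw [Polynomial.natDegree_C_mul_X_pow _ _ (Polynomial.leadingCoeff_ne_zero.2 hp0)]
      omega
    · rw [subst_X]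
      simp only [leadingPart, ofFun_apply, Matrix.cons_val_zero, map_add, component_C_mul_X]
      rw [if_neg hlt, zero_add, component_aeval_of_eq hμ0 rfl]
      simp [hd]

/-- The permutation exchanges the last two components. -/
theorem exists_hasStableEigenvalue_swap12 (ha : a ≠ 0) (hc : c ≠ 0) (he : e ≠ 0)
    (hq : q ∈ supported k {0, 1})
    (hu : IsUnit (ofFun ![triFst a b, triThd e q, triSnd c p])) :
    ∃ θ, HasStableEigenvalue (ofFun ![triFst a b, triThd e q, triSnd c p]) θ := by
  set d : ℕ := max 1 (q.support.sup fun m => m 1) with hd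
  have hmd : ∀ m ∈ q.support, m 1 ≤ d := fun m hm =>
    (Finset.le_sup (f := fun m : Fin 3 →₀ ℕ => m 1) hm).trans (le_max_right _ _)
  have hdex : d = 1 ∨ ∃ m ∈ q.support, m 1 = d := by
    by_cases h0 : q.support = ∅
    · left; simp [hd, h0]
    · obtain ⟨m, hm, h⟩ := Finset.exists_mem_eq_sup q.support
        (Finset.nonempty_of_ne_empty h0) fun m => m 1
      rcases le_total (q.support.sup fun m => m 1) 1 with h1 | h1
      · left; rw [hd, max_eq_left h1]
      · right; exact ⟨m, hm, by rw [hd, max_eq_right h1, h]⟩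
  have hd1' : 1 ≤ d := le_max_left _ _
  have hd1 : (1 : ℝ≥0) ≤ d := by exact_mod_cast hd1'
  have hd0 : (0 : ℝ≥0) < d := zero_lt_one.trans_le hd1
  refine ⟨d, hasStableEigenvalue_of hu hd1 (i := d) (j := 0) (by simp [sq]) ?_ ?_ ?_⟩
  · intro δ hδ
    -- The eigenvector gives `x` weight zero. A small weight `ε` makes it positive, and `N ε ≤ min 1
    -- δ` ensures that powers of `x` cost at most the slack.
    set N : ℕ := p.natDegree + q.totalDegree + 1 with hN
    have hN0 : (0 : ℝ≥0) < N := by simp [hN]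
    set ε : ℝ≥0 := min 1 δ / N with hε
    have hε0 : 0 < ε := div_pos (lt_min one_pos hδ) hN0
    have hNε : (N : ℝ≥0) * ε = min 1 δ := mul_div_cancel₀ _ hN0.ne'
    have hNε1 : (N : ℝ≥0) * ε ≤ 1 := hNε ▸ min_le_left _ _
    have hNεδ : (N : ℝ≥0) * ε ≤ δ := hNε ▸ min_le_right _ _
    refine ⟨![ε, (d : ℝ≥0), 1], pos_vec hε0 hd0 one_pos, ?_⟩
    rw [forall_weightLE_vec_iff, weightLE_triFst_iff ha, weightLE_triSnd_iff hc,
      weightLE_triThd_iff he hq, weightLE_iff_of_mem_supported hq]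
    simp only [Matrix.cons_val_zero, Matrix.cons_val_one, Matrix.cons_val, mul_one]
    have hdδ : (1 : ℝ≥0) ≤ d + δ := hd1.trans le_self_add
    refine ⟨le_mul_of_one_le_left zero_le hdδ, ⟨one_le_mul hdδ hd1, fun m hm => ?_⟩,
      le_self_add, ?_⟩
    · have h1 : (m 0 : ℝ≥0) ≤ N := by
        have := add_le_totalDegree hm
        norm_cast; omega
      have h2 : (m 1 : ℝ≥0) ≤ d := by exact_mod_cast hmd m hm
      calc (m 0 : ℝ≥0) * ε + m 1 * d ≤ N * ε + d * d := by gcongr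
        _ ≤ δ * d + d * d := by
            exact add_le_add_left (hNεδ.trans (le_mul_of_one_le_right zero_le hd1)) _
        _ = (d + δ) * d := by ring
    · have h1 : (p.natDegree : ℝ≥0) ≤ N := by norm_cast; omega
      calc (p.natDegree : ℝ≥0) * ε ≤ N * ε := by gcongr
        _ ≤ 1 := hNε1
        _ ≤ d + δ := hdδ
  · refine ⟨![0, (d : ℝ≥0), 1], fun h => by simpa using congrFun h 2, ?_⟩
    rw [isEigen_vec_iff, isWeight_triFst_iff ha, isWeight_triSnd_iff hc,
      isWeight_triThd_iff he hq, weightLE_iff_of_mem_supported hq]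
    simp only [Matrix.cons_val_zero, Matrix.cons_val_one, Matrix.cons_val, mul_one, mul_zero,
      zero_add, true_and, le_refl, zero_le, true_or, and_true]
    refine ⟨one_le_mul hd1 hd1, fun m hm => ?_, ?_⟩
    · have : (m 1 : ℝ≥0) ≤ d := by exact_mod_cast hmd m hm
      gcongr
    · rcases hdex with h | ⟨m, hm, h⟩
      · left; simp [h]
      · right
        refine ⟨m, hm, ?_⟩
        rw [weight_of_mem_support hq _ hm]
        simp [h]
  · intro h1 μ hμ hE
    rw [isEigen_vec_iff, isWeight_triFst_iff ha, isWeight_triSnd_iff hc,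
      isWeight_triThd_iff he hq] at hE
    obtain ⟨hx, ⟨-, -, hy⟩, hz, -, hz'⟩ := hE
    have hμ0 : μ 0 = 0 := eq_zero_of_eq_mul h1 hx
    have h12 : μ 1 = d * μ 2 := by
      rcases hz' with h | h
      · exact h
      · rw [hμ0, mul_zero] at h
        rw [← h] at hz ⊢
        exact le_antisymm hz zero_le
    have hμ2 : 0 < μ 2 := by
      refine pos_of_ne_zero fun h0 => hμ ?_
      rw [h0, mul_zero] at h12
      funext i
      fin_cases i
      exacts [hμ0, h12, h0]
    have hμ1 : 0 < μ 1 := h12 ▸ mul_pos hd0 hμ2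
    have hne : μ 2 ≠ d * μ 1 := by
      rw [h12]
      exact ((lt_mul_of_one_lt h1 hμ2).trans (lt_mul_of_one_lt h1 (mul_pos hd0 hμ2))).ne
    -- The leading part acts on `k[x, y]` by `x ↦ a x + b`, `y ↦ h`. Since `x` has weight zero,
    -- every monomial of `h` contains `y`, which gives injectivity.
    set h := weightedHomogeneousComponent μ (d * μ 1) q with hh
    have hh0 : h ≠ 0 := component_ne_zero (hy.resolve_left hne)
    have hhs : h ∈ supported k {0, 1} := component_mem_supported hq
    refine ⟨1, hμ1, fun r => ?_⟩
    rw [pow_apply_eq_iterate]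
    refine iterate_ne_zero_of_pair (i := 0) (j := 1) (u := triFst a b) (v := h) (by simp)
      (add_mem (mul_mem (C_mem_supported _ _) (X_mem_supported.2 (by simp)))
        (C_mem_supported _ _)) (not_mem_supported_C_mul_X_add_C ha b 0) hhs
      (not_mem_supported_compl_of_weight hh0 fun m hm h0 => ?_) (Or.inl ⟨?_, ?_⟩)
      (X_mem_supported.2 (by simp)) (X_ne_zero _) r
    · obtain ⟨hm, hw⟩ := mem_support_component hm
      rw [weight_of_mem_support hq _ hm, hμ0, h0, mul_zero, Nat.cast_zero, zero_mul, zero_add] at hw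
      exact (mul_pos hd0 hμ1).ne hw
    · rw [subst_X]
      simp only [leadingPart, ofFun_apply, Matrix.cons_val_zero, map_add, component_C_mul_X]
      rw [if_pos hx, hμ0, mul_zero, component_zero_C]
    · rw [subst_X]
      simp only [leadingPart, ofFun_apply, Matrix.cons_val_one, Matrix.cons_val_zero, map_add,
        component_C_mul_X]
      simp [hne, hh]

theorem exists_nat_of_maximal_root {ι : Type*} {s : Finset ι} {u v : ι → ℕ} {θ : ℝ≥0}
    (h : θ = 1 ∨ ∃ x ∈ s, u x * θ + v x = θ ^ 2) : ∃ i j : ℕ, θ ^ 2 = i * θ + j := by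
  rcases h with rfl | ⟨x, -, h⟩
  · exact ⟨0, 1, by simp⟩
  · exact ⟨u x, v x, h.symm⟩

/-- The permutation exchanges the first and the last component. -/
theorem exists_hasStableEigenvalue_swap02 (ha : a ≠ 0) (hc : c ≠ 0) (he : e ≠ 0)
    (hq : q ∈ supported k {0, 1})
    (hu : IsUnit (ofFun ![triThd e q, triSnd c p, triFst a b])) :
    ∃ θ, HasStableEigenvalue (ofFun ![triThd e q, triSnd c p, triFst a b]) θ := by
  set d := p.natDegree with hd
  -- For the weights `(θ, d, 1)` a monomial `x^i y^j` of `q` has weight `i θ + j d`, to be compared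
  -- with `θ²`.
  obtain ⟨θ, hθ1, hle, hex⟩ := exists_maximal_root q.support (fun m => m 0) (fun m => m 1 * d)
  obtain ⟨i, j, hH⟩ := exists_nat_of_maximal_root hex
  have hθ0 : 0 < θ := zero_lt_one.trans_le hθ1
  push_cast at hle hex
  refine ⟨θ, hasStableEigenvalue_of hu hθ1 hH ?_ ?_ ?_⟩
  · intro δ hδ
    set N : ℕ := q.totalDegree + 1 with hN
    have hN0 : (0 : ℝ≥0) < N := by simp [hN]
    -- The weight `d` of `y` is zero when `p` is constant; adding `ε` makes it positive within the
    -- slack `δ`.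
    set ε : ℝ≥0 := δ / N with hε
    have hε0 : 0 < ε := div_pos hδ hN0
    have hNε : (N : ℝ≥0) * ε = δ := mul_div_cancel₀ _ hN0.ne'
    refine ⟨![θ, d + ε, 1], pos_vec hθ0 (add_pos_of_nonneg_of_pos zero_le hε0) one_pos, ?_⟩
    rw [forall_weightLE_vec_iff, weightLE_triFst_iff ha, weightLE_triSnd_iff hc,
      weightLE_triThd_iff he hq, weightLE_iff_of_mem_supported hq]
    simp only [Matrix.cons_val_zero, Matrix.cons_val_one, Matrix.cons_val, mul_one, ← hd]
    have hθδ : 1 ≤ θ + δ := hθ1.trans le_self_add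
    refine ⟨⟨one_le_mul hθδ hθ1, fun m hm => ?_⟩,
      ⟨le_mul_of_one_le_left zero_le hθδ, ?_⟩, le_self_add⟩
    · have h1 : (m 1 : ℝ≥0) ≤ N := by
        have := add_le_totalDegree hm
        norm_cast; omega
      calc (m 0 : ℝ≥0) * θ + m 1 * (d + ε) = (m 0 * θ + m 1 * d) + m 1 * ε := by ring
        _ ≤ θ ^ 2 + N * ε := add_le_add (hle m hm) (by gcongr)
        _ ≤ θ ^ 2 + δ * θ := by
            rw [hNε]; exact add_le_add_right (le_mul_of_one_le_right zero_le hθ1) _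
        _ = (θ + δ) * θ := by ring
    · rw [mul_comm]
      exact mul_le_mul' le_self_add le_self_add
  · refine ⟨![θ, (d : ℝ≥0), 1], fun h => by simpa using congrFun h 2, ?_⟩
    rw [isEigen_vec_iff, isWeight_triFst_iff ha, isWeight_triSnd_iff hc,
      isWeight_triThd_iff he hq, weightLE_iff_of_mem_supported hq]
    simp only [Matrix.cons_val_zero, Matrix.cons_val_one, Matrix.cons_val, mul_one, ← hd, and_true]
    refine ⟨⟨one_le_mul hθ1 hθ1, fun m hm => ?_, ?_⟩, le_mul_of_one_le_left zero_le hθ1,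
      (mul_comm _ _).le, Or.inr (mul_comm _ _)⟩
    · rw [← sq]; exact hle m hm
    · rcases hex with h | ⟨m, hm, h⟩
      · left; simp [h]
      · right
        refine ⟨m, hm, ?_⟩
        rw [weight_of_mem_support hq _ hm, ← sq]
        simpa using h
  · intro h1 μ hμ hE
    rw [isEigen_vec_iff, isWeight_triFst_iff ha, isWeight_triSnd_iff hc,
      isWeight_triThd_iff he hq, ← hd] at hE
    obtain ⟨⟨-, -, hx⟩, ⟨hy1, hy2, hy⟩, hz⟩ := hE
    have hμ0 : 0 < μ 0 := by
      refine pos_of_ne_zero fun h0 => hμ ?_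
      have h20 : μ 2 = 0 := by
        rw [h0] at hz
        exact (mul_eq_zero.1 hz.symm).resolve_left hθ0.ne'
      have h10 : μ 1 = 0 := by
        rcases hy with h | h
        · exact eq_zero_of_eq_mul h1 h
        · rw [h0, mul_zero] at h
          exact (mul_eq_zero.1 h.symm).resolve_left hθ0.ne'
      funext i
      fin_cases i
      exacts [h0, h10, h20]
    have hμ2 : 0 < μ 2 := by
      refine pos_of_ne_zero fun h => ?_
      rw [h, mul_zero] at hz
      exact hμ0.ne' hz
    have hne : μ 2 ≠ θ * μ 0 := by
      rw [hz]
      exact ((lt_mul_of_one_lt h1 hμ2).trans (lt_mul_of_one_lt h1 (mul_pos hθ0 hμ2))).ne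
    set h := weightedHomogeneousComponent μ (θ * μ 0) q with hh
    have hh0 : h ≠ 0 := component_ne_zero (hx.resolve_left hne)
    have hhs : h ∈ supported k {0, 1} := component_mem_supported hq
    have hF0 : (leadingPart μ θ (ofFun ![triThd e q, triSnd c p, triFst a b])).subst (X 0) = h := by
      rw [subst_X]
      simp only [leadingPart, ofFun_apply, Matrix.cons_val_zero, map_add, component_C_mul_X]
      simp [hne, hh]
    refine ⟨0, hμ0, fun r => ?_⟩
    rw [pow_apply_eq_iterate]
    -- If `p` is constant, `y` has weight zero and moves by an affine map of the line, while every
    -- monomial of `h` involves `x`. Otherwise the leading part sends `y` to `γ x^d`.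
    rcases Nat.eq_zero_or_pos d with hd0 | hd0
    · have hμ1 : μ 1 = 0 := by
        rcases hy with h | h
        · exact eq_zero_of_eq_mul h1 h
        · rw [hd0, Nat.cast_zero, zero_mul] at h
          exact (mul_eq_zero.1 h.symm).resolve_left hθ0.ne'
      rw [hd0, eq_comm] at hd
      have hF1 : (leadingPart μ θ (ofFun ![triThd e q, triSnd c p, triFst a b])).subst (X 1) =
          C c * X 1 + C (p.coeff 0) := by
        rw [subst_X]
        simp only [leadingPart, ofFun_apply, Matrix.cons_val_one, Matrix.cons_val_zero, map_add,
          component_C_mul_X]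
        rw [hμ1, mul_zero, if_pos rfl]
        congr 1
        rw [Polynomial.eq_C_of_natDegree_eq_zero hd, Polynomial.aeval_C, Polynomial.coeff_C_zero]
        exact component_zero_C _
      refine iterate_ne_zero_of_pair (i := 1) (j := 0) (by simp)
        (add_mem (mul_mem (C_mem_supported _ _) (X_mem_supported.2 (by simp)))
          (C_mem_supported _ _)) (not_mem_supported_C_mul_X_add_C hc (p.coeff 0) 1)
        (Set.pair_comm (0 : Fin 3) 1 ▸ hhs)
        (not_mem_supported_compl_of_weight hh0 fun m hm h0 => ?_) (Or.inl ⟨hF1, hF0⟩)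
        (X_mem_supported.2 (by simp)) (X_ne_zero _) r
      obtain ⟨hm, hw⟩ := mem_support_component hm
      rw [weight_of_mem_support hq _ hm, hμ1, h0, mul_zero, Nat.cast_zero, zero_mul, zero_add] at hw
      exact (mul_pos hθ0 hμ0).ne hw
    · have hd0' : (0 : ℝ≥0) < d := by exact_mod_cast hd0
      have hμ1 : 0 < μ 1 := by
        refine pos_of_ne_zero fun h => ?_
        rw [h, mul_zero] at hy2
        exact (mul_pos hd0' hμ0).not_ge hy2
      have hne1 : μ 1 ≠ θ * μ 1 := (lt_mul_of_one_lt h1 hμ1).ne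
      have hp0 : p ≠ 0 := by rintro rfl; simp at hd; omega
      refine iterate_ne_zero_of_X_pow hhs hh0 (fun m hm => ?_)
        (Polynomial.leadingCoeff_ne_zero.2 hp0) (d := d) (by omega) hF0 ?_ r
      · refine ne_zero_of_weight_ne_zero (μ := μ) ?_
        rw [(mem_support_component hm).2]
        exact (mul_pos hθ0 hμ0).ne'
      · rw [subst_X]
        simp only [leadingPart, ofFun_apply, Matrix.cons_val_one, Matrix.cons_val_zero, map_add,
          component_C_mul_X]
        rw [if_neg hne1, zero_add, component_aeval_of_eq hμ0 (hy.resolve_left hne1)]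

/-- The permutation is the cycle for which `f₁ = τ₃`, with vanishing `p`. -/
theorem exists_hasStableEigenvalue_cycle (ha : a ≠ 0) (hc : c ≠ 0) (he : e ≠ 0)
    (hq : q ∈ supported k {0, 1})
    (hu : IsUnit (ofFun ![triThd e q, triFst a b, triSnd c 0])) :
    ∃ θ, HasStableEigenvalue (ofFun ![triThd e q, triFst a b, triSnd c 0]) θ := by
  -- The components `a x + b` and `c y` force weights proportional to `(θ, 1, θ⁻¹)`, so that `q`
  -- gives `i θ + j` against `θ²`.
  obtain ⟨θ, hθ1, hle, hex⟩ := exists_maximal_root q.support (fun m => m 0) (fun m => m 1)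
  obtain ⟨i, j, hH⟩ := exists_nat_of_maximal_root hex
  have hθ0 : 0 < θ := zero_lt_one.trans_le hθ1
  have hinv : θ⁻¹ ≤ θ * θ := (inv_le_one_of_one_le₀ hθ1).trans (one_le_mul hθ1 hθ1)
  have hE : IsEigen ![θ, 1, θ⁻¹] θ (ofFun ![triThd e q, triFst a b, triSnd c 0]) := by
    rw [isEigen_vec_iff, isWeight_triFst_iff ha, isWeight_triSnd_iff hc,
      isWeight_triThd_iff he hq, weightLE_iff_of_mem_supported hq]
    simp only [Matrix.cons_val_zero, Matrix.cons_val_one, Matrix.cons_val, mul_one,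
      mul_inv_cancel₀ hθ0.ne', Polynomial.natDegree_zero, Nat.cast_zero, zero_mul, le_refl,
      zero_le, true_or, and_true]
    refine ⟨hinv, fun m hm => by rw [← sq]; exact hle m hm, ?_⟩
    rcases hex with h | ⟨m, hm, h⟩
    · left; simp [h]
    · right
      refine ⟨m, hm, ?_⟩
      rw [weight_of_mem_support hq _ hm, ← sq]
      simpa using h
  refine ⟨θ, hasStableEigenvalue_of hu hθ1 hH
    (upper_of_pos (pos_vec hθ0 one_pos (inv_pos.2 hθ0)) fun i => (hE i).1)
    ⟨_, fun h => by simpa using congrFun h 1, hE⟩ ?_⟩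
  intro h1 μ hμ hE
  rw [isEigen_vec_iff, isWeight_triFst_iff ha, isWeight_triSnd_iff hc,
    isWeight_triThd_iff he hq] at hE
  obtain ⟨⟨-, -, hx⟩, hy, hz1, -, hz⟩ := hE
  have h12 : μ 1 = θ * μ 2 := by
    rcases hz with h | h
    · exact h
    · rw [Polynomial.natDegree_zero, Nat.cast_zero, zero_mul] at h
      rw [← h] at hz1 ⊢
      exact le_antisymm hz1 zero_le
  have hμ2 : 0 < μ 2 := by
    refine pos_of_ne_zero fun h0 => hμ ?_
    rw [h0, mul_zero] at h12
    rw [h12, mul_zero] at hy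
    funext i
    fin_cases i
    exacts [hy, h12, h0]
  have hμ1 : 0 < μ 1 := h12 ▸ mul_pos hθ0 hμ2
  have hμ0 : 0 < μ 0 := hy ▸ mul_pos hθ0 hμ1
  have hne : μ 2 ≠ θ * μ 0 := by
    refine ((lt_mul_of_one_lt h1 hμ2).trans ?_).ne
    rw [← h12]
    refine (lt_mul_of_one_lt h1 hμ1).trans ?_
    rw [← hy]
    exact lt_mul_of_one_lt h1 hμ0
  set h := weightedHomogeneousComponent μ (θ * μ 0) q with hh
  refine ⟨0, hμ0, fun r => ?_⟩
  rw [pow_apply_eq_iterate]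
  refine iterate_ne_zero_of_X_pow (h := h) (component_mem_supported hq)
    (component_ne_zero (hx.resolve_left hne)) (fun m hm => ?_) ha (d := 1) one_ne_zero
    ?_ ?_ r
  · refine ne_zero_of_weight_ne_zero (μ := μ) ?_
    rw [(mem_support_component hm).2]
    exact (mul_pos hθ0 hμ0).ne'
  · rw [subst_X]
    simp only [leadingPart, ofFun_apply, Matrix.cons_val_zero, map_add, component_C_mul_X]
    simp [hne, hh]
  · rw [subst_X]
    simp only [leadingPart, ofFun_apply, Matrix.cons_val_one, Matrix.cons_val_zero, map_add,
      component_C_mul_X]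
    rw [if_pos hy, component_C (mul_pos hθ0 hμ1).ne', add_zero, pow_one]

end AffEnd

/-! ### The two 3-cycles: conjugation, eigenvectors and the exceptional relation -/

namespace AffEnd

variable {k : Type*} [Field k] {a b c e : k} {p : Polynomial k} {q : MvPolynomial (Fin 3) k}

/-- `f` is conjugate to a permutation-triangular endomorphism, of degree at most that of `f`, whose
maximal eigenvalue has the required properties. -/
def HasStableModel (f : AffEnd k 3) : Prop :=
  ∃ f' : AffEnd k 3, f'.IsPermTriangular ∧ IsConj f f' ∧ f'.degree ≤ f.degree ∧
    ∃ θ, HasStableEigenvalue f' θ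

theorem HasStableModel.of_isConj {f g : AffEnd k 3} (hg : HasStableModel g) (hc : IsConj f g)
    (hd : g.degree ≤ f.degree) : HasStableModel f := by
  obtain ⟨f', h1, h2, h3, h4⟩ := hg
  exact ⟨f', h1, hc.trans h2, h3.trans hd, h4⟩

theorem isPermTriangular_of_vec (hq : q ∈ supported k {0, 1}) (s : Equiv.Perm (Fin 3))
    {f : AffEnd k 3} (hf : ∀ i, f i = ![triFst a b, triSnd c p, triThd e q] (s i)) :
    f.IsPermTriangular := by
  refine ⟨ofFun fun i => X (s i), ofFun ![triFst a b, triSnd c p, triThd e q], ⟨s, fun _ => rfl⟩,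
    ?_, ?_⟩
  · intro i
    fin_cases i
    · exact add_mem (mul_mem (C_mem_supported _ _) (X_mem_supported.2 (by simp)))
        (C_mem_supported _ _)
    · exact add_mem (mul_mem (C_mem_supported _ _) (X_mem_supported.2 (by simp)))
        (supported_mono (by simp) (aeval_X_mem_supported (0 : Fin 3) p))
    · refine add_mem (mul_mem (C_mem_supported _ _) (X_mem_supported.2 (by simp)))
        (supported_mono ?_ hq)
      intro i _
      exact Fin.le_last i
  · funext i
    rw [mul_apply, ofFun_apply, subst_X, ofFun_apply, hf]

theorem isConj_of_isUnit {n : ℕ} {f g φ : AffEnd k n} (hφ : IsUnit φ) (h : φ * f = g * φ) :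
    IsConj f g := by
  obtain ⟨u, rfl⟩ := hφ
  exact ⟨u, h⟩

theorem degree_vec_le_iff {A B D : MvPolynomial (Fin 3) k} {d : ℕ} :
    (ofFun ![A, B, D]).degree ≤ d ↔ WeightLE 1 (d : ℝ≥0) A ∧ WeightLE 1 (d : ℝ≥0) B ∧
      WeightLE 1 (d : ℝ≥0) D := by
  simp [degree_le_iff, weightLE_one_iff, Fin.forall_fin_succ]

theorem algHom_aeval_X {σ A : Type*} [CommRing A] [Algebra k A] (F : MvPolynomial σ k →ₐ[k] A)
    (i : σ) (P : Polynomial k) :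
    F (Polynomial.aeval (X i) P) = Polynomial.aeval (F (X i)) P :=
  (Polynomial.aeval_algHom_apply F (X i) P).symm

/-- For the cycle with `f₁ = τ₃` one can conjugate to a map with vanishing `p`. -/
theorem hasStableModel_cycle (ha : a ≠ 0) (hc : c ≠ 0) (he : e ≠ 0)
    (hq : q ∈ supported k {0, 1})
    (hu : IsUnit (ofFun ![triThd e q, triFst a b, triSnd c p])) :
    HasStableModel (ofFun ![triThd e q, triFst a b, triSnd c p]) := by
  set f := ofFun ![triThd e q, triFst a b, triSnd c p] with hf
  have hf0 : f 0 = triThd e q := rfl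
  have hf1 : f 1 = triFst a b := rfl
  have hf2 : f 2 = triSnd c p := rfl
  -- The inverse of `x ↦ a x + b`: then `P = p ∘ l` satisfies `P(a x + b) = p(x)`, so the new
  -- coordinate `z - P(y)` pulls back to `c y`. The first component compensates by adding `e P(y)`
  -- to `q`.
  let l : Polynomial k := Polynomial.C a⁻¹ * (Polynomial.X - Polynomial.C b)
  have hl : Polynomial.aeval (triFst a b) l = X 0 := by
    have haa : (C a⁻¹ * C a : MvPolynomial (Fin 3) k) = 1 := by
      rw [← C_mul, inv_mul_cancel₀ ha, C_1]
    have hl' : Polynomial.aeval (triFst a b) l = C a⁻¹ * (triFst a b - C b) := by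
      simp [l]
    rw [hl']
    linear_combination X 0 * haa
  set P : Polynomial k := p.comp l
  have hPd : P.natDegree ≤ p.natDegree := by
    refine Polynomial.natDegree_comp_le.trans ?_
    have : l.natDegree ≤ 1 := by
      simp only [l]
      compute_degree
    nlinarith
  have hPs : Polynomial.aeval (X 1 : MvPolynomial (Fin 3) k) P ∈ supported k {1} :=
    aeval_X_mem_supported _ _
  set q' : MvPolynomial (Fin 3) k := q + C e * Polynomial.aeval (X 1) P
  have hq' : q' ∈ supported k {0, 1} :=
    add_mem hq (mul_mem (C_mem_supported _ _) (supported_mono (by simp) hPs))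
  set f' := ofFun ![triThd e q', triFst a b, triSnd c 0] with hf'
  have hg0 : f' 0 = triThd e q' := rfl
  have hg1 : f' 1 = triFst a b := rfl
  have hg2 : f' 2 = triSnd c 0 := rfl
  let φ : AffEnd k 3 := elementary 2 1 (-Polynomial.aeval (X 1) P)
  have hPs2 : Polynomial.aeval (X 1 : MvPolynomial (Fin 3) k) P ∈ supported k {2}ᶜ :=
    supported_mono (by simp) hPs
  have hφ : IsUnit φ := isUnit_elementary 2 one_ne_zero (neg_mem hPs2)
  have hφ0 : φ 0 = X 0 := elementary_of_ne (by simp) _ _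
  have hφ1 : φ 1 = X 1 := elementary_of_ne (by simp) _ _
  have hφ2 : φ 2 = X 2 - Polynomial.aeval (X 1) P := by
    simp only [φ, elementary_self, C_1, one_mul, sub_eq_add_neg]
  have hconj : IsConj f f' := by
    refine isConj_of_isUnit hφ ?_
    funext i
    rw [mul_apply, mul_apply]
    fin_cases i
    · change f.subst (φ 0) = φ.subst (f' 0)
      have h1 : φ.subst q = q :=
        subst_elementary_of_mem_supported _ _ (compl_two ▸ hq)
      rw [hφ0, subst_X, hf0, hg0]
      simp only [q', map_add, map_mul, subst_C, subst_X, hφ2, h1, algHom_aeval_X, hφ1]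
      ring
    · change f.subst (φ 1) = φ.subst (f' 1)
      rw [hφ1, subst_X, hf1, hg1]
      simp only [map_add, map_mul, subst_C, subst_X, hφ0]
    · change f.subst (φ 2) = φ.subst (f' 2)
      have hP : f.subst (Polynomial.aeval (X 1) P) = Polynomial.aeval (X 0) p := by
        rw [algHom_aeval_X, subst_X, hf1, Polynomial.aeval_comp, hl]
      rw [hφ2, hg2, map_sub, hP, subst_X, hf2]
      simp only [map_add, map_mul, subst_C, subst_X, hφ1, map_zero, add_zero, add_sub_cancel_right]
  refine ⟨f', ?_, hconj, ?_,
    exists_hasStableEigenvalue_cycle ha hc he hq' (isUnit_of_isConj hconj hu)⟩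
  · refine isPermTriangular_of_vec (a := a) (b := b) (c := c) (e := e) (p := 0) hq'
      ⟨![2, 0, 1], ![1, 2, 0], by decide, by decide⟩ fun i => ?_
    fin_cases i <;> rfl
  · have h := degree_vec_le_iff.1 (hf ▸ le_refl f.degree)
    rw [weightLE_triThd_iff he hq, weightLE_triFst_iff ha, weightLE_triSnd_iff hc] at h
    obtain ⟨⟨h1, h2⟩, -, -, h3⟩ := h
    rw [hf', degree_vec_le_iff, weightLE_triThd_iff he hq', weightLE_triFst_iff ha,
      weightLE_triSnd_iff hc]
    refine ⟨⟨h1, h2.add (WeightLE.C_mul (weightLE_aeval_X_iff.2 (le_trans ?_ h3)) e)⟩, h1, h1,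
      by simp⟩
    simpa using hPd

/-- The largest solution of the equations `d w = u d + v w` from a finite family. -/
theorem exists_maximal_slope {ι : Type*} (s : Finset ι) (u v : ι → ℕ) {d : ℕ} (hd : 0 < d)
    (hv : ∀ x ∈ s, v x < d) (huv : ∀ x ∈ s, u x + v x * d ≤ d ^ 2) :
    ∃ w : ℝ≥0, 1 ≤ d * w ∧ w ≤ d ^ 2 ∧ (∀ x ∈ s, u x * d + v x * w ≤ d * w) ∧
      (1 = d * w ∨ ∃ x ∈ s, u x * d + v x * w = d * w) := by
  classical
  have hd0 : (0 : ℝ) < d := by exact_mod_cast hd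
  have hd1 : (1 : ℝ) ≤ d := by exact_mod_cast hd
  induction s using Finset.induction_on with
  | empty =>
    have hd0' : (d : ℝ≥0) ≠ 0 := by exact_mod_cast hd.ne'
    refine ⟨(d : ℝ≥0)⁻¹, (mul_inv_cancel₀ hd0').ge, ?_, by simp, Or.inl (mul_inv_cancel₀ hd0').symm⟩
    have h1 : (1 : ℝ≥0) ≤ d := by exact_mod_cast hd
    exact (inv_le_one_of_one_le₀ h1).trans (one_le_pow₀ h1)
  | insert x s _ ih =>
    obtain ⟨w, h1, hw, hle, hex⟩ := ih (fun y hy => hv y (Finset.mem_insert_of_mem hy))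
      (fun y hy => huv y (Finset.mem_insert_of_mem hy))
    by_cases hx : u x * d + v x * w ≤ d * w
    · refine ⟨w, h1, hw, fun y hy => ?_, hex.imp_right fun ⟨y, hy, h⟩ =>
        ⟨y, Finset.mem_insert_of_mem hy, h⟩⟩
      rcases Finset.mem_insert.1 hy with rfl | hy
      exacts [hx, hle y hy]
    · rw [not_le] at hx
      have hx' : (d : ℝ) * w < u x * d + v x * w := by exact_mod_cast hx
      have hvx : (0 : ℝ) < d - v x := by
        have : (v x : ℝ) < d := by exact_mod_cast hv x (Finset.mem_insert_self _ _)
        linarith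
      have hux : (u x : ℝ) + v x * d ≤ d ^ 2 := by
        exact_mod_cast huv x (Finset.mem_insert_self _ _)
      -- The solution of `u d + v t = d t` for the violated inequality. The others persist because
      -- `v < d`, and `u + v d ≤ d²` gives `t ≤ d²`.
      obtain ⟨t, ht⟩ : ∃ t : ℝ≥0, (t : ℝ) = u x * d / (d - v x) := ⟨⟨_, by positivity⟩, rfl⟩
      have ht' : (t : ℝ) * (d - v x) = u x * d := by rw [ht]; field_simp
      have hroot : (u x : ℝ) * d + v x * t = d * t := by linarith
      have hwt : (w : ℝ) ≤ t := by
        by_contra h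
        rw [not_le] at h
        nlinarith
      have htd : (t : ℝ) ≤ d ^ 2 := by
        rw [ht, div_le_iff₀ hvx]
        nlinarith
      refine ⟨t, ?_, by exact_mod_cast htd, fun y hy => ?_,
        Or.inr ⟨x, Finset.mem_insert_self _ _, by exact_mod_cast hroot⟩⟩
      · have : (w : ℝ≥0) ≤ t := by exact_mod_cast hwt
        exact h1.trans (by gcongr)
      · rcases Finset.mem_insert.1 hy with rfl | hy
        · have := hroot.le
          exact_mod_cast this
        · have hy' : (u y : ℝ) * d + v y * w ≤ d * w := by exact_mod_cast hle y hy
          have hvy : (v y : ℝ) < d := by exact_mod_cast hv y (Finset.mem_insert_of_mem hy)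
          have : (u y : ℝ) * d + v y * t ≤ d * t := by nlinarith
          exact_mod_cast this

/-- Eigenvectors for the cycle with `f₁ = τ₂`. -/
theorem exists_isEigen_cycle (ha : a ≠ 0) (hc : c ≠ 0) (he : e ≠ 0)
    (hq : q ∈ supported k {0, 1}) :
    ∃ θ : ℝ≥0, 1 ≤ θ ∧ (∃ i j : ℕ, θ ^ 2 = i * θ + j) ∧ ∃ μ : Fin 3 → ℝ≥0, (∀ i, 0 < μ i) ∧
      IsEigen μ θ (ofFun ![triSnd c p, triThd e q, triFst a b]) := by
  set d := p.natDegree with hd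
  obtain ⟨θ, hθ1, hle, hex⟩ := exists_maximal_root q.support (fun m => m 1) (fun m => m 0)
  have hθ0 : 0 < θ := zero_lt_one.trans_le hθ1
  -- Without `p`, the weights `(θ, θ², 1)` turn the second component into `θ² = j θ + i`. If `d ≤ θ`
  -- this remains an eigenvector; if `d > θ`, the term `x^d` dominates and the eigenvalue becomes
  -- `d`.
  rcases le_or_gt (d : ℝ≥0) θ with hdθ | hdθ
  · refine ⟨θ, hθ1, exists_nat_of_maximal_root hex, ![θ, θ ^ 2, 1],
      pos_vec hθ0 (by positivity) one_pos, ?_⟩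
    rw [isEigen_vec_iff, isWeight_triFst_iff ha, isWeight_triSnd_iff hc,
      isWeight_triThd_iff he hq, weightLE_iff_of_mem_supported hq]
    simp only [Matrix.cons_val_zero, Matrix.cons_val_one, Matrix.cons_val, mul_one, ← hd, and_true,
      sq, le_refl, true_and, true_or]
    refine ⟨by gcongr, one_le_mul hθ1 (one_le_mul hθ1 hθ1), fun m hm => ?_, ?_⟩
    · calc (m 0 : ℝ≥0) * θ + m 1 * (θ * θ) = θ * (m 1 * θ + m 0) := by ring
        _ ≤ θ * θ ^ 2 := mul_le_mul_right (hle m hm) _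
        _ = θ * (θ * θ) := by ring
    · rcases hex with h | ⟨m, hm, h⟩
      · left; simp [h]
      · right
        refine ⟨m, hm, ?_⟩
        rw [weight_of_mem_support hq _ hm]
        simp only [Matrix.cons_val_zero, Matrix.cons_val_one]
        calc (m 0 : ℝ≥0) * θ + m 1 * (θ * θ) = θ * (m 1 * θ + m 0) := by ring
          _ = θ * (θ * θ) := by rw [h]; ring
  · have hd1 : (1 : ℝ≥0) ≤ d := hθ1.trans hdθ.le
    have hd0 : (0 : ℝ≥0) < d := zero_lt_one.trans_le hd1
    have hdθ' : (θ : ℝ) < d := by exact_mod_cast hdθ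
    have hθ0' : (0 : ℝ) < θ := by exact_mod_cast hθ0
    have hle' : ∀ m ∈ q.support, (m 1 : ℝ) * θ + m 0 ≤ θ ^ 2 := fun m hm => by
      exact_mod_cast hle m hm
    have hm1 : ∀ m ∈ q.support, (m 1 : ℝ) ≤ θ := fun m hm => by
      have := hle' m hm
      have h0 : (0 : ℝ) ≤ m 0 := Nat.cast_nonneg _
      nlinarith
    -- The weights are `(d, w, 1)`. The bound `w ≤ d²` keeps `c y` below `x^d` in the first
    -- component, and `1 ≤ d w` allows `e z` in the second.
    obtain ⟨w, hw1, hwd, hwle, hwex⟩ := exists_maximal_slope q.support (fun m => m 0)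
      (fun m => m 1) (d := d) (by exact_mod_cast hd0)
      (fun m hm => by exact_mod_cast (hm1 m hm).trans_lt hdθ')
      (fun m hm => by
        have h1 := hle' m hm
        have h2 := hm1 m hm
        have : (m 0 : ℝ) + m 1 * d ≤ d ^ 2 := by nlinarith
        exact_mod_cast this)
    have hw0 : 0 < w := pos_of_ne_zero fun h => by simp [h] at hw1
    refine ⟨d, hd1, ⟨d, 0, by simp [sq]⟩, ![(d : ℝ≥0), w, 1], pos_vec hd0 hw0 one_pos, ?_⟩
    rw [isEigen_vec_iff, isWeight_triFst_iff ha, isWeight_triSnd_iff hc,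
      isWeight_triThd_iff he hq, weightLE_iff_of_mem_supported hq]
    simp only [Matrix.cons_val_zero, Matrix.cons_val_one, Matrix.cons_val, mul_one, ← hd, and_true,
      le_refl, or_true]
    refine ⟨by rwa [← sq], hw1, hwle, hwex.imp_right ?_⟩
    rintro ⟨m, hm, h⟩
    exact ⟨m, hm, by rw [weight_of_mem_support hq _ hm]; simpa using h⟩

/-- For the cycle with `f₁ = τ₂`, the iterates of the leading part can only vanish if there is a
relation between its first two components. -/
theorem leadingNonvanishing_or_relation (ha : a ≠ 0) (hc : c ≠ 0) (he : e ≠ 0)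
    (hq : q ∈ supported k {0, 1}) {μ : Fin 3 → ℝ≥0} {θ : ℝ≥0} (h1 : 1 < θ) (hμ : μ ≠ 0)
    (hE : IsEigen μ θ (ofFun ![triSnd c p, triThd e q, triFst a b])) :
    LeadingNonvanishing μ θ (ofFun ![triSnd c p, triThd e q, triFst a b]) ∨
      (2 ≤ p.natDegree ∧ 0 < μ 0 ∧ μ 1 = p.natDegree * μ 0 ∧
        WeightLE μ (p.natDegree * μ 1) q ∧ ∃ κ : k,
          C c * weightedHomogeneousComponent μ (p.natDegree * μ 1) q +
            C p.leadingCoeff * (C c * X 1 + C p.leadingCoeff * X 0 ^ p.natDegree) ^ p.natDegree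
            = C κ) := by
  set f := ofFun ![triSnd c p, triThd e q, triFst a b] with hf
  set d := p.natDegree with hd
  rw [isEigen_vec_iff, isWeight_triFst_iff ha, isWeight_triSnd_iff hc,
    isWeight_triThd_iff he hq, ← hd] at hE
  obtain ⟨⟨hx1, hx2, hx⟩, ⟨-, hqw, hy⟩, hz⟩ := hE
  have hθ0 : 0 < θ := zero_lt_one.trans h1
  have hμ0 : 0 < μ 0 := by
    refine pos_of_ne_zero fun h0 => hμ ?_
    rw [h0, mul_zero] at hx1
    rw [h0] at hz
    funext i
    fin_cases i
    exacts [h0, le_antisymm hx1 zero_le, (mul_eq_zero.1 hz.symm).resolve_left hθ0.ne']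
  have hFx : (leadingPart μ θ f).subst (X 0) = weightedHomogeneousComponent μ (θ * μ 0)
      (C c * X 1) + weightedHomogeneousComponent μ (θ * μ 0) (Polynomial.aeval (X 0) p) := by
    rw [subst_X]
    simp only [leadingPart, hf, ofFun_apply, Matrix.cons_val_zero, map_add]
  have hdθ : d * μ 0 = θ * μ 0 → (d : ℝ≥0) = θ := fun h => mul_right_cancel₀ hμ0.ne' h
  by_cases hxy : μ 1 = θ * μ 0
  swap
  -- If `y` does not contribute, the first component of the leading part is `γ x^d`, and `k[x]` is
  -- preserved.
  · have hdx := hx.resolve_left hxy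
    have hdθ := hdθ hdx
    have hd0 : d ≠ 0 := by
      rintro h
      rw [h, Nat.cast_zero] at hdθ
      exact hθ0.ne hdθ
    have hp0 : p ≠ 0 := by rintro rfl; simp at hd; omega
    refine Or.inl ⟨0, hμ0, fun r => ?_⟩
    rw [pow_apply_eq_iterate]
    refine iterate_ne_zero_of_aeval (transcendental_X k 0)
      (Q := Polynomial.C p.leadingCoeff * Polynomial.X ^ d) ?_ ?_ r
    · rwa [Polynomial.natDegree_C_mul_X_pow _ _ (Polynomial.leadingCoeff_ne_zero.2 hp0)]
    · rw [hFx, component_C_mul_X, if_neg hxy, zero_add, component_aeval_of_eq hμ0 hdx]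
      simp [hd]
  have hμ1 : 0 < μ 1 := hxy ▸ mul_pos hθ0 hμ0
  have hμ2 : 0 < μ 2 := by
    refine pos_of_ne_zero fun h => ?_
    rw [h, mul_zero] at hz
    exact hμ0.ne' hz
  have hne : μ 2 ≠ θ * μ 1 := by
    refine ((lt_mul_of_one_lt h1 hμ2).trans ?_).ne
    rw [← hz]
    refine (lt_mul_of_one_lt h1 hμ0).trans ?_
    rw [← hxy]
    exact lt_mul_of_one_lt h1 hμ1
  set h := weightedHomogeneousComponent μ (θ * μ 1) q with hh
  have hh0 : h ≠ 0 := component_ne_zero (hy.resolve_left hne)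
  have hhs : h ∈ supported k {0, 1} := component_mem_supported hq
  obtain ⟨ε, hε, hcomp⟩ : ∃ ε : k, ((d * μ 0 = θ * μ 0 ∧ ε = p.leadingCoeff) ∨ ε = 0) ∧
      weightedHomogeneousComponent μ (θ * μ 0) (Polynomial.aeval (X 0) p) = C ε * X 0 ^ d := by
    rcases hx2.eq_or_lt with h | h
    · exact ⟨_, Or.inl ⟨h, rfl⟩, component_aeval_of_eq hμ0 h⟩
    · exact ⟨0, Or.inr rfl, by rw [component_aeval_of_lt h]; simp⟩
  set u : MvPolynomial (Fin 3) k := C c * X 1 + C ε * X 0 ^ d with hu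
  have hus : u ∈ supported k {0, 1} :=
    add_mem (mul_mem (C_mem_supported _ _) (X_mem_supported.2 (by simp)))
      (mul_mem (C_mem_supported _ _) (pow_mem (X_mem_supported.2 (by simp)) d))
  set F := (leadingPart μ θ f).subst with hF
  have hF0 : F (X 0) = u := by
    rw [hFx, component_C_mul_X, if_pos hxy, hcomp]
  have hF1 : F (X 1) = h := by
    rw [hF, subst_X]
    simp only [leadingPart, hf, ofFun_apply, Matrix.cons_val_one, Matrix.cons_val_zero, map_add,
      component_C_mul_X]
    simp [hne, hh]
  have hrs : (C ε * X 0 ^ d : MvPolynomial (Fin 3) k) ∈ supported k {1}ᶜ :=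
    mul_mem (C_mem_supported _ _) (pow_mem (X_mem_supported.2 (by simp)) d)
  -- This change of coordinates makes `u` a variable: `V` sends `u` to `X 1`, so `h` is a polynomial
  -- in `u` alone exactly when `V.subst h` does not involve `X 0`.
  let U : AffEnd k 3 := elementary 1 c (C ε * X 0 ^ d)
  let V : AffEnd k 3 := elementary 1 c⁻¹ (-(C c⁻¹ * (C ε * X 0 ^ d)))
  have hUV : U * V = 1 := elementary_mul_elementary (mul_inv_cancel₀ hc) hrs
  have hVU : V * U = 1 := elementary_mul_elementary' (mul_inv_cancel₀ hc) hrs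
  have hUV' : ∀ P, V.subst (U.subst P) = P := fun P => by rw [← subst_mul, hUV, subst_one]
  have hVU' : ∀ P, U.subst (V.subst P) = P := fun P => by rw [← subst_mul, hVU, subst_one]
  have hU1 : U.subst (X 1) = u := by rw [subst_X]; exact elementary_self _ _ _
  have hVu : V.subst u = X 1 := by rw [← hU1, hUV']
  have hVs : ∀ i ∈ ({0, 1} : Set (Fin 3)), V i ∈ supported k {0, 1} := by
    rintro i (rfl | rfl)
    · rw [show V 0 = X 0 from elementary_of_ne (by simp) _ _]
      exact X_mem_supported.2 (by simp)
    · rw [show V 1 = _ from elementary_self _ _ _]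
      exact add_mem (mul_mem (C_mem_supported _ _) (X_mem_supported.2 (by simp)))
        (neg_mem (mul_mem (C_mem_supported _ _)
          (mul_mem (C_mem_supported _ _) (pow_mem (X_mem_supported.2 (by simp)) d))))
  have hHs : V.subst h ∈ supported k {0, 1} := subst_mem_supported hVs hhs
  by_cases hH : V.subst h ∈ supported k {0}ᶜ
  swap
  · refine Or.inl ⟨0, hμ0, fun r => ?_⟩
    rw [pow_apply_eq_iterate]
    refine iterate_ne_zero_of_injOn (s := {0, 1}) ?_ ?_ (X_mem_supported.2 (by simp))
      (X_ne_zero _) r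
    · rintro i (rfl | rfl)
      · rw [← hF, hF0]; exact hus
      · rw [← hF, hF1]; exact hhs
    · intro P hP hFP
      by_contra hP0
      -- Used for a single iterate: it gives injectivity on `k[x, y]` of `F` followed by `V`, hence
      -- of `F`.
      refine iterate_ne_zero_of_pair (i := 1) (j := 0) (u := X 1) (v := V.subst h)
        (F := V.subst.comp F) (by simp) (X_mem_supported.2 (by simp))
        (fun hX => by simpa using X_mem_supported.1 hX)
        (Set.pair_comm (0 : Fin 3) 1 ▸ hHs) hH (Or.inr ⟨?_, ?_⟩)
        (Set.pair_comm (0 : Fin 3) 1 ▸ hP) hP0 1 ?_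
      · rw [AlgHom.comp_apply, hF1]
      · rw [AlgHom.comp_apply, hF0, hVu]
      · rw [Function.iterate_one, AlgHom.comp_apply, hFP, map_zero]
  have hH1 : V.subst h ∈ supported k {1} :=
    supported_inter (by intro i; fin_cases i <;> simp) hHs hH
  obtain ⟨Q, hQ⟩ := exists_aeval_of_mem_supported_singleton hH1
  have hhQ : h = Polynomial.aeval u Q := by
    rw [← hVU' h, hQ, algHom_aeval_X, hU1]
  have hFu : F u = Polynomial.aeval u
      (Polynomial.C c * Q + Polynomial.C ε * Polynomial.X ^ d) := by
    have h2 : F u = C c * h + C ε * u ^ d := by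
      rw [hu, map_add, map_mul, map_mul, map_pow, hF0, hF1, hF, subst_C, subst_C]
    rw [h2, map_add, map_mul, map_mul, map_pow, Polynomial.aeval_C, Polynomial.aeval_C,
      Polynomial.aeval_X, ← hhQ]
    rfl
  -- Here `h = Q(u)`, so `F` sends `u` to a polynomial in `u`. Only if this polynomial is constant
  -- can the iterates vanish.
  by_cases hR : (Polynomial.C c * Q + Polynomial.C ε * Polynomial.X ^ d).natDegree = 0
  swap
  · have htr : Transcendental k u := by
      rw [transcendental_iff]
      intro P hP
      refine transcendental_iff.1 (transcendental_X k (1 : Fin 3)) P ?_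
      rw [← hVu, Polynomial.aeval_algHom_apply, hP, map_zero]
    refine Or.inl ⟨0, hμ0, fun r => ?_⟩
    rw [pow_apply_eq_iterate]
    cases r with
    | zero => exact X_ne_zero _
    | succ r =>
      rw [Function.iterate_succ_apply, ← hF, hF0]
      exact iterate_ne_zero_of_aeval htr hR hFu r
  · have hκ := Polynomial.eq_C_of_natDegree_eq_zero hR
    set κ := (Polynomial.C c * Q + Polynomial.C ε * Polynomial.X ^ d).coeff 0
    have hrel : C c * h + C ε * u ^ d = C κ := by
      have := congrArg (Polynomial.aeval u) hκ
      rw [map_add, map_mul, map_mul, map_pow, Polynomial.aeval_C, Polynomial.aeval_C,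
        Polynomial.aeval_X, ← hhQ, Polynomial.aeval_C] at this
      exact this
    rcases hε with ⟨hdx, rfl⟩ | rfl
    · have hdθ := hdθ hdx
      refine Or.inr ⟨?_, hμ0, by rw [hxy, hdθ], by rwa [hdθ], κ, by rw [hdθ]; exact hrel⟩
      rw [← hdθ] at h1
      exact_mod_cast h1
    -- Without a contribution of `p`, the relation makes `c h` constant, although `h` is nonzero of
    -- positive weight.
    · exfalso
      obtain ⟨m, hm⟩ := ne_zero_iff.1 hh0
      have hw := (mem_support_component (mem_support_iff.2 hm)).2
      have hm0 : m ≠ 0 := ne_zero_of_weight_ne_zero (μ := μ) (by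
        rw [hw]; exact (mul_pos hθ0 hμ1).ne')
      have h3 := congrArg (coeff m) hrel
      rw [C_0, zero_mul, add_zero, coeff_C_mul, coeff_C, if_neg (Ne.symm hm0)] at h3
      exact hm ((mul_eq_zero.1 h3).resolve_left hc)

end AffEnd

/-! ### Lowering the degree of `p`, and assembly of the cases -/

namespace AffEnd

variable {k : Type*} [Field k] {a b c e : k} {p : Polynomial k} {q : MvPolynomial (Fin 3) k}

/-- For the cycle with `f₁ = τ₂`, a relation between the first two components of the leading part
allows one to lower the degree of `p` by conjugation. -/
theorem exists_isConj_of_relation (ha : a ≠ 0) (hc : c ≠ 0) (he : e ≠ 0)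
    (hq : q ∈ supported k {0, 1}) {μ : Fin 3 → ℝ≥0} (hd2 : 2 ≤ p.natDegree) (hμ0 : 0 < μ 0)
    (hμ1 : μ 1 = p.natDegree * μ 0) (hqw : WeightLE μ (p.natDegree * μ 1) q) {κ : k}
    (hrel : C c * weightedHomogeneousComponent μ (p.natDegree * μ 1) q +
      C p.leadingCoeff * (C c * X 1 + C p.leadingCoeff * X 0 ^ p.natDegree) ^ p.natDegree = C κ) :
    ∃ q' ∈ supported k {0, 1},
      IsConj (ofFun ![triSnd c p, triThd e q, triFst a b])
        (ofFun ![triSnd 1 p.eraseLead, triThd (c * e) q', triFst a b]) ∧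
      (ofFun ![triSnd 1 p.eraseLead, triThd (c * e) q', triFst a b]).degree ≤
        (ofFun ![triSnd c p, triThd e q, triFst a b]).degree := by
  set f := ofFun ![triSnd c p, triThd e q, triFst a b] with hf
  have hf0 : f 0 = triSnd c p := rfl
  have hf1 : f 1 = triThd e q := rfl
  have hf2 : f 2 = triFst a b := rfl
  set d := p.natDegree with hd
  set γ := p.leadingCoeff with hγ
  have hγ0 : γ ≠ 0 := Polynomial.leadingCoeff_ne_zero.2 (by rintro rfl; simp at hd; omega)
  have hrs : (C γ * X 0 ^ d : MvPolynomial (Fin 3) k) ∈ supported k {1}ᶜ :=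
    mul_mem (C_mem_supported _ _) (pow_mem (X_mem_supported.2 (by simp)) d)
  set u : MvPolynomial (Fin 3) k := C c * X 1 + C γ * X 0 ^ d with hu
  let U : AffEnd k 3 := elementary 1 c (C γ * X 0 ^ d)
  let V : AffEnd k 3 := elementary 1 c⁻¹ (-(C c⁻¹ * (C γ * X 0 ^ d)))
  have hVU : V * U = 1 := elementary_mul_elementary' (mul_inv_cancel₀ hc) hrs
  have hVU' : ∀ P, U.subst (V.subst P) = P := fun P => by rw [← subst_mul, hVU, subst_one]
  have hU0 : U 0 = X 0 := elementary_of_ne (by simp) _ _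
  have hU1 : U 1 = u := elementary_self _ _ _
  have hU2 : U 2 = X 2 := elementary_of_ne (by simp) _ _
  have hV0 : V 0 = X 0 := elementary_of_ne (by simp) _ _
  have hV1 : V 1 = C c⁻¹ * X 1 + -(C c⁻¹ * (C γ * X 0 ^ d)) := elementary_self _ _ _
  have hV2 : V 2 = X 2 := elementary_of_ne (by simp) _ _
  -- With `u` as the new second coordinate, the first component becomes `y + p̃(x)`, where `p̃` is
  -- `p` without its leading term. The second is `c (e z + q) + γ x^d` after one step of `f`, with
  -- `q` rewritten through `V`.
  set q' : MvPolynomial (Fin 3) k :=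
    C c * V.subst q + C γ * (X 1 + Polynomial.aeval (X 0) p.eraseLead) ^ d with hq'
  have hps : Polynomial.aeval (X 0 : MvPolynomial (Fin 3) k) p.eraseLead ∈ supported k {0, 1} :=
    supported_mono (by simp) (aeval_X_mem_supported 0 p.eraseLead)
  have hVq : V.subst q ∈ supported k {0, 1} := by
    refine subst_mem_supported ?_ hq
    rintro i (rfl | rfl)
    · rw [hV0]
      exact X_mem_supported.2 (by simp)
    · rw [hV1]
      exact add_mem (mul_mem (C_mem_supported _ _) (X_mem_supported.2 (by simp)))
        (neg_mem (mul_mem (C_mem_supported _ _)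
          (mul_mem (C_mem_supported _ _) (pow_mem (X_mem_supported.2 (by simp)) d))))
  have hq's : q' ∈ supported k {0, 1} :=
    add_mem (mul_mem (C_mem_supported _ _) hVq) (mul_mem (C_mem_supported _ _)
      (pow_mem (add_mem (X_mem_supported.2 (by simp)) hps) d))
  have hup : u + Polynomial.aeval (X 0) p.eraseLead = triSnd c p := by
    rw [triSnd, aeval_eraseLead_add (0 : Fin 3) p, hu]
    ring
  refine ⟨q', hq's, isConj_of_isUnit (isUnit_elementary 1 hc hrs) ?_, ?_⟩
  · set f' := ofFun ![triSnd 1 p.eraseLead, triThd (c * e) q', triFst a b]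
    have hg0 : f' 0 = triSnd 1 p.eraseLead := rfl
    have hg1 : f' 1 = triThd (c * e) q' := rfl
    have hg2 : f' 2 = triFst a b := rfl
    change U * f = f' * U
    funext i
    rw [mul_apply, mul_apply]
    fin_cases i
    · change f.subst (U 0) = U.subst (f' 0)
      rw [hU0, subst_X, hf0, hg0, ← hup]
      simp only [map_add, subst_X, hU0, hU1, algHom_aeval_X, C_1, one_mul]
    · change f.subst (U 1) = U.subst (f' 1)
      rw [hU1, hg1, hu, hq']
      simp only [map_add, map_mul, map_pow, subst_C, subst_X, hU0, hU1, hU2, algHom_aeval_X, hVU',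
        hf0, hf1, hup]
      ring
    · change f.subst (U 2) = U.subst (f' 2)
      rw [hU2, subst_X, hf2, hg2]
      simp only [map_add, map_mul, subst_C, subst_X, hU0]
  · have hdeg := degree_vec_le_iff.1 (show (ofFun ![triSnd c p, triThd e q, triFst a b]).degree ≤
      f.degree from le_rfl)
    rw [weightLE_triThd_iff he hq, weightLE_triFst_iff ha, weightLE_triSnd_iff hc] at hdeg
    obtain ⟨⟨h1, hpd⟩, ⟨-, hqd⟩, -⟩ := hdeg
    -- In the relation, `γ u^d` contributes `γ^(d+1) x^(d²)`, which can only be cancelled by `q`.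
    -- Hence `d² ≤ deg f`, the room needed for `q'`.
    have hmem : Finsupp.single 0 (d * d) ∈ q.support := by
      classical
      have hlead : IsLead (![1, 0, 0] : Fin 3 → ℝ≥0) d u (C γ * X 0 ^ d) := by
        constructor
        · have := ((isWeightedHomogeneous_X k (![1, 0, 0] : Fin 3 → ℝ≥0) 0).pow d).C_mul γ
          simpa using this
        · rw [hu, add_sub_cancel_right]
          intro m hm
          have := (weightLE_X (k := k) (![1, 0, 0] : Fin 3 → ℝ≥0) 1).C_mul c m hm
          refine this.trans_lt ?_
          simp only [Matrix.cons_val_one, Matrix.cons_val_zero]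
          exact_mod_cast (by omega : 0 < d)
      have hcu : coeff (Finsupp.single 0 (d * d)) (u ^ d) = γ ^ d := by
        rw [(hlead.pow d).coeff_eq (by rw [Finsupp.weight_single]; simp), mul_pow,
          ← C_pow, ← pow_mul, coeff_C_mul, coeff_X_pow, if_pos rfl, mul_one]
      have hne : (0 : Fin 3 →₀ ℕ) ≠ Finsupp.single 0 (d * d) := by
        intro h
        have := DFunLike.congr_fun h 0
        simp at this
        omega
      have h2 := congrArg (coeff (Finsupp.single 0 (d * d))) hrel
      rw [coeff_add, coeff_C_mul, coeff_C_mul, hcu, coeff_C, if_neg hne] at h2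
      refine (mem_support_component (μ := μ) (w := d * μ 1) (mem_support_iff.2 fun h0 => ?_)).1
      rw [h0, mul_zero, zero_add] at h2
      exact mul_ne_zero hγ0 (pow_ne_zero d hγ0) h2
    have hdd : (d * d : ℝ≥0) ≤ f.degree := by
      have := hqd _ hmem
      rw [Finsupp.weight_single] at this
      simpa using this
    -- On `x, y` this is `μ` rescaled by `μ₀`. Both `u` and `y + p̃(x)` have weight `d`, so `q'` has
    -- weight at most `d²`; as `d ≥ 1`, this bounds its total degree.
    let ν : Fin 3 → ℝ≥0 := ![1, d, 1]
    have hν0 : ν 0 = 1 := rfl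
    have hν1 : ν 1 = d := rfl
    have hqν : WeightLE ν (d * d) q := by
      rw [weightLE_iff_of_mem_supported hq] at hqw ⊢
      intro m hm
      have h3 := hqw m hm
      rw [hμ1] at h3
      refine le_of_mul_le_mul_right ?_ hμ0
      calc (m 0 * ν 0 + m 1 * ν 1) * μ 0 = m 0 * μ 0 + m 1 * (d * μ 0) := by rw [hν0, hν1]; ring
        _ ≤ d * (d * μ 0) := h3
        _ = d * d * μ 0 := by ring
    have hpν : WeightLE ν d (C γ * X 0 ^ d : MvPolynomial (Fin 3) k) := by
      simpa [hν0] using ((weightLE_X (k := k) ν 0).pow d).C_mul γ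
    have hV : ∀ i, WeightLE ν (1 * ν i) (V i) := by
      intro i
      rw [one_mul]
      fin_cases i
      · change WeightLE ν (ν 0) (V 0)
        rw [hV0]; exact weightLE_X ν 0
      · change WeightLE ν (ν 1) (V 1)
        rw [hV1, ← neg_mul, ← C_neg]
        exact ((weightLE_X ν 1).C_mul _).add (hpν.C_mul _)
      · change WeightLE ν (ν 2) (V 2)
        rw [hV2]; exact weightLE_X ν 2
    have hVν : WeightLE ν (d * d) (V.subst q) := by
      have := hqν.bind₁ hV
      rwa [one_mul] at this
    have heν : WeightLE ν d (Polynomial.aeval (X 0 : MvPolynomial (Fin 3) k) p.eraseLead) := by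
      rw [weightLE_aeval_X_iff, hν0, mul_one]
      exact_mod_cast Polynomial.eraseLead_natDegree_le_aux
    have hq'ν : WeightLE ν (d * d) q' := by
      refine (hVν.C_mul c).add (WeightLE.C_mul ?_ γ)
      have := ((weightLE_X (k := k) ν 1).add heν).pow d
      rwa [nsmul_eq_mul] at this
    have hd1 : (1 : ℝ≥0) ≤ d := by exact_mod_cast (by omega : 1 ≤ d)
    have hq'1 : WeightLE 1 (f.degree : ℝ≥0) q' := by
      rw [weightLE_iff_of_mem_supported hq's] at hq'ν ⊢
      intro m hm
      refine le_trans ?_ ((hq'ν m hm).trans hdd)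
      rw [hν0, hν1]
      simp only [Pi.one_apply]
      gcongr
    rw [degree_vec_le_iff, weightLE_triThd_iff (mul_ne_zero hc he) hq's, weightLE_triFst_iff ha,
      weightLE_triSnd_iff one_ne_zero]
    refine ⟨⟨h1, le_trans ?_ hpd⟩, ⟨h1, hq'1⟩, h1⟩
    have : p.eraseLead.natDegree ≤ d := Polynomial.eraseLead_natDegree_le_aux
    gcongr

/-- The cycle with `f₁ = τ₂`. -/
theorem hasStableModel_cycle' (ha : a ≠ 0) (hc : c ≠ 0) (he : e ≠ 0)
    (hq : q ∈ supported k {0, 1})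
    (hu : IsUnit (ofFun ![triSnd c p, triThd e q, triFst a b])) :
    HasStableModel (ofFun ![triSnd c p, triThd e q, triFst a b]) := by
  -- Each exceptional relation requires `deg p ≥ 2` and strictly lowers `deg p`. The eigenvalue `θ`
  -- is chosen anew at every stage.
  induction hN : p.natDegree using Nat.strong_induction_on generalizing c e p q with
  | _ N ih =>
    obtain ⟨θ, hθ1, ⟨i, j, hH⟩, μ, hμ, hE⟩ :=
      exists_isEigen_cycle (b := b) (p := p) ha hc he hq
    by_cases hS : 1 < θ → ∀ μ : Fin 3 → ℝ≥0, μ ≠ 0 →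
        IsEigen μ θ (ofFun ![triSnd c p, triThd e q, triFst a b]) →
        LeadingNonvanishing μ θ (ofFun ![triSnd c p, triThd e q, triFst a b])
    · refine ⟨_, ?_, IsConj.refl _, le_rfl, θ, hasStableEigenvalue_of hu hθ1 hH
        (upper_of_pos hμ fun i => (hE i).1) ⟨μ, fun h => ?_, hE⟩ hS⟩
      · refine isPermTriangular_of_vec (a := a) (b := b) (c := c) (e := e) (p := p) hq
          ⟨![1, 2, 0], ![2, 0, 1], by decide, by decide⟩ fun i => ?_
        fin_cases i <;> rfl
      · have := hμ 0
        simp [h] at this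
    · push Not at hS
      obtain ⟨hθ, μ, hμ0, hE, hnot⟩ := hS
      obtain ⟨hd2, h0, h1, hqw, κ, hrel⟩ :=
        (leadingNonvanishing_or_relation ha hc he hq hθ hμ0 hE).resolve_left hnot
      obtain ⟨q', hq', hconj, hdeg⟩ :=
        exists_isConj_of_relation (e := e) (b := b) ha hc he hq hd2 h0 h1 hqw hrel
      refine (ih p.eraseLead.natDegree ?_ one_ne_zero (mul_ne_zero hc he) hq'
        (isUnit_of_isConj hconj hu) rfl).of_isConj hconj hdeg
      have := Polynomial.eraseLead_natDegree_le p
      omega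

theorem perm_fin_three (s : Equiv.Perm (Fin 3)) :
    (s 0 = 0 ∧ s 1 = 1 ∧ s 2 = 2) ∨ (s 0 = 1 ∧ s 1 = 0 ∧ s 2 = 2) ∨
    (s 0 = 0 ∧ s 1 = 2 ∧ s 2 = 1) ∨ (s 0 = 2 ∧ s 1 = 1 ∧ s 2 = 0) ∨
    (s 0 = 2 ∧ s 1 = 0 ∧ s 2 = 1) ∨ (s 0 = 1 ∧ s 1 = 2 ∧ s 2 = 0) := by
  have key : ∀ i j l : Fin 3, i ≠ j → i ≠ l → j ≠ l →
      (i = 0 ∧ j = 1 ∧ l = 2) ∨ (i = 1 ∧ j = 0 ∧ l = 2) ∨ (i = 0 ∧ j = 2 ∧ l = 1) ∨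
      (i = 2 ∧ j = 1 ∧ l = 0) ∨ (i = 2 ∧ j = 0 ∧ l = 1) ∨ (i = 1 ∧ j = 2 ∧ l = 0) := by
    decide
  exact key _ _ _ (s.injective.ne (by decide)) (s.injective.ne (by decide))
    (s.injective.ne (by decide))

theorem hasStableModel_of_vec (ha : a ≠ 0) (hc : c ≠ 0) (he : e ≠ 0)
    (hq : q ∈ supported k {0, 1}) (s : Equiv.Perm (Fin 3)) {f : AffEnd k 3}
    (hf : ∀ i, f i = ![triFst a b, triSnd c p, triThd e q] (s i)) (hu : IsUnit f) :
    HasStableModel f := by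
  have hperm : f.IsPermTriangular := isPermTriangular_of_vec hq s hf
  have hfv : ∀ {A B D : MvPolynomial (Fin 3) k}, f 0 = A → f 1 = B → f 2 = D →
      f = ofFun ![A, B, D] := by
    rintro A B D rfl rfl rfl
    funext i
    fin_cases i <;> rfl
  have f0 := hf 0
  have f1 := hf 1
  have f2 := hf 2
  rcases perm_fin_three s with ⟨h0, h1, h2⟩ | ⟨h0, h1, h2⟩ | ⟨h0, h1, h2⟩ | ⟨h0, h1, h2⟩ |
    ⟨h0, h1, h2⟩ | ⟨h0, h1, h2⟩ <;> rw [h0] at f0 <;> rw [h1] at f1 <;> rw [h2] at f2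
  · obtain rfl : f = ofFun ![triFst a b, triSnd c p, triThd e q] := hfv f0 f1 f2
    exact ⟨_, hperm, IsConj.refl _, le_rfl, 1, hasStableEigenvalue_id ha hc he hq hu⟩
  · obtain rfl : f = ofFun ![triSnd c p, triFst a b, triThd e q] := hfv f0 f1 f2
    rcases Nat.lt_or_ge p.natDegree 2 with hp | hp
    · exact ⟨_, hperm, IsConj.refl _, le_rfl, 1,
        hasStableEigenvalue_swap01_of_le ha hc he hq (by omega) hu⟩
    · exact ⟨_, hperm, IsConj.refl _, le_rfl, _,
        hasStableEigenvalue_swap01_of_two_le ha hc he hq hp hu⟩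
  · obtain rfl : f = ofFun ![triFst a b, triThd e q, triSnd c p] := hfv f0 f1 f2
    exact ⟨_, hperm, IsConj.refl _, le_rfl, exists_hasStableEigenvalue_swap12 ha hc he hq hu⟩
  · obtain rfl : f = ofFun ![triThd e q, triSnd c p, triFst a b] := hfv f0 f1 f2
    exact ⟨_, hperm, IsConj.refl _, le_rfl, exists_hasStableEigenvalue_swap02 ha hc he hq hu⟩
  · obtain rfl : f = ofFun ![triThd e q, triFst a b, triSnd c p] := hfv f0 f1 f2
    exact hasStableModel_cycle ha hc he hq hu
  · obtain rfl : f = ofFun ![triSnd c p, triThd e q, triFst a b] := hfv f0 f1 f2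
    exact hasStableModel_cycle' ha hc he hq hu

theorem hasStableModel_of_isAffineTriangular {f : AffEnd k 3} (hf : IsUnit f)
    (hft : f.IsAffineTriangular) : HasStableModel f := by
  obtain ⟨s, t, ht, hconj, hdeg⟩ := hft.exists_isConj
  have hu := isUnit_of_isConj hconj hf
  have htu : IsUnit t := by
    have h1 : (ofFun fun i => X (s i) : AffEnd k 3) * (ofFun fun i => X (s.symm i)) = 1 := by
      funext i
      rw [mul_apply, ofFun_apply, subst_X, ofFun_apply, Equiv.symm_apply_apply, one_apply]
    have h2 : (ofFun fun i => X (s.symm i) : AffEnd k 3) * (ofFun fun i => X (s i)) = 1 := by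
      funext i
      rw [mul_apply, ofFun_apply, subst_X, ofFun_apply, Equiv.apply_symm_apply, one_apply]
    -- Undoing the permutation shows that the triangular factor is itself an automorphism, as the
    -- normal form requires.
    have h3 : t = (ofFun fun i => X (s.symm i)) * ofFun fun i => t (s i) := by
      funext i
      rw [mul_apply, ofFun_apply, subst_X, ofFun_apply, Equiv.apply_symm_apply]
    rw [h3]
    exact (isUnit_iff_exists.2 ⟨_, h2, h1⟩).mul hu
  obtain ⟨a, b, c, e, p, q, ha, hc, he, hq, t0, t1, t2⟩ := ht.exists_normal_form htu
  refine (hasStableModel_of_vec ha hc he hq s (b := b) (p := p) (fun i => ?_) hu).of_isConj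
    hconj hdeg
  rw [ofFun_apply]
  generalize s i = j
  fin_cases j
  exacts [t0, t1, t2]

end AffEnd

end

theorem propositionD {k : Type*} [Field k] (f : AffEnd k 3)
    (hf : f.IsAut) (hft : f.IsAffineTriangular) :
    ∃ f' : AffEnd k 3, f'.IsAut ∧ f'.IsPermTriangular ∧ IsConj f f' ∧ f'.degree ≤ f.degree ∧
      ∃ θ : NNReal, f'.IsMaximalEigenvalue θ ∧
        (θ = 1 ∨ ∀ μ : Fin 3 → NNReal, f'.IsMaximalEigenvector μ → f'.IsMuAlgStable μ) ∧
        f.HasDynamicalDegree θ ∧ f'.HasDynamicalDegree θ ∧ IsHandelman θ := by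
  obtain ⟨f', hp, hc, hd, θ, hθ⟩ := AffEnd.hasStableModel_of_isAffineTriangular hf hft
  exact ⟨f', AffEnd.isUnit_of_isConj hc hf, hp, hc, hd, θ, hθ.isMaximalEigenvalue, hθ.stable,
    (hθ.growth.of_isConj hc).hasDynamicalDegree, hθ.growth.hasDynamicalDegree, hθ.handelman⟩
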